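/- **Setting.** Let $d\ge 2$. Points of $\mathbb R^d$ are row vectors, $e_1=(1,0,\dots,0)$, $x_\perp=(x_2,\dots,x_d)\in\mathbb R^{d-1}$ for $x\in\mathbb R^d$ (and $\mathbb R^{d-1}$ is identified with $\{0\}\times\mathbb R^{d-1}\subset\mathbb R^d$); $\mathcal B^d(x,r)$ are open balls, $\mathcal B^d_r=\mathcal B^d(0,r)$, $v_{d-1}=\operatorname{vol}(\mathcal B^{d-1}_1)$; $\omega$ denotes Lebesgue measure on the unit sphere $S^{d-1}_1$. Fix $R:S^{d-1}_1\to\mathrm{SO}(d)$ with $vR(v)=e_1$ for all $v$, continuous outside one point, and put $D_\rho=\operatorname{diag}(\rho^{d-1},\rho^{-1},\dots,\rho^{-1})$, $0<\rho<1$. Let $\mathcal P\subset\mathbb R^d$ be locally finite, $c_{\mathcal P}>0$, $\Sigma$ a compact metric space with a Borel probability measure $\mathsf m$, and $\varsigma:\mathcal P\to\Sigma$ a marking. Put $\mathcal X=\mathbb R^d\times\Sigma$, $\mu_{\mathcal X}=\operatorname{vol}\times\mathsf m$, $\widetilde{\mathcal P}=\{(p,\varsigma(p)):p\in\mathcal P\}$;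 translations, dilations and matrices act on $\mathcal X$ through the first factor. For $q\in\mathbb R^d$, $v\in S_1^{d-1}$ let $\mathcal Q_\rho(q,v)=(\{(p,\varsigma(p)):p\in\mathcal P\setminus\{q\}\}-q)R(v)D_\rho$. Let $N(\mathcal X)$ be the space of locally finite counting measures on $\mathcal X$ with the vague topology, let $P(N(\mathcal X))$ carry the weak topology, and let $\varsigma\mapsto\mu_\varsigma$ be a continuous map $\Sigma\to P(N(\mathcal X))$; $\Xi_\varsigma$ denotes a point process with law $\mu_\varsigma$. Assume: - [P1] $T^{-d}\,\#(\widetilde{\mathcal P}\cap TB)\to c_{\mathcal P}\,\mu_{\mathcal X}(B)$ as $T\to\infty$, for every bounded $B\subset\mathcal X$ with $\mu_{\mathcal X}(\partial B)=0$. - [P2] There is given a subset $\mathcal E\subset\mathcal P$ of asymptotic density zero such that, with $\mathcal P_T(\rho)=(\mathcal P\cap\mathcal B^d_{T\rho^{1-d}})\setminus\mathcal E$, for every $T\ge1$ and every $\omega$-absolutely continuous Borel probability measure $\lambda$ on $S_1^{d-1}$, the law of $\mathcal Q_\rho(q,v)$ for $v$ random with law $\lambda$ converges weakly to $\mu_{\varsigma(q)}$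 as $\rho\to0$, uniformly over $q\in\mathcal P_T(\rho)$ (uniformly with respect to a metric on $P(N(\mathcal X))$ realizing the weak topology). - [P3] For every bounded Borel set $B\subset\mathbb R^d$, $\lim_{\xi\to\infty}\limsup_{\rho\to0}\,[\operatorname{vol}\times\omega](\{(q,v)\in B\times S_1^{d-1}:\mathcal Q_\rho(\rho^{1-d}q,v)\cap(\mathfrak Z_\xi\times\Sigma)=\emptyset\})=0$, where $\mathfrak Z_\xi=(0,\xi)\times\mathcal B_1^{d-1}$. - [Q1] Each $\mu_\varsigma$ is invariant under $\{k\in\mathrm{SO}(d):e_1k=e_1\}$. - [Q2] For each $\varsigma\in\Sigma$, almost surely no hyperplane $\{x_1\}\times\mathbb R^{d-1}\times\Sigma$ has $\Xi_\varsigma$-mass greater than $1$. - [Q3] For every $\varepsilon>0$ there is $r>0$ such that $\mu_\varsigma(\{\nu:\nu(\mathcal B^d(x,r)\times\Sigma)=0\})<\varepsilon$ for all $\varsigma\in\Sigma$, $x\in\mathbb R^d$. - The set $\{\varsigma(q):q\in\mathcal P\setminus\mathcal E\}$ is dense in $\Sigma$. **Transition kernel.** Let $\Omega=\mathcal B_1^{d-1}\times\Sigma$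 and $\mu_\Omega=v_{d-1}^{-1}\operatorname{vol}_{\mathbb R^{d-1}}\times\mathsf m$. For $Y\in N(\mathcal X)$, viewed as a point set, let $z(Y)\in\mathbb R_{>0}\times\Omega$ be the unique point of $Y\cap((0,\infty)\times\mathcal B_1^{d-1}\times\Sigma)$ with minimal first coordinate ("undefined" if there is none), and let $\iota(\xi,w,\varsigma)=(\xi,-w,\varsigma)$. For $\omega'=(x,\varsigma)\in\mathbb R^{d-1}\times\Sigma$ let $\kappa(\omega';\cdot)$ be the law of $\iota(z(\Xi_\varsigma-x))$ restricted to $\mathbb R_{>0}\times\Omega$, and let $k(\omega',\cdot,\cdot)$ be its Radon–Nikodym derivative with respect to $d\xi\,d\mu_\Omega$. **First collision.** Let $\mathcal K_\rho=\mathbb R^d\setminus\bigcup_{p\in\mathcal P}\mathcal B^d(p,\rho)$. Let $\mathfrak w(\rho)$ be the set of $(q,v)\in\mathcal K_\rho\times S_1^{d-1}$ with either $q\in\mathcal K_\rho^\circ$, or $q\in\partial\mathcal K_\rho$ and $(q-p)\cdot v\ge0$ for all $p\in\mathcal P$ with $\|q-p\|=\rho$. For $(q,v)\in\mathfrak w(\rho)$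 let $\tau_1(q,v;\rho)=\inf\{t>0:q+tv\notin\mathcal K_\rho\}\in[0,\infty]$. A scatterer $\mathcal B^d(p,\rho)$ ($p\in\mathcal P$) is separated if $\|p'-p\|>2\rho$ for all $p'\in\mathcal P\setminus\{p\}$. Let $\mathfrak w(1;\rho)$ be the set of $(q,v)\in\mathfrak w(\rho)$ with $\tau_1(q,v;\rho)<\infty$ such that $q+\tau_1v$ lies on the boundary of a (then unique) separated scatterer $\mathcal B^d(q^{(1)},\rho)$; define $u_1$ by $q+\tau_1v=q^{(1)}+\rho u_1$, $w_1=(u_1R(v))_\perp\in\mathcal B_1^{d-1}$, and $\omega_1(q,v;\rho)=(w_1,\varsigma(q^{(1)}))\in\Omega$. For $U\subset S_1^{d-1}$ open and $\beta\in C_b(U,\mathbb R^d)$ (sup norm) put $q_{\rho,\beta}(v)=q+\rho\beta(v)$ and $\mathfrak w^\beta_{q,\rho}=\{v\in U:(q_{\rho,\beta}(v),v)\in\mathfrak w(1;\rho)\}$. **Theorem.** For every $\omega'\in\mathbb R^{d-1}\times\Sigma$, $\kappa(\omega';\cdot)$ is a probability measure on $\mathbb R_{>0}\times\Omega$ and $k(\omega',\cdot,\cdot)$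 is its density with respect to $d\xi\,d\mu_\Omega$. Moreover, let $U\subset S_1^{d-1}$ be open, let $K\subset C_b(U,\mathbb R^d)$ be relatively compact with $(\beta(v)+\mathbb R_{>0}v)\cap\mathcal B_1^d=\emptyset$ for all $\beta\in K$, $v\in U$, and let $\lambda$ be a Borel probability measure on $S_1^{d-1}$, absolutely continuous with respect to $\omega$, with $\lambda(U)=1$. Then for every $T\ge1$ and every bounded continuous $f:U\times\mathbb R_{>0}\times\Omega\to\mathbb R$, $$\int_{\mathfrak w^\beta_{q,\rho}}f\bigl(v,\rho^{d-1}\tau_1(q_{\rho,\beta}(v),v;\rho),\omega_1(q_{\rho,\beta}(v),v;\rho)\bigr)\,d\lambda(v)-\int_U\int_0^\infty\int_\Omega f(v,\xi,\omega)\,k\bigl(((\beta(v)R(v))_\perp,\varsigma(q)),\xi,\omega\bigr)\,d\mu_\Omega(\omega)\,d\xi\,d\lambda(v)\to0$$ as $\rho\to0$, uniformly over all $q\in\mathcal P_T(\rho)$ and $\beta\in K$. -/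

import Mathlib

open MeasureTheory Filter Topology Set
open scoped BoundedContinuousFunction ENNReal

namespace LorentzGas

noncomputable section

/-! ### Euclidean conventions

The ambient dimension is `d = n + 1`, so that `d - 1 = n`.  Points of `ℝ^d` are row vectors, and
matrices act on them from the right. -/

/-- The Euclidean space `ℝ^n`. -/
abbrev Euc (n : ℕ) : Type := EuclideanSpace ℝ (Fin n)

/-- The unit sphere in `ℝ^d`, `d = n + 1`. -/
abbrev UnitSphere (n : ℕ) : Type := Metric.sphere (0 : Euc (n + 1)) 1

/-- Scatterer radii `0 < ρ < 1`. -/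
abbrev Radius : Type := Set.Ioo (0 : ℝ) 1

/-- `(x₁, x₂, …, x_d)_⊥ = (x₂, …, x_d)`, as a vector in `ℝ^(d-1)`. -/
def perp {n : ℕ} (x : Euc (n + 1)) : Euc n := WithLp.toLp 2 (fun i => x i.succ)

/-- The inclusion of `ℝ^(d-1)` in `ℝ^d` as `{0} × ℝ^(d-1)`. -/
def ofPerp {n : ℕ} (w : Euc n) : Euc (n + 1) :=
  WithLp.toLp 2 (Fin.cons (0 : ℝ) (fun i => w i) : Fin (n + 1) → ℝ)

/-- The first unit vector. -/
def e1 (n : ℕ) : Euc (n + 1) := EuclideanSpace.single 0 1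

/-- The row vector `x A`. -/
def rowMul {n : ℕ} (x : Euc n) (A : Matrix (Fin n) (Fin n) ℝ) : Euc n :=
  WithLp.toLp 2 (Matrix.vecMul x.ofLp A)

/-- `D_ρ = diag(ρ^(d-1), ρ⁻¹, …, ρ⁻¹)`. -/
def scaleMatrix (n : ℕ) (ρ : ℝ) : Matrix (Fin (n + 1)) (Fin (n + 1)) ℝ :=
  Matrix.diagonal (Fin.cons (ρ ^ n) (fun _ => ρ⁻¹) : Fin (n + 1) → ℝ)

/-- A map `R` from the sphere to `SO(d)` with `v R(v) = e₁` for all `v`, continuous outside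
one point. -/
structure FrameMap (n : ℕ) where
  toFun : UnitSphere n → Matrix.specialOrthogonalGroup (Fin (n + 1)) ℝ
  map_to_e1 : ∀ v : UnitSphere n, rowMul (v : Euc (n + 1)) (toFun v).1 = e1 n
  continuousOn_compl : ∃ v₀ : UnitSphere n, ContinuousOn toFun {v₀}ᶜ

/-! ### Counting measures with the vague topology -/

/-- The space `N(X)` of locally finite counting measures on `X`: Borel measures taking (finite)
nonnegative integer values on the relatively compact Borel sets. -/
def CountingMeasures (X : Type*) [TopologicalSpace X] [MeasurableSpace X] : Type _ :=
  {ν : Measure X // ∀ B : Set X, MeasurableSet B → IsCompact (closure B) → ∃ k : ℕ, ν B = k}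

/-- The vague topology: the coarsest one making `ν ↦ ∫ f dν` continuous for each continuous
compactly supported `f`. -/
instance CountingMeasures.instTopologicalSpace (X : Type*) [TopologicalSpace X]
    [MeasurableSpace X] : TopologicalSpace (CountingMeasures X) :=
  ⨅ f : CompactlySupportedContinuousMap X ℝ,
    TopologicalSpace.induced (fun ν : CountingMeasures X => ∫ x, f x ∂ν.1) inferInstance

instance CountingMeasures.instMeasurableSpace (X : Type*) [TopologicalSpace X]
    [MeasurableSpace X] : MeasurableSpace (CountingMeasures X) := borel _

instance CountingMeasures.instBorelSpace (X : Type*) [TopologicalSpace X]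
    [MeasurableSpace X] : BorelSpace (CountingMeasures X) := ⟨rfl⟩

section Counting

variable {X : Type*} [TopologicalSpace X] [MeasurableSpace X] [BorelSpace X]

/-- The point set underlying a counting measure. -/
def CountingMeasures.points (ν : CountingMeasures X) : Set X := {x | ν.1 {x} ≠ 0}

/-- Push-forward of a counting measure under a homeomorphism. -/
def CountingMeasures.map (e : X ≃ₜ X) (ν : CountingMeasures X) : CountingMeasures X :=
  ⟨ν.1.map e, fun B hB hc => by
    rw [Measure.map_apply e.continuous.measurable hB]
    refine ν.2 _ (e.continuous.measurable hB) ?_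
    rw [← e.preimage_closure]
    exact e.isCompact_preimage.2 hc⟩

/-- The counting measure `∑_{y ∈ Y} δ_y` of a locally finite set `Y`. -/
def CountingMeasures.ofSet (Y : Set X) (hY : ∀ C : Set X, IsCompact C → (Y ∩ C).Finite) :
    CountingMeasures X :=
  ⟨Measure.sum (fun y : Y => Measure.dirac (y : X)), fun B hB hc => by
    have hfin : {y : Y | (y : X) ∈ B}.Finite := by
      refine Set.Finite.of_finite_image (f := Subtype.val) ?_ Subtype.val_injective.injOn
      refine (hY _ hc).subset ?_
      rintro _ ⟨y, hy, rfl⟩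
      exact ⟨y.2, subset_closure hy⟩
    refine ⟨hfin.toFinset.card, ?_⟩
    rw [Measure.sum_apply _ hB]
    rw [tsum_eq_sum (s := hfin.toFinset)]
    · rw [Finset.sum_congr rfl (g := fun _ => (1 : ℝ≥0∞))]
      · simp
      · intro y hy
        have : (y : X) ∈ B := by simpa using hy
        rw [Measure.dirac_apply' _ hB]
        simp [this]
    · intro y hy
      have : (y : X) ∉ B := by simpa using hy
      rw [Measure.dirac_apply' _ hB]
      simp [this]⟩

end Counting

/-! ### Uniform weak convergence -/

/-- The topology of weak convergence on the space of probability measures. -/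
abbrev weakTopology (Y : Type*) [TopologicalSpace Y] [MeasurableSpace Y]
    [OpensMeasurableSpace Y] : TopologicalSpace (ProbabilityMeasure Y) :=
  inferInstance

/-- `μ_{j,ρ} → ν_j` weakly as `ρ → 0`, uniformly over `j ∈ J(ρ)`: for some metric on the space of
probability measures realizing the weak topology, the distance tends to zero uniformly. -/
def UniformWeakConv {Y J : Type*} [TopologicalSpace Y] [MeasurableSpace Y]
    [OpensMeasurableSpace Y] (Jr : Radius → Set J)
    (μ : J → Radius → ProbabilityMeasure Y) (ν : J → ProbabilityMeasure Y) : Prop :=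
  ∃ δ : MetricSpace (ProbabilityMeasure Y),
    δ.toPseudoMetricSpace.toUniformSpace.toTopologicalSpace = weakTopology Y ∧
      ∀ ε : ℝ, 0 < ε → ∃ ρ₀ : Radius, ∀ ρ : Radius, ρ < ρ₀ → ∀ j ∈ Jr ρ,
        δ.dist (μ j ρ) (ν j) < ε

/-! ### Marked scatterer configurations -/

/-- The marked space `X = ℝ^d × Σ`. -/
abbrev Marked (n : ℕ) (S : Type*) : Type _ := Euc (n + 1) × S

/-- A locally finite set of scatterer centers in `ℝ^d` with a marking.  Only the values of
`mark` on `centers` are ever used. -/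
structure ScattererConfig (n : ℕ) (S : Type*) where
  centers : Set (Euc (n + 1))
  locallyFinite : ∀ r : ℝ, (centers ∩ Metric.closedBall 0 r).Finite
  mark : Euc (n + 1) → S

variable {n : ℕ} {S : Type*}

/-- The marked point set `{(p, ς(p)) : p ∈ 𝒫}`. -/
def ScattererConfig.marked (Q : ScattererConfig n S) : Set (Marked n S) :=
  (fun p => (p, Q.mark p)) '' Q.centers

/-- The marked point set with the point above `q` (if any) removed. -/
def ScattererConfig.markedRemoving (Q : ScattererConfig n S) (q : Euc (n + 1)) :
    Set (Marked n S) :=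
  {y | y ∈ Q.marked ∧ y.1 ≠ q}

/-- The affine map `(x, ς) ↦ ((x - q) R(v) D_ρ, ς)` to the particle frame. -/
def frameAction (R : FrameMap n) (ρ : ℝ) (q : Euc (n + 1)) (v : UnitSphere n)
    (y : Marked n S) : Marked n S :=
  (rowMul (rowMul (y.1 - q) (R.toFun v).1) (scaleMatrix n ρ), y.2)

/-- The marked point set `𝒬_ρ(q, v)`: the scatterers other than `q`, in the frame of a particle
at `q` with direction `v`. -/
def ScattererConfig.view (Q : ScattererConfig n S) (R : FrameMap n) (ρ : ℝ)
    (q : Euc (n + 1)) (v : UnitSphere n) : Set (Marked n S) :=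
  frameAction R ρ q v '' Q.markedRemoving q

lemma inner_rowMul {m : ℕ} (A : Matrix.specialOrthogonalGroup (Fin m) ℝ) (x y : Euc m) :
    inner ℝ (rowMul x A.1) (rowMul y A.1) = inner ℝ x y := by
  have hA : A.1 * A.1.transpose = 1 := by
    have := (Matrix.mem_specialOrthogonalGroup_iff.1 A.2).1
    have h2 := (Matrix.mem_orthogonalGroup_iff (Fin m) ℝ).1 this
    simpa [Matrix.star_eq_conjTranspose] using h2
  simp only [rowMul, EuclideanSpace.inner_eq_star_dotProduct, star_trivial]
  rw [← Matrix.mulVec_transpose, ← Matrix.mulVec_transpose]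
  rw [Matrix.dotProduct_mulVec, Matrix.vecMul_transpose, Matrix.mulVec_mulVec, hA,
    Matrix.one_mulVec]

lemma norm_rowMul {m : ℕ} (A : Matrix.specialOrthogonalGroup (Fin m) ℝ) (x : Euc m) :
    ‖rowMul x A.1‖ = ‖x‖ := by
  rw [@norm_eq_sqrt_real_inner _ _ _ (rowMul x A.1), inner_rowMul, ← norm_eq_sqrt_real_inner]

lemma norm_sq_split (x : Euc (n + 1)) : ‖x‖ ^ 2 = x 0 ^ 2 + ‖perp x‖ ^ 2 := by
  simp [EuclideanSpace.norm_sq_eq, Fin.sum_univ_succ, perp]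

lemma norm_rowMul_scaleMatrix (ρ : Radius) (x : Euc (n + 1)) :
    (ρ : ℝ) ^ n * ‖x‖ ≤ ‖rowMul x (scaleMatrix n ρ)‖ := by
  obtain ⟨ρ, h0, h1⟩ := ρ
  have hn0 : 0 ≤ ρ ^ n := by positivity
  have h01 : rowMul x (scaleMatrix n ρ) 0 = ρ ^ n * x 0 := by
    simp [rowMul, scaleMatrix, Matrix.vecMul_diagonal, mul_comm]
  have h02 : perp (rowMul x (scaleMatrix n ρ)) = ρ⁻¹ • perp x := by
    ext i
    simp [perp, rowMul, scaleMatrix, Matrix.vecMul_diagonal, mul_comm]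
  have hle : ρ ^ n ≤ ρ⁻¹ :=
    (pow_le_one₀ h0.le h1.le).trans ((one_le_inv₀ h0).2 h1.le)
  refine le_of_sq_le_sq ?_ (norm_nonneg _)
  rw [mul_pow, norm_sq_split x, norm_sq_split (rowMul _ _), h01, h02, norm_smul, mul_pow, mul_pow,
    Real.norm_of_nonneg (by positivity : (0 : ℝ) ≤ ρ⁻¹), mul_add]
  gcongr

lemma ScattererConfig.finite_near (Q : ScattererConfig n S) (q : Euc (n + 1)) (r : ℝ) :
    (Q.centers ∩ Metric.closedBall q r).Finite := by
  refine (Q.locallyFinite (‖q‖ + r)).subset fun p hp => ⟨hp.1, ?_⟩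
  have h1 : dist p q ≤ r := hp.2
  have h2 : dist p 0 ≤ dist p q + dist q 0 := dist_triangle _ _ _
  rw [dist_zero_right q] at h2
  exact Metric.mem_closedBall.2 (by linarith)

lemma ScattererConfig.finite_markedRemoving (Q : ScattererConfig n S) (q : Euc (n + 1)) (r : ℝ) :
    {y | y ∈ Q.markedRemoving q ∧ ‖y.1 - q‖ ≤ r}.Finite := by
  refine ((Q.finite_near q r).image (fun p => (p, Q.mark p))).subset ?_
  rintro y ⟨⟨⟨p, hp, rfl⟩, -⟩, hr⟩
  exact ⟨p, ⟨hp, by simpa [dist_eq_norm] using hr⟩, rfl⟩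

lemma norm_frameAction (R : FrameMap n) (ρ : Radius) (q : Euc (n + 1)) (v : UnitSphere n)
    (y : Marked n S) : (ρ : ℝ) ^ n * ‖y.1 - q‖ ≤ ‖(frameAction R ρ q v y).1‖ := by
  have := norm_rowMul_scaleMatrix ρ (rowMul (y.1 - q) (R.toFun v).1)
  rwa [norm_rowMul] at this

lemma frameAction_injective (R : FrameMap n) (ρ : Radius) (q : Euc (n + 1)) (v : UnitSphere n) :
    Function.Injective (frameAction R ρ q v : Marked n S → Marked n S) := by
  intro y y' h
  have h1 : (frameAction R ρ q v y).1 = (frameAction R ρ q v y').1 := by rw [h]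
  have h2 : (frameAction R ρ q v y).2 = (frameAction R ρ q v y').2 := by rw [h]
  have h3 := norm_frameAction R ρ y'.1 v y
  have h4 : (frameAction R ρ y'.1 v y).1 =
      (frameAction R ρ q v y).1 - (frameAction R ρ q v y').1 := by
    have e : y.1 - y'.1 = (y.1 - q) - (y'.1 - q) := by abel
    simp only [frameAction, rowMul]
    rw [e, WithLp.ofLp_sub, Matrix.sub_vecMul, Matrix.sub_vecMul, WithLp.toLp_sub]
  rw [h4, h1, sub_self, norm_zero] at h3
  have hpos : 0 < (ρ : ℝ) ^ n := pow_pos ρ.2.1 n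
  have h5 : ‖y.1 - y'.1‖ ≤ 0 := by
    by_contra hc
    push Not at hc
    have := mul_pos hpos hc
    linarith
  exact Prod.ext (sub_eq_zero.1 (norm_le_zero_iff.1 h5)) h2

lemma compact_bounded [TopologicalSpace S] {C : Set (Marked n S)} (hC : IsCompact C) :
    ∃ M : ℝ, ∀ y ∈ C, ‖y.1‖ ≤ M :=
  hC.exists_bound_of_continuousOn continuous_fst.continuousOn

lemma ScattererConfig.view_locallyFinite [TopologicalSpace S] (Q : ScattererConfig n S)
    (R : FrameMap n) (ρ : Radius) (q : Euc (n + 1)) (v : UnitSphere n)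
    (C : Set (Marked n S)) (hC : IsCompact C) : (Q.view R ρ q v ∩ C).Finite := by
  obtain ⟨M, hM⟩ := compact_bounded hC
  have hpos : 0 < (ρ : ℝ) ^ n := pow_pos ρ.2.1 n
  refine ((Q.finite_markedRemoving q (M / (ρ : ℝ) ^ n)).image (frameAction R ρ q v)).subset ?_
  rintro _ ⟨⟨y, hy, rfl⟩, hyC⟩
  refine ⟨y, ⟨hy, ?_⟩, rfl⟩
  rw [le_div_iff₀ hpos, mul_comm]
  exact (norm_frameAction R ρ q v y).trans (hM _ hyC)

section View

variable [MetricSpace S] [CompactSpace S] [MeasurableSpace S] [BorelSpace S]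

/-- The counting measure of `𝒬_ρ(q, v)`. -/
def ScattererConfig.viewMeasure (Q : ScattererConfig n S) (R : FrameMap n) (ρ : Radius)
    (q : Euc (n + 1)) (v : UnitSphere n) : CountingMeasures (Marked n S) :=
  CountingMeasures.ofSet (Q.view R ρ q v) (Q.view_locallyFinite R ρ q v)

lemma ScattererConfig.integral_viewMeasure (Q : ScattererConfig n S) (R : FrameMap n)
    (ρ : Radius) (q : Euc (n + 1)) (v : UnitSphere n)
    (f : CompactlySupportedContinuousMap (Marked n S) ℝ) {M : ℝ}
    (hM : ∀ y ∈ tsupport f, ‖y.1‖ ≤ M) :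
    ∫ y, f y ∂(Q.viewMeasure R ρ q v).1 =
      ∑ y ∈ (Q.finite_markedRemoving q (M / (ρ : ℝ) ^ n)).toFinset, f (frameAction R ρ q v y) := by
  have hpos : 0 < (ρ : ℝ) ^ n := pow_pos ρ.2.1 n
  have : IsFiniteMeasureOnCompacts (Q.viewMeasure R ρ q v).1 := ⟨fun C hC => by
    obtain ⟨k, hk⟩ := (Q.viewMeasure R ρ q v).2 C hC.measurableSet
      (by rwa [hC.isClosed.closure_eq])
    rw [hk]
    exact ENNReal.natCast_lt_top k⟩
  have hint : Integrable f (Q.viewMeasure R ρ q v).1 :=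
    f.continuous.integrable_of_hasCompactSupport f.hasCompactSupport
  have h1 := (hasSum_integral_measure (μ := fun y : Q.view R ρ q v =>
    Measure.dirac (y : Marked n S)) hint).tsum_eq
  have h2 : ∀ y : Marked n S, ∫ x, f x ∂(Measure.dirac y) = f y := fun y =>
    integral_dirac' _ _ f.continuous.stronglyMeasurable
  simp only [h2] at h1
  refine Eq.trans h1.symm ?_
  rw [ScattererConfig.view,
    tsum_image (fun y => f y) (frameAction_injective R ρ q v).injOn]
  refine Eq.trans (tsum_subtype (Q.markedRemoving q) (fun y => f (frameAction R ρ q v y))) ?_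
  rw [← Finset.tsum_subtype' (Q.finite_markedRemoving q (M / (ρ : ℝ) ^ n)).toFinset
    (fun y => f (frameAction R ρ q v y)), tsum_subtype
    (↑(Q.finite_markedRemoving q (M / (ρ : ℝ) ^ n)).toFinset : Set (Marked n S))
    (fun y => f (frameAction R ρ q v y))]
  refine tsum_congr fun y => ?_
  have hmem : y ∈ (↑(Q.finite_markedRemoving q (M / (ρ : ℝ) ^ n)).toFinset : Set (Marked n S)) ↔
      y ∈ Q.markedRemoving q ∧ ‖y.1 - q‖ ≤ M / (ρ : ℝ) ^ n := by
    rw [Set.Finite.coe_toFinset]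
    exact Iff.rfl
  by_cases hy : y ∈ Q.markedRemoving q
  · by_cases hr : ‖y.1 - q‖ ≤ M / (ρ : ℝ) ^ n
    · rw [Set.indicator_of_mem hy, Set.indicator_of_mem (hmem.2 ⟨hy, hr⟩)]
    · rw [Set.indicator_of_mem hy, Set.indicator_of_notMem (fun h => hr (hmem.1 h).2)]
      by_contra hne
      refine hr ?_
      rw [le_div_iff₀ hpos, mul_comm]
      exact (norm_frameAction R ρ q v y).trans (hM _ (subset_tsupport _ hne))
  · rw [Set.indicator_of_notMem hy, Set.indicator_of_notMem (fun h => hy (hmem.1 h).1)]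

lemma ScattererConfig.measurable_viewMeasure (Q : ScattererConfig n S) (R : FrameMap n)
    (ρ : Radius) (q : Euc (n + 1)) : Measurable (Q.viewMeasure R ρ q) := by
  obtain ⟨v₀, hv₀⟩ := R.continuousOn_compl
  refine measurable_of_continuousOn_compl_singleton v₀ ?_
  rw [continuousOn_iff_continuous_domRestrict] at hv₀ ⊢
  refine continuous_iInf_rng.2 fun f => continuous_induced_rng.2 ?_
  obtain ⟨M, hM⟩ := compact_bounded f.hasCompactSupport.isCompact
  have : ((fun ν : CountingMeasures (Marked n S) => ∫ x, f x ∂ν.1) ∘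
      ({v₀}ᶜ : Set (UnitSphere n)).domRestrict (Q.viewMeasure R ρ q)) =
      fun v : ({v₀}ᶜ : Set (UnitSphere n)) => ∑ y ∈ (Q.finite_markedRemoving q (M / (ρ : ℝ) ^ n)).toFinset,
        f (frameAction R ρ q v.1 y) := by
    funext v
    exact Q.integral_viewMeasure R ρ q v.1 f hM
  rw [this]
  refine continuous_finsetSum _ fun y _ => f.continuous.comp ?_
  refine Continuous.prodMk ?_ continuous_const
  have hR : Continuous fun v : ({v₀}ᶜ : Set (UnitSphere n)) =>
      ((R.toFun v).1 : Matrix (Fin (n + 1)) (Fin (n + 1)) ℝ) :=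
    continuous_subtype_val.comp hv₀
  refine (PiLp.continuous_toLp 2 _).comp ?_
  refine Continuous.matrix_vecMul ?_ continuous_const
  exact Continuous.matrix_vecMul continuous_const hR

/-- The law of `𝒬_ρ(q, v)` for `v` random with law `λ`. -/
def ScattererConfig.viewLaw (Q : ScattererConfig n S) (R : FrameMap n)
    (lam : ProbabilityMeasure (UnitSphere n)) (q : Euc (n + 1)) (ρ : Radius) :
    ProbabilityMeasure (CountingMeasures (Marked n S)) :=
  lam.map (Q.measurable_viewMeasure R ρ q).aemeasurable

end View

/-! ### The standing assumptions -/

/-- Surface (Lebesgue) measure `ω` on the unit sphere. -/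
def sphereMeasure (n : ℕ) : Measure (UnitSphere n) := (volume : Measure (Euc (n + 1))).toSphere

/-- The open cylinder `{0 < x₁ < ξ, x₂² + ⋯ + x_d² < 1}`. -/
def cylinder (n : ℕ) (ξ : ℝ) : Set (Euc (n + 1)) := {x | 0 < x 0 ∧ x 0 < ξ ∧ ‖perp x‖ < 1}

/-- `𝒫_T(ρ)`: the non-exceptional scatterer centers in the open ball of radius `T ρ^(1-d)`. -/
def ScattererConfig.centersIn (Q : ScattererConfig n S) (E : Set (Euc (n + 1))) (T : ℝ)
    (ρ : Radius) : Set (Euc (n + 1)) :=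
  (Q.centers ∩ Metric.ball 0 (T * ((ρ : ℝ) ^ n)⁻¹)) \ E

/-- The action of a special orthogonal matrix on `X`, `(x, ς) ↦ (x k, ς)`. -/
def rotateHomeo [TopologicalSpace S] (k : Matrix.specialOrthogonalGroup (Fin (n + 1)) ℝ) :
    Marked n S ≃ₜ Marked n S where
  toFun y := (rowMul y.1 k.1, y.2)
  invFun y := (rowMul y.1 (k⁻¹).1, y.2)
  left_inv y := by
    have h : k.1 * (k⁻¹).1 = 1 := congrArg Subtype.val (mul_inv_cancel k)
    simp [rowMul, Matrix.vecMul_vecMul, h]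
  right_inv y := by
    have h : (k⁻¹).1 * k.1 = 1 := congrArg Subtype.val (inv_mul_cancel k)
    simp [rowMul, Matrix.vecMul_vecMul, h]
  continuous_toFun := by
    refine Continuous.prodMk ((PiLp.continuous_toLp 2 _).comp ?_) continuous_snd
    exact ((PiLp.continuous_ofLp 2 _).comp continuous_fst).matrix_vecMul continuous_const
  continuous_invFun := by
    refine Continuous.prodMk ((PiLp.continuous_toLp 2 _).comp ?_) continuous_snd
    exact ((PiLp.continuous_ofLp 2 _).comp continuous_fst).matrix_vecMul continuous_const

/-- The translation `(y, ς) ↦ (y - x, ς)` of `X`. -/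
def shiftHomeo [TopologicalSpace S] (x : Euc (n + 1)) : Marked n S ≃ₜ Marked n S :=
  (Homeomorph.subRight x).prodCongr (Homeomorph.refl S)

/-- The standing assumptions on the marked scatterer configuration: here `c` is the asymptotic
density, `m` the mark distribution, `μ ς` the limiting point process laws and `E` the exceptional
set. -/
structure StandingAssumptions [MetricSpace S] [CompactSpace S] [MeasurableSpace S] [BorelSpace S]
    (R : FrameMap n) (Q : ScattererConfig n S) (c : ℝ) (m : ProbabilityMeasure S)
    (μ : S → ProbabilityMeasure (CountingMeasures (Marked n S))) (E : Set (Euc (n + 1))) :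
    Prop where
  /-- The density is positive. -/
  density_pos : 0 < c
  /-- The limit laws depend continuously on the mark. -/
  continuous_limit : Continuous μ
  /-- [P1], uniform density. -/
  uniform_density : ∀ B : Set (Marked n S), Bornology.IsBounded B →
    ((volume : Measure (Euc (n + 1))).prod (m : Measure S)) (frontier B) = 0 →
    Tendsto (fun T : ℝ =>
        ((Q.marked ∩ (fun y : Marked n S => (T • y.1, y.2)) '' B).ncard : ℝ) / T ^ (n + 1))
      atTop (𝓝 (c * (((volume : Measure (Euc (n + 1))).prod (m : Measure S)) B).toReal))
  /-- The exceptional set consists of scatterer centers … -/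
  exceptional_subset : E ⊆ Q.centers
  /-- … and has asymptotic density zero. -/
  exceptional_density : Tendsto
    (fun T : ℝ => ((E ∩ Metric.ball 0 T).ncard : ℝ) / T ^ (n + 1)) atTop (𝓝 0)
  /-- [P2], spherical equidistribution. -/
  spherical_equidistribution : ∀ T : ℝ, 1 ≤ T → ∀ lam : ProbabilityMeasure (UnitSphere n),
    (lam : Measure (UnitSphere n)) ≪ sphereMeasure n →
    UniformWeakConv (Q.centersIn E T) (Q.viewLaw R lam) (fun q => μ (Q.mark q))
  /-- [P3], no escape of mass. -/
  no_escape : ∀ B : Set (Euc (n + 1)), MeasurableSet B → Bornology.IsBounded B →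
    Tendsto (fun ξ : ℝ => limsup (fun ρ : ℝ =>
        ((volume : Measure (Euc (n + 1))).prod (sphereMeasure n))
          {z | z.1 ∈ B ∧
            Q.view R ρ ((ρ ^ n)⁻¹ • z.1) z.2 ∩ (cylinder n ξ) ×ˢ (univ : Set S) = ∅})
        (𝓝[>] 0)) atTop (𝓝 0)
  /-- [Q1], invariance under `SO(d-1)`. -/
  rotation_invariant : ∀ (s : S) (k : Matrix.specialOrthogonalGroup (Fin (n + 1)) ℝ),
    rowMul (e1 n) k.1 = e1 n →
    (μ s : Measure (CountingMeasures (Marked n S))).map (CountingMeasures.map (rotateHomeo k)) =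
      (μ s : Measure (CountingMeasures (Marked n S)))
  /-- [Q2], coincidence-free first coordinates. -/
  coincidence_free : ∀ s : S, (μ s : Measure (CountingMeasures (Marked n S)))
    {ν | ∃ x₁ : ℝ, 1 < ν.1 {y | y.1 0 = x₁}} = 0
  /-- [Q3], small probability of large voids. -/
  small_voids : ∀ ε : ℝ≥0∞, 0 < ε → ∃ r : ℝ, 0 < r ∧ ∀ (s : S) (x : Euc (n + 1)),
    (μ s : Measure (CountingMeasures (Marked n S)))
      {ν | ν.1 (Metric.ball x r ×ˢ (univ : Set S)) = 0} < ε
  /-- The marks of the non-exceptional centers are dense in the space of marks. -/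
  marks_dense : closure (Q.mark '' (Q.centers \ E)) = univ

/-! ### The transition kernel -/

/-- `Ω = B_1^(d-1) × Σ`. -/
abbrev ImpactSpace (n : ℕ) (S : Type*) : Type _ := Metric.ball (0 : Euc n) 1 × S

/-- `μ_Ω = v_(d-1)⁻¹ vol × m`, where `v_(d-1) = vol(B_1^(d-1))`. -/
def impactMeasure [MeasurableSpace S] (n : ℕ) (m : Measure S) : Measure (ImpactSpace n S) :=
  ((volume : Measure (Euc n)) (Metric.ball 0 1))⁻¹ •
    (((volume : Measure (Euc n)).comap Subtype.val).prod m)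

/-- Lebesgue measure on `ℝ_{>0}`. -/
def posMeasure : Measure (Set.Ioi (0 : ℝ)) := (volume : Measure ℝ).comap Subtype.val

/-- `Δ = (ℝ_{>0} × Ω) ⊔ {undef}`. -/
abbrev HitSpace (n : ℕ) (S : Type*) : Type _ := (Set.Ioi (0 : ℝ) × ImpactSpace n S) ⊕ Unit

/-- `y` is the unique point of `Y` in the infinite half-cylinder `{0 < x₁, ‖x_⊥‖ < 1}` with
minimal first coordinate. -/
def IsFirstPoint (Y : Set (Marked n S)) (y : Marked n S) : Prop :=
  (y ∈ Y ∧ 0 < y.1 0 ∧ ‖perp y.1‖ < 1) ∧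
    ∀ y' ∈ Y, 0 < y'.1 0 → ‖perp y'.1‖ < 1 → y' ≠ y → y.1 0 < y'.1 0

open Classical in
/-- The map `z : N(X) → Δ`, giving the first point of a point set in the half-cylinder. -/
def firstPoint [TopologicalSpace S] [MeasurableSpace S] [BorelSpace S]
    (ν : CountingMeasures (Marked n S)) : HitSpace n S :=
  if h : ∃ y, IsFirstPoint ν.points y then
    Sum.inl (⟨h.choose.1 0, h.choose_spec.1.2.1⟩,
      (⟨perp h.choose.1, by simpa using h.choose_spec.1.2.2⟩, h.choose.2))
  else Sum.inr ()

/-- The reflection `ι(ξ, w, ς) = (ξ, -w, ς)` on `Δ`. -/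
def reflect : HitSpace n S → HitSpace n S
  | Sum.inl z => Sum.inl (z.1, (⟨-z.2.1.1, by
      rw [mem_ball_zero_iff, norm_neg]; exact mem_ball_zero_iff.1 z.2.1.2⟩, z.2.2))
  | Sum.inr u => Sum.inr u

/-- `κ((x, ς); ·)`: the law of `ι(z(Ξ_ς - x))` on `ℝ_{>0} × Ω`, where `Ξ_ς` has law `μ ς`. -/
def hitLaw [TopologicalSpace S] [MeasurableSpace S] [BorelSpace S]
    (μ : S → ProbabilityMeasure (CountingMeasures (Marked n S))) (ω' : Euc n × S) :
    Measure (Set.Ioi (0 : ℝ) × ImpactSpace n S) :=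
  ((μ ω'.2 : Measure (CountingMeasures (Marked n S))).map
    (fun ν => reflect (firstPoint (ν.map (shiftHomeo (ofPerp ω'.1)))))).comap Sum.inl

/-- The transition kernel `k(ω', ξ, ω)`: the density of `κ(ω'; ·)` with respect to
`dξ dμ_Ω(ω)`. -/
def transitionKernel [TopologicalSpace S] [MeasurableSpace S] [BorelSpace S] (m : Measure S)
    (μ : S → ProbabilityMeasure (CountingMeasures (Marked n S))) (ω' : Euc n × S)
    (ξ : Set.Ioi (0 : ℝ)) (ω : ImpactSpace n S) : ℝ :=
  ((hitLaw μ ω').rnDeriv (posMeasure.prod (impactMeasure n m)) (ξ, ω)).toReal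

/-! ### The first collision -/

/-- `𝒦_ρ`, the complement of the open balls of radius `ρ` around the centers. -/
def ScattererConfig.freeSpace (Q : ScattererConfig n S) (ρ : ℝ) : Set (Euc (n + 1)) :=
  (⋃ p ∈ Q.centers, Metric.ball p ρ)ᶜ

/-- `𝔴(ρ)`: the initial conditions `(q, v)` with `q` interior to `𝒦_ρ`, or `q` on the boundary
and `v` outgoing. -/
def ScattererConfig.untrapped (Q : ScattererConfig n S) (ρ : ℝ) :
    Set (Euc (n + 1) × UnitSphere n) :=
  {z | z.1 ∈ interior (Q.freeSpace ρ)} ∪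
    {z | z.1 ∈ frontier (Q.freeSpace ρ) ∧
      ∀ p ∈ Q.centers, ‖z.1 - p‖ = ρ → 0 ≤ inner ℝ (z.1 - p) (z.2 : Euc (n + 1))}

open Classical in
/-- The free path length `τ₁(q, v; ρ)`, equal to `∞` if there is no collision, or if `(q, v)` is
trapped. -/
def ScattererConfig.freePath (Q : ScattererConfig n S) (ρ : ℝ) (q : Euc (n + 1))
    (v : UnitSphere n) : ℝ≥0∞ :=
  if (q, v) ∈ Q.untrapped ρ then
    ⨅ (t : ℝ) (_ : 0 < t ∧ q + t • (v : Euc (n + 1)) ∉ Q.freeSpace ρ), ENNReal.ofReal t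
  else ⊤

/-- The scatterer at `p` is separated. -/
def ScattererConfig.Separated (Q : ScattererConfig n S) (ρ : ℝ) (p : Euc (n + 1)) : Prop :=
  ∀ p' ∈ Q.centers, p' ≠ p → 2 * ρ < ‖p' - p‖

/-- `𝔴(1; ρ)`: the initial conditions leading, in finite time, to a collision with a separated
scatterer. -/
def ScattererConfig.colliding (Q : ScattererConfig n S) (ρ : ℝ) :
    Set (Euc (n + 1) × UnitSphere n) :=
  {z | z ∈ Q.untrapped ρ ∧ Q.freePath ρ z.1 z.2 < ⊤ ∧
    ∃ p ∈ Q.centers, Q.Separated ρ p ∧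
      z.1 + (Q.freePath ρ z.1 z.2).toReal • (z.2 : Euc (n + 1)) ∈ Metric.sphere p ρ}

section Collision

variable {Q : ScattererConfig n S} {ρ : Radius} {q : Euc (n + 1)} {v : UnitSphere n}

/-- The center `q⁽¹⁾` of the (unique) separated scatterer causing the first collision. -/
def hitCenter (h : (q, v) ∈ Q.colliding ρ) : Euc (n + 1) := h.2.2.choose

/-- The normalized hitting position `u₁`, with `q + τ₁ v = q⁽¹⁾ + ρ u₁`. -/
def hitPosition (h : (q, v) ∈ Q.colliding ρ) : Euc (n + 1) :=
  (ρ : ℝ)⁻¹ • (q + (Q.freePath ρ q v).toReal • (v : Euc (n + 1)) - hitCenter h)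

/-- The normalized impact parameter `w₁ = (u₁ R(v))_⊥`. -/
def impactParameter (R : FrameMap n) (h : (q, v) ∈ Q.colliding ρ) : Euc n :=
  perp (rowMul (hitPosition h) (R.toFun v).1)

/-- A particle at a point outside all scatterers, which is outgoing at those it touches, stays
outside all scatterers for a short time. -/
lemma eventually_free (Q : ScattererConfig n S) (ρ : Radius) (y : Euc (n + 1))
    (v : UnitSphere n) (h1 : ∀ p ∈ Q.centers, (ρ : ℝ) ≤ ‖y - p‖)
    (h2 : ∀ p ∈ Q.centers, ‖y - p‖ = ρ → 0 ≤ inner ℝ (y - p) (v : Euc (n + 1))) :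
    ∃ δ : ℝ, 0 < δ ∧ ∀ t : ℝ, 0 < t → t < δ → y + t • (v : Euc (n + 1)) ∈ Q.freeSpace ρ := by
  have hv : ‖(v : Euc (n + 1))‖ = 1 := by simp
  have key : ∀ᶠ t : ℝ in 𝓝[>] 0, ∀ p ∈ Q.centers ∩ Metric.closedBall y (ρ + 1),
      (ρ : ℝ) ≤ ‖y + t • (v : Euc (n + 1)) - p‖ := by
    refine (eventually_all_finite (Q.finite_near y (ρ + 1))).2 fun p hp => ?_
    rcases (h1 p hp.1).eq_or_lt with he | hlt
    · filter_upwards [self_mem_nhdsWithin] with t ht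
      have ht0 : (0 : ℝ) < t := ht
      have hi := h2 p hp.1 he.symm
      have e : y + t • (v : Euc (n + 1)) - p = (y - p) + t • (v : Euc (n + 1)) := by abel
      rw [e]
      refine le_of_sq_le_sq ?_ (norm_nonneg _)
      rw [norm_add_sq_real, ← he, inner_smul_right]
      nlinarith [mul_nonneg ht0.le hi, sq_nonneg ‖t • (v : Euc (n + 1))‖]
    · have hc : Continuous fun t : ℝ => ‖y + t • (v : Euc (n + 1)) - p‖ := by fun_prop
      have ht := hc.tendsto 0
      simp only [zero_smul, add_zero] at ht
      exact ((ht.eventually_const_lt hlt).filter_mono nhdsWithin_le_nhds).mono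
        fun _ h => h.le
  have key1 : ∀ᶠ t : ℝ in 𝓝[>] 0, t < 1 := by
    exact (gt_mem_nhds one_pos).filter_mono nhdsWithin_le_nhds
  obtain ⟨δ, hδ, hδ'⟩ := (mem_nhdsGT_iff_exists_Ioo_subset).1 (key.and key1)
  refine ⟨δ, hδ, fun t ht0 htδ => ?_⟩
  obtain ⟨ha, hb⟩ := hδ' ⟨ht0, htδ⟩
  simp only [ScattererConfig.freeSpace, mem_compl_iff, mem_iUnion, Metric.mem_ball, not_exists,
    not_lt, dist_eq_norm]
  intro p hp
  by_cases hpc : p ∈ Metric.closedBall y (ρ + 1)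
  · exact ha p ⟨hp, hpc⟩
  · have h3 : (ρ : ℝ) + 1 < ‖y - p‖ := by
      simpa [dist_eq_norm, norm_sub_rev] using hpc
    have h4 : ‖y - p‖ ≤ ‖y + t • (v : Euc (n + 1)) - p‖ + ‖t • (v : Euc (n + 1))‖ := by
      have e : y - p = (y + t • (v : Euc (n + 1)) - p) - t • (v : Euc (n + 1)) := by abel
      calc ‖y - p‖ = ‖(y + t • (v : Euc (n + 1)) - p) - t • (v : Euc (n + 1))‖ := by rw [← e]
        _ ≤ _ := norm_sub_le _ _
    rw [norm_smul, hv, Real.norm_of_nonneg ht0.le] at h4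
    linarith

lemma untrapped_far (h : (q, v) ∈ Q.untrapped ρ) {p : Euc (n + 1)} (hp : p ∈ Q.centers) :
    (ρ : ℝ) ≤ ‖q - p‖ := by
  have hclosed : IsClosed (Q.freeSpace ρ) :=
    (isOpen_biUnion fun p _ => Metric.isOpen_ball).isClosed_compl
  have hq : q ∈ Q.freeSpace ρ := by
    rcases h with h | h
    · exact interior_subset h
    · exact hclosed.frontier_subset h.1
  simp only [ScattererConfig.freeSpace, mem_compl_iff, mem_iUnion, Metric.mem_ball, not_exists,
    not_lt, dist_eq_norm] at hq
  exact hq p hp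

lemma untrapped_outgoing (h : (q, v) ∈ Q.untrapped ρ) {p : Euc (n + 1)} (hp : p ∈ Q.centers)
    (hqp : ‖q - p‖ = ρ) : 0 ≤ inner ℝ (q - p) (v : Euc (n + 1)) := by
  rcases h with h | h
  · exfalso
    have hint : q ∈ interior ((Metric.ball p (ρ : ℝ))ᶜ) :=
      interior_mono (compl_subset_compl.2 (subset_biUnion_of_mem hp)) h
    rw [interior_compl, closure_ball _ (ne_of_gt ρ.2.1)] at hint
    exact hint (by simp [dist_eq_norm, hqp])
  · exact h.2 p hp hqp

/-- The free path length is positive for collisions. -/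
lemma freePath_pos (h : (q, v) ∈ Q.colliding ρ) : 0 < (Q.freePath ρ q v).toReal := by
  obtain ⟨δ, hδ, hfree⟩ := eventually_free Q ρ q v (fun p hp => untrapped_far h.1 hp)
    (fun p hp => untrapped_outgoing h.1 hp)
  refine ENNReal.toReal_pos (ne_of_gt ?_) h.2.1.ne
  refine (ENNReal.ofReal_pos.2 hδ).trans_le ?_
  rw [ScattererConfig.freePath, if_pos h.1]
  refine le_iInf₂ fun t ht => ENNReal.ofReal_le_ofReal ?_
  by_contra hc
  exact ht.2 (hfree t ht.1 (not_le.1 hc))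

lemma hitCenter_unique (h : (q, v) ∈ Q.colliding ρ) {p : Euc (n + 1)} (hp : p ∈ Q.centers)
    (hpd : ‖q + (Q.freePath ρ q v).toReal • (v : Euc (n + 1)) - p‖ ≤ ρ) : p = hitCenter h := by
  obtain ⟨-, hsep, hs⟩ := h.2.2.choose_spec
  by_contra hne
  have h1 := hsep p hp hne
  rw [mem_sphere_iff_norm] at hs
  have h2 := norm_sub_le
    (q + (Q.freePath ρ q v).toReal • (v : Euc (n + 1)) - h.2.2.choose)
    (q + (Q.freePath ρ q v).toReal • (v : Euc (n + 1)) - p)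
  have e : (q + (Q.freePath ρ q v).toReal • (v : Euc (n + 1)) - h.2.2.choose) -
    (q + (Q.freePath ρ q v).toReal • (v : Euc (n + 1)) - p) = p - h.2.2.choose := by abel
  rw [e] at h2
  simp only at hs
  linarith

/-- The impact parameter lies in the open unit ball. -/
lemma impactParameter_mem (R : FrameMap n) (h : (q, v) ∈ Q.colliding ρ) :
    impactParameter R h ∈ Metric.ball (0 : Euc n) 1 := by
  obtain ⟨hpP, hsep, hs⟩ := h.2.2.choose_spec
  have hρ : (0 : ℝ) < ρ := ρ.2.1
  set τ := (Q.freePath ρ q v).toReal with hτ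
  set y := q + τ • (v : Euc (n + 1)) with hy
  have hs' : ‖y - hitCenter h‖ = ρ := mem_sphere_iff_norm.1 hs
  have hu : ‖hitPosition h‖ = 1 := by
    rw [hitPosition, norm_smul, Real.norm_of_nonneg (inv_nonneg.2 hρ.le)]
    rw [← hτ, ← hy, hs', inv_mul_cancel₀ hρ.ne']
  have h0 : rowMul (hitPosition h) (R.toFun v).1 0 =
      inner ℝ (hitPosition h) (v : Euc (n + 1)) := by
    rw [← inner_rowMul (R.toFun v) (hitPosition h) v, R.map_to_e1, e1]
    simp [EuclideanSpace.inner_single_right]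
  have hsplit := norm_sq_split (rowMul (hitPosition h) (R.toFun v).1)
  rw [norm_rowMul, hu, h0] at hsplit
  rw [mem_ball_zero_iff]
  by_contra hge
  rw [not_lt] at hge
  change 1 ≤ ‖perp (rowMul (hitPosition h) (R.toFun v).1)‖ at hge
  have hin : inner ℝ (hitPosition h) (v : Euc (n + 1)) = 0 := by
    have : (1 : ℝ) ≤ ‖perp (rowMul (hitPosition h) (R.toFun v).1)‖ ^ 2 := one_le_pow₀ hge
    have h3 : (inner ℝ (hitPosition h) (v : Euc (n + 1)) : ℝ) ^ 2 ≤ 0 := by linarith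
    exact pow_eq_zero_iff two_ne_zero |>.1 (le_antisymm h3 (sq_nonneg _))
  have hin2 : inner ℝ (y - hitCenter h) (v : Euc (n + 1)) = 0 := by
    rw [hitPosition, real_inner_smul_left] at hin
    exact (mul_eq_zero.1 hin).resolve_left (inv_ne_zero hρ.ne')
  have hfar : ∀ p ∈ Q.centers, (ρ : ℝ) ≤ ‖y - p‖ := by
    intro p hp
    by_contra hc
    rw [not_le] at hc
    have := hitCenter_unique h hp hc.le
    rw [this, hs'] at hc
    exact lt_irrefl _ hc
  obtain ⟨δ, hδ, hfree⟩ := eventually_free Q ρ y v hfar (fun p hp he => by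
    rw [hitCenter_unique h hp he.le, hin2])
  have hyfree : y ∈ Q.freeSpace ρ := by
    simp only [ScattererConfig.freeSpace, mem_compl_iff, mem_iUnion, Metric.mem_ball, not_exists,
      not_lt, dist_eq_norm]
    exact hfar
  have hτpos : 0 < τ := freePath_pos h
  have hle : ENNReal.ofReal (τ + δ) ≤ Q.freePath ρ q v := by
    have hlow : ∀ t : ℝ, (0 < t ∧ q + t • (v : Euc (n + 1)) ∉ Q.freeSpace ρ) →
        Q.freePath ρ q v ≤ ENNReal.ofReal t := by
      intro t ht
      rw [ScattererConfig.freePath, if_pos h.1]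
      exact iInf₂_le t ht
    conv_rhs => rw [ScattererConfig.freePath, if_pos h.1]
    refine le_iInf₂ fun t ht => ENNReal.ofReal_le_ofReal ?_
    have h1 : τ ≤ t := by
      have := ENNReal.toReal_mono ENNReal.ofReal_ne_top (hlow t ht)
      rwa [ENNReal.toReal_ofReal ht.1.le] at this
    by_contra hc
    rw [not_le] at hc
    rcases h1.eq_or_lt with he | hlt
    · rw [← he] at ht
      exact ht.2 hyfree
    · refine ht.2 ?_
      have := hfree (t - τ) (by linarith) (by linarith)
      have e : y + (t - τ) • (v : Euc (n + 1)) = q + t • (v : Euc (n + 1)) := by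
        rw [hy, sub_smul]
        abel
      rwa [e] at this
  have := ENNReal.toReal_mono h.2.1.ne hle
  rw [ENNReal.toReal_ofReal (by linarith)] at this
  change τ + δ ≤ τ at this
  linarith

/-- The pair `(ρ^(d-1) τ₁, ω₁)` of the normalized free path length and
`ω₁ = (w₁, ς(q⁽¹⁾)) ∈ Ω`. -/
def collisionData (R : FrameMap n) (h : (q, v) ∈ Q.colliding ρ) :
    Set.Ioi (0 : ℝ) × ImpactSpace n S :=
  (⟨(ρ : ℝ) ^ n * (Q.freePath ρ q v).toReal,
      mul_pos (pow_pos ρ.2.1 n) (freePath_pos h)⟩,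
    (⟨impactParameter R h, impactParameter_mem R h⟩, Q.mark (hitCenter h)))

end Collision

/-- The starting point `q + ρ β(v)`. -/
def startPoint {U : Set (UnitSphere n)} (ρ : Radius) (q : Euc (n + 1))
    (β : U →ᵇ Euc (n + 1)) (v : U) : Euc (n + 1) := q + (ρ : ℝ) • β v

/-- The set of `v ∈ U` such that the particle starting at `q + ρ β(v)` with velocity `v` collides
with a separated scatterer. -/
def ScattererConfig.collidingVelocities (Q : ScattererConfig n S) {U : Set (UnitSphere n)}
    (ρ : Radius) (q : Euc (n + 1)) (β : U →ᵇ Euc (n + 1)) : Set U :=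
  {v | (startPoint ρ q β v, (v : UnitSphere n)) ∈ Q.colliding ρ}

open Classical in
/-- The integral of `f(v, ρ^(d-1) τ₁, ω₁)` over the set of colliding velocities, with respect to
`λ`. -/
def collisionIntegral [TopologicalSpace S] (R : FrameMap n) (Q : ScattererConfig n S)
    {U : Set (UnitSphere n)} (lam : Measure (UnitSphere n))
    (f : (U × Set.Ioi (0 : ℝ) × ImpactSpace n S) →ᵇ ℝ)
    (ρ : Radius) (q : Euc (n + 1)) (β : U →ᵇ Euc (n + 1)) : ℝ :=
  ∫ v in Q.collidingVelocities ρ q β,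
    (if h : (startPoint ρ q β v, (v : UnitSphere n)) ∈ Q.colliding ρ then
      f (v, collisionData R h) else 0) ∂(lam.comap Subtype.val)

/-- The limit: the integral of `f(v, ξ, ω) k(((β(v) R(v))_⊥, ς), ξ, ω)`. -/
def limitIntegral [TopologicalSpace S] [MeasurableSpace S] [BorelSpace S] (R : FrameMap n)
    (m : Measure S) (μ : S → ProbabilityMeasure (CountingMeasures (Marked n S)))
    {U : Set (UnitSphere n)} (lam : Measure (UnitSphere n))
    (f : (U × Set.Ioi (0 : ℝ) × ImpactSpace n S) →ᵇ ℝ)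
    (s : S) (β : U →ᵇ Euc (n + 1)) : ℝ :=
  ∫ v : U, ∫ ξ : Set.Ioi (0 : ℝ), ∫ ω : ImpactSpace n S,
    f (v, ξ, ω) * transitionKernel m μ (perp (rowMul (β v) (R.toFun v).1), s) ξ ω
    ∂(impactMeasure n m) ∂posMeasure ∂(lam.comap Subtype.val)

end

end LorentzGas

set_option linter.unusedSectionVars false
set_option linter.style.longLine false

namespace LorentzGas

noncomputable section

namespace CountingMeasures

/-! ### Counting measures on proper metric spaces -/

section Proper

variable {X : Type*} [MetricSpace X] [ProperSpace X] [MeasurableSpace X] [BorelSpace X]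

/-! Here d = n + 1. Seen from a scatterer and rescaled, the configuration converges to Ξ_ς. Up to an
error of order ρ^d, the first collision is the first point of the rescaled configuration in the unit
cylinder over the exit parameter. The theorem is thus a continuous mapping argument: the first-point
map must be almost surely continuous under each `μ ς`, and the convergence must be made joint with v
and uniform in q and β.

General position (`Good`, `StandingAssumptions.ae_good`). Almost surely no point of the limit
process has first coordinate 0 or lies on the wall of the cylinder, because the intensity is
absolutely continuous (`StandingAssumptions.intensity_absolutelyContinuous`). Indeed the expected
number of points of 𝒬_ρ(q,v) in a region is a sum over centers of the probability that the random
direction carries the center into the region; cap estimates and the count in [P1] bound this sum,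
and the bound passes to the limit on open sets. Distinct first coordinates are [Q2]. The cylinder is
not empty because `μ ς` is invariant under D_a (`StandingAssumptions.map_stretch`): stretching makes
the cylinder contain a ball as large as [Q3] requires.

Stability. A configuration is recorded by its integrals against countably many bump functions
(`CountingMeasures.testVec`), so that limits are taken in a separable metrizable space. Masses are
integers, hence a configuration close to a good one has exactly one point near the limiting first
point and no other in a fixed enlargement of the relevant region (`Good.eventually_first`). This
makes κ lower semicontinuous on open sets (`StandingAssumptions.hitLaw_le_liminf`); together with
the deterministic statement `exists_colliding` it also controls the actual collision
(`Good.eventually_colliding`).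

Joint law. Conditioning λ on an event keeps it absolutely continuous, so [P2] applies to the
conditional laws and yields independence of direction and view in the limit
(`StandingAssumptions.prod_le_liminf_view`). Hence the collision laws satisfy the open-set lower
bound with the expected limit (`StandingAssumptions.jointLaw_le_liminf`). The limit has mass one and
the collision laws have mass at most one, so this one-sided bound already forces convergence of
integrals (`tendsto_integral_of_isOpen`); the non-colliding directions need no separate estimate.

Uniformity. A sequence violating it has, by compactness of Σ and of the closure of K, a subsequence
along which marks and exit functions converge. Along it the collision integrals and the limit
integrals tend to the same number (`StandingAssumptions.exists_radius`). -/

instance (ν : CountingMeasures X) : IsFiniteMeasureOnCompacts ν.1 := ⟨fun C hC => by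
  obtain ⟨k, hk⟩ := ν.2 C hC.measurableSet (by rwa [hC.isClosed.closure_eq])
  rw [hk]
  exact ENNReal.natCast_lt_top k⟩

lemma integrable (ν : CountingMeasures X) (f : CompactlySupportedContinuousMap X ℝ) :
    Integrable f ν.1 :=
  f.continuous.integrable_of_hasCompactSupport f.hasCompactSupport

lemma continuous_integral (f : CompactlySupportedContinuousMap X ℝ) :
    Continuous fun ν : CountingMeasures X => ∫ x, f x ∂ν.1 :=
  continuous_iInf_dom (i := f) continuous_induced_dom

/-- A compactly supported continuous function from a continuous one vanishing off a closed
ball. -/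
def compactlySupported (f : X → ℝ) (hf : Continuous f) (a : X) (r : ℝ)
    (h : ∀ x, x ∉ Metric.closedBall a r → f x = 0) : CompactlySupportedContinuousMap X ℝ where
  toFun := f
  continuous_toFun := hf
  hasCompactSupport' := HasCompactSupport.intro (isCompact_closedBall a r) (fun x hx => h x hx)

/-- Compactly supported functions increasing to the indicator function of an open set. -/
def openApprox (x₀ : X) (G : Set X) (k : ℕ) : CompactlySupportedContinuousMap X ℝ :=
  compactlySupported
    (fun x => (1 - (thickenedIndicator (Nat.one_div_pos_of_nat (α := ℝ) (n := k)) Gᶜ x : ℝ)) *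
      max 0 (min 1 ((k : ℝ) + 1 - dist x x₀)))
    (by
      refine Continuous.mul ?_ (by fun_prop)
      exact continuous_const.sub (NNReal.continuous_coe.comp
        (thickenedIndicator (Nat.one_div_pos_of_nat (α := ℝ) (n := k)) Gᶜ).continuous))
    x₀ (k + 1) (fun x hx => by
      have : (k : ℝ) + 1 < dist x x₀ := by simpa using hx
      rw [max_eq_left, mul_zero]
      exact (min_le_right _ _).trans (by linarith))

lemma openApprox_apply (x₀ : X) (G : Set X) (k : ℕ) (x : X) : openApprox x₀ G k x =
    (1 - (thickenedIndicator (Nat.one_div_pos_of_nat (α := ℝ) (n := k)) Gᶜ x : ℝ)) *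
      max 0 (min 1 ((k : ℝ) + 1 - dist x x₀)) := rfl

lemma openApprox_nonneg (x₀ : X) (G : Set X) (k : ℕ) (x : X) : 0 ≤ openApprox x₀ G k x := by
  rw [openApprox_apply]
  refine mul_nonneg (sub_nonneg.2 ?_) (le_max_left _ _)
  exact_mod_cast thickenedIndicator_le_one (Nat.one_div_pos_of_nat (α := ℝ) (n := k)) Gᶜ x

lemma openApprox_mono (x₀ : X) (G : Set X) (x : X) : Monotone fun k => openApprox x₀ G k x := by
  intro k l hkl
  simp only [openApprox_apply]
  have hkl' : (k : ℝ) ≤ l := by exact_mod_cast hkl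
  refine mul_le_mul (sub_le_sub_left ?_ _) ?_ (le_max_left _ _) (sub_nonneg.2 ?_)
  · exact_mod_cast thickenedIndicator_mono (Nat.one_div_pos_of_nat (α := ℝ) (n := l))
      (Nat.one_div_pos_of_nat (α := ℝ) (n := k)) (Nat.one_div_le_one_div hkl) Gᶜ x
  · gcongr
  · exact_mod_cast thickenedIndicator_le_one (Nat.one_div_pos_of_nat (α := ℝ) (n := l)) Gᶜ x

lemma tendsto_openApprox (x₀ : X) {G : Set X} (hG : IsOpen G) (x : X) :
    Tendsto (fun k => openApprox x₀ G k x) atTop (𝓝 (G.indicator (fun _ => 1) x)) := by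
  have h1 := thickenedIndicator_tendsto_indicator_closure
    (fun k => Nat.one_div_pos_of_nat (α := ℝ) (n := k)) tendsto_one_div_add_atTop_nhds_zero_nat Gᶜ
  rw [tendsto_pi_nhds] at h1
  have h2 := NNReal.tendsto_coe.2 (h1 x)
  rw [hG.isClosed_compl.closure_eq] at h2
  have h3 : Tendsto (fun k : ℕ => max 0 (min 1 ((k : ℝ) + 1 - dist x x₀))) atTop (𝓝 1) := by
    refine tendsto_const_nhds.congr' ?_
    filter_upwards [(tendsto_natCast_atTop_atTop (R := ℝ)).eventually_ge_atTop (dist x x₀)] with k hk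
    rw [min_eq_left (by linarith), max_eq_right zero_le_one]
  have h4 := (h2.const_sub 1).mul h3
  refine (h4.congr fun k => (openApprox_apply x₀ G k x).symm).trans (le_of_eq ?_)
  congr 1
  by_cases hx : x ∈ G <;> simp [hx]

lemma ofReal_integral (ν : CountingMeasures X) (f : CompactlySupportedContinuousMap X ℝ)
    (hf : ∀ x, 0 ≤ f x) :
    ENNReal.ofReal (∫ x, f x ∂ν.1) = ∫⁻ x, ENNReal.ofReal (f x) ∂ν.1 :=
  ofReal_integral_eq_lintegral_ofReal (ν.integrable f) (ae_of_all _ hf)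

lemma tendsto_integral_openApprox (x₀ : X) {G : Set X} (hG : IsOpen G) (ν : CountingMeasures X) :
    Tendsto (fun k => ENNReal.ofReal (∫ x, openApprox x₀ G k x ∂ν.1)) atTop (𝓝 (ν.1 G)) := by
  simp_rw [ofReal_integral ν _ (openApprox_nonneg x₀ G _)]
  rw [← lintegral_indicator_one hG.measurableSet]
  refine lintegral_tendsto_of_tendsto_of_monotone
    (fun k => (openApprox x₀ G k).continuous.measurable.ennreal_ofReal.aemeasurable) ?_ ?_
  · exact ae_of_all _ fun x _ _ hkl => ENNReal.ofReal_le_ofReal (openApprox_mono x₀ G x hkl)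
  · refine ae_of_all _ fun x => ?_
    have := ENNReal.tendsto_ofReal (tendsto_openApprox x₀ hG x)
    refine this.trans (le_of_eq ?_)
    congr 1
    by_cases hx : x ∈ G <;> simp [hx]

lemma monotone_integral_openApprox (x₀ : X) (G : Set X) (ν : CountingMeasures X) :
    Monotone fun k => ∫ x, openApprox x₀ G k x ∂ν.1 := fun _ _ hkl =>
  integral_mono (ν.integrable _) (ν.integrable _) fun x => openApprox_mono x₀ G x hkl

lemma measurable_apply_isOpen {G : Set X} (hG : IsOpen G) :
    Measurable fun ν : CountingMeasures X => ν.1 G := by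
  rcases isEmpty_or_nonempty X with h | ⟨⟨x₀⟩⟩
  · have : G = ∅ := Set.eq_empty_of_isEmpty G
    simp [this]
  · exact measurable_of_tendsto_metrizable
      (fun k => (continuous_integral (openApprox x₀ G k)).measurable.ennreal_ofReal)
      (tendsto_pi_nhds.2 fun ν => tendsto_integral_openApprox x₀ hG ν)

/-- Masses of open sets are limits of vaguely continuous functions. The π-system argument needs
finite measures, so it is run on restrictions to balls, which then exhaust the space. -/
lemma measurable_val : Measurable fun ν : CountingMeasures X => ν.1 := by
  rcases isEmpty_or_nonempty X with h | ⟨⟨x₀⟩⟩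
  · refine Measure.measurable_of_measurable_coe _ fun s _ => ?_
    have : s = ∅ := Set.eq_empty_of_isEmpty s
    simp [this]
  have key : ∀ k : ℕ, Measurable fun ν : CountingMeasures X =>
      ν.1.restrict (Metric.ball x₀ k) := fun k => by
    have hfin : ∀ ν : CountingMeasures X, IsFiniteMeasure (ν.1.restrict (Metric.ball x₀ k)) :=
      fun ν => ⟨by
        rw [Measure.restrict_apply_univ]
        exact (measure_mono Metric.ball_subset_closedBall).trans_lt
          (isCompact_closedBall x₀ k).measure_lt_top⟩
    refine Measurable.measure_of_isPiSystem (S := {s | IsOpen s}) (BorelSpace.measurable_eq)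
      isPiSystem_isOpen (fun s hs => ?_) ?_
    · simp_rw [Measure.restrict_apply (IsOpen.measurableSet hs)]
      exact measurable_apply_isOpen (IsOpen.inter hs Metric.isOpen_ball)
    · simp_rw [Measure.restrict_apply_univ]
      exact measurable_apply_isOpen Metric.isOpen_ball
  refine Measure.measurable_of_measurable_coe _ fun s hs => ?_
  have h2 : ∀ ν : CountingMeasures X, Tendsto (fun k : ℕ => ν.1.restrict (Metric.ball x₀ k) s)
      atTop (𝓝 (ν.1 s)) := fun ν => by
    simp_rw [Measure.restrict_apply hs]
    have h3 := tendsto_measure_iUnion_atTop (μ := ν.1) (s := fun k : ℕ => s ∩ Metric.ball x₀ k)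
      (fun k l hkl => inter_subset_inter_right _ (Metric.ball_subset_ball (by exact_mod_cast hkl)))
    rwa [← inter_iUnion, Metric.iUnion_ball_nat, inter_univ] at h3
  exact measurable_of_tendsto_metrizable
    (fun k => (Measure.measurable_coe hs).comp (key k)) (tendsto_pi_nhds.2 h2)

lemma measurable_apply {A : Set X} (hA : MeasurableSet A) :
    Measurable fun ν : CountingMeasures X => ν.1 A :=
  (Measure.measurable_coe hA).comp measurable_val

/-- The intensity of an open set is lower semicontinuous under weak convergence. -/
lemma lintegral_apply_isOpen_le_liminf {ι : Type*} {l : Filter ι}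
    {P : ProbabilityMeasure (CountingMeasures X)}
    {Pi : ι → ProbabilityMeasure (CountingMeasures X)} (h : Tendsto Pi l (𝓝 P))
    {G : Set X} (hG : IsOpen G) :
    ∫⁻ ν, ν.1 G ∂(P : Measure (CountingMeasures X)) ≤
      liminf (fun i => ∫⁻ ν, ν.1 G ∂(Pi i : Measure (CountingMeasures X))) l := by
  rcases isEmpty_or_nonempty X with hX | ⟨⟨x₀⟩⟩
  · have : G = ∅ := Set.eq_empty_of_isEmpty G
    simp [this]
  have hc : ∀ k : ℕ, Continuous fun ν : CountingMeasures X =>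
      min (Real.toNNReal (∫ x, openApprox x₀ G k x ∂ν.1)) k := fun k =>
    (continuous_real_toNNReal.comp (continuous_integral (openApprox x₀ G k))).min continuous_const
  have hb : ∀ (k : ℕ) (ν ν' : CountingMeasures X),
      dist (min (Real.toNNReal (∫ x, openApprox x₀ G k x ∂ν.1)) k)
        (min (Real.toNNReal (∫ x, openApprox x₀ G k x ∂ν'.1)) k) ≤ k := fun k ν ν' => by
    rw [NNReal.dist_eq]
    set a := min (Real.toNNReal (∫ x, openApprox x₀ G k x ∂ν.1)) (k : NNReal)
    set b := min (Real.toNNReal (∫ x, openApprox x₀ G k x ∂ν'.1)) (k : NNReal)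
    have ha : (a : ℝ) ≤ k := by exact_mod_cast min_le_right _ _
    have hb : (b : ℝ) ≤ k := by exact_mod_cast min_le_right _ _
    rw [abs_le]
    constructor <;> linarith [a.2, b.2]
  -- Truncating at k makes the functional bounded, as weak convergence requires; the truncation
  -- level and the approximation increase together to the mass of G.
  let F : ℕ → BoundedContinuousFunction (CountingMeasures X) NNReal := fun k =>
    BoundedContinuousFunction.mkOfBound ⟨_, hc k⟩ k (hb k)
  have hF : ∀ k ν, ((F k ν : NNReal) : ℝ≥0∞) =
      min (ENNReal.ofReal (∫ x, openApprox x₀ G k x ∂ν.1)) k := fun k ν => by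
    change ((min (Real.toNNReal (∫ x, openApprox x₀ G k x ∂ν.1)) (k : NNReal) : NNReal) : ℝ≥0∞) = _
    rw [ENNReal.coe_min]
    rfl
  have hle : ∀ k ν, ((F k ν : NNReal) : ℝ≥0∞) ≤ ν.1 G := fun k ν => by
    rw [hF]
    refine (min_le_left _ _).trans ?_
    exact Monotone.ge_of_tendsto (fun a b hab => ENNReal.ofReal_le_ofReal
      (monotone_integral_openApprox x₀ G ν hab)) (tendsto_integral_openApprox x₀ hG ν) k
  have hlim : Tendsto (fun k => ∫⁻ ν, F k ν ∂(P : Measure (CountingMeasures X))) atTop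
      (𝓝 (∫⁻ ν, ν.1 G ∂(P : Measure (CountingMeasures X)))) := by
    refine lintegral_tendsto_of_tendsto_of_monotone
      (fun k => ((F k).continuous.measurable.coe_nnreal_ennreal).aemeasurable) ?_ ?_
    · refine ae_of_all _ fun ν k l hkl => ?_
      simp only [hF]
      exact min_le_min (ENNReal.ofReal_le_ofReal (monotone_integral_openApprox x₀ G ν hkl))
        (by exact_mod_cast hkl)
    · refine ae_of_all _ fun ν => ?_
      simp only [hF]
      have := (tendsto_integral_openApprox x₀ hG ν).min ENNReal.tendsto_nat_nhds_top
      simpa using this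
  refine le_of_tendsto' hlim fun k => ?_
  rcases l.eq_or_neBot with rfl | hl
  · simp [liminf_eq]
  have h1 := (ProbabilityMeasure.tendsto_iff_forall_lintegral_tendsto.1 h (F k)).liminf_eq
  rw [← h1]
  exact liminf_le_liminf (Eventually.of_forall fun i => lintegral_mono (hle k))

/-! ### Atoms -/

/-- Punctured balls shrink to the empty set, so their masses tend to 0; being integers, they
eventually vanish. -/
lemma exists_measure_closedBall_diff (ν : CountingMeasures X) (x : X) :
    ∃ r : ℝ, 0 < r ∧ ν.1 (Metric.closedBall x r \ {x}) = 0 := by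
  have h1 := tendsto_measure_biInter_gt (μ := ν.1) (s := fun r => Metric.closedBall x r \ {x})
    (a := (0 : ℝ)) (fun r _ => (Metric.isClosed_closedBall.measurableSet.diff
      (measurableSet_singleton x)).nullMeasurableSet)
    (fun i j _ hij => sdiff_subset_sdiff_left (Metric.closedBall_subset_closedBall hij))
    ⟨1, one_pos, ((measure_mono sdiff_subset).trans_lt
      (isCompact_closedBall x 1).measure_lt_top).ne⟩
  have h2 : ⋂ r > (0 : ℝ), Metric.closedBall x r \ {x} = ∅ := by
    refine eq_empty_of_forall_notMem fun y hy => ?_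
    simp only [mem_iInter] at hy
    have hne : y ≠ x := fun h => (hy 1 one_pos).2 h
    have := (hy (dist y x / 2) (half_pos (dist_pos.2 hne))).1
    rw [Metric.mem_closedBall] at this
    linarith [dist_pos.2 hne]
  rw [h2, measure_empty] at h1
  obtain ⟨r, hr, hr0⟩ := ((h1.eventually (gt_mem_nhds one_pos)).and self_mem_nhdsWithin).exists
  refine ⟨r, hr0, ?_⟩
  obtain ⟨k, hk⟩ := ν.2 (Metric.closedBall x r \ {x})
    (Metric.isClosed_closedBall.measurableSet.diff (measurableSet_singleton x))
    ((isCompact_closedBall x r).closure_of_subset sdiff_subset)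
  simp only [Function.comp_apply] at hr
  rw [hk] at hr ⊢
  have : k < 1 := by exact_mod_cast hr
  simp [Nat.lt_one_iff.1 this]

lemma one_le_of_ne_zero (ν : CountingMeasures X) {A : Set X} (hA : MeasurableSet A)
    (hc : IsCompact (closure A)) (h : ν.1 A ≠ 0) : 1 ≤ ν.1 A := by
  obtain ⟨k, hk⟩ := ν.2 A hA hc
  rw [hk] at h ⊢
  have : k ≠ 0 := by simpa using h
  exact_mod_cast Nat.one_le_iff_ne_zero.2 this

lemma one_le_singleton (ν : CountingMeasures X) {x : X} (h : x ∈ ν.points) : 1 ≤ ν.1 {x} :=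
  ν.one_le_of_ne_zero (measurableSet_singleton x) (by simp) h

/-- Atoms are isolated, so a set without atoms is locally null, hence null: a counting measure is
carried by its points. -/
lemma measure_eq_zero_of_points {ν : CountingMeasures X} {A : Set X}
    (h : ∀ x ∈ A, x ∉ ν.points) : ν.1 A = 0 := by
  refine measure_null_of_locally_null A fun x hx => ?_
  obtain ⟨r, hr, h0⟩ := ν.exists_measure_closedBall_diff x
  refine ⟨Metric.closedBall x r, mem_nhdsWithin_of_mem_nhds (Metric.closedBall_mem_nhds x hr), ?_⟩
  have h1 : ν.1 {x} = 0 := not_not.1 (h x hx)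
  refine measure_mono_null (t := (Metric.closedBall x r \ {x}) ∪ {x}) ?_ ?_
  · rw [sdiff_union_self]
    exact subset_union_left
  · exact measure_union_null h0 h1

lemma exists_point_of_ne_zero {ν : CountingMeasures X} {A : Set X} (h : ν.1 A ≠ 0) :
    ∃ x ∈ A, x ∈ ν.points := by
  by_contra hc
  push Not at hc
  exact h (measure_eq_zero_of_points hc)

lemma finite_points_inter (ν : CountingMeasures X) {C : Set X} (hC : IsCompact C) :
    (ν.points ∩ C).Finite := by
  choose r hr h0 using ν.exists_measure_closedBall_diff
  obtain ⟨t, -, ht⟩ := hC.elim_nhds_subcover (fun x => Metric.closedBall x (r x))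
    (fun x _ => Metric.closedBall_mem_nhds x (hr x))
  refine t.finite_toSet.subset fun y hy => ?_
  obtain ⟨x, hx, hxy⟩ := mem_iUnion₂.1 (ht hy.2)
  have : y = x := by
    by_contra hne
    exact hy.1 (measure_mono_null (singleton_subset_iff.2 (show y ∈ Metric.closedBall x (r x) \ {x} from
      ⟨hxy, hne⟩)) (h0 x))
  rwa [this]

/-! ### Countably many test functions -/

/-- A test function equal to `1` on the ball of radius `r` around `a` and to `0` outside the ball
of radius `2 r`. -/
def bumpFun (a : X) (r : ℝ) (hr : 0 < r) : CompactlySupportedContinuousMap X ℝ :=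
  compactlySupported (fun x => max 0 (min 1 (2 - dist x a / r))) (by fun_prop) a (2 * r)
    (fun x hx => by
      have : 2 * r < dist x a := by simpa using hx
      have h2 : 2 < dist x a / r := by rwa [lt_div_iff₀ hr]
      exact max_eq_left ((min_le_right _ _).trans (by linarith)))

variable [Nonempty X]

/-- A countable family of test functions. -/
def test (k : ℕ × ℕ) : CompactlySupportedContinuousMap X ℝ :=
  bumpFun (TopologicalSpace.denseSeq X k.1) (1 / ((k.2 : ℝ) + 1)) Nat.one_div_pos_of_nat

/-- The integrals of the countable family of test functions. -/
def testVec (ν : CountingMeasures X) (k : ℕ × ℕ) : ℝ := ∫ x, test k x ∂ν.1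

lemma continuous_testVec : Continuous (testVec : CountingMeasures X → ℕ × ℕ → ℝ) :=
  continuous_pi fun k => continuous_integral (test k)

lemma test_nonneg (k : ℕ × ℕ) (x : X) : 0 ≤ test k x := le_max_left _ _

lemma test_le_one (k : ℕ × ℕ) (x : X) : test k x ≤ 1 :=
  max_le zero_le_one (min_le_left _ _)

/-- The countable family is rich enough to separate any point from the complement of any of its
neighborhoods. -/
lemma exists_test (y : X) {O : Set X} (hO : O ∈ 𝓝 y) :
    ∃ (k : ℕ × ℕ) (U : Set X), U ∈ 𝓝 y ∧ IsOpen U ∧ U ⊆ O ∧ (∀ z ∈ U, test k z = 1) ∧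
      ∀ z ∉ O, test k z = 0 := by
  obtain ⟨ε, hε, hb⟩ := Metric.mem_nhds_iff.1 hO
  -- The bump is supported within 2r of a center lying within r of y, so 3r < ε keeps the support
  -- inside O.
  obtain ⟨m, hm⟩ := exists_nat_one_div_lt (show 0 < ε / 3 by positivity)
  have hr : (0 : ℝ) < 1 / ((m : ℝ) + 1) := Nat.one_div_pos_of_nat
  set r : ℝ := 1 / ((m : ℝ) + 1) with hrdef
  obtain ⟨i, hi⟩ := (TopologicalSpace.denseRange_denseSeq X).exists_dist_lt y hr
  have hval : ∀ z, test (i, m) z = max 0 (min 1 (2 - dist z (TopologicalSpace.denseSeq X i) / r)) :=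
    fun z => rfl
  refine ⟨(i, m), Metric.ball (TopologicalSpace.denseSeq X i) r, Metric.isOpen_ball.mem_nhds hi,
    Metric.isOpen_ball, fun z hz => hb ?_, fun z hz => ?_, fun z hz => ?_⟩
  · have h1 := dist_triangle z (TopologicalSpace.denseSeq X i) y
    rw [Metric.mem_ball] at hz ⊢
    rw [dist_comm] at hi
    linarith
  · rw [hval]
    have : dist z (TopologicalSpace.denseSeq X i) / r < 1 := by
      rw [div_lt_one hr]
      exact hz
    rw [min_eq_left (by linarith), max_eq_right zero_le_one]
  · rw [hval]
    have h1 : ε ≤ dist z y := by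
      by_contra hc
      exact hz (hb (by simpa using hc))
    have h2 : 2 ≤ dist z (TopologicalSpace.denseSeq X i) / r := by
      rw [le_div_iff₀ hr]
      have := dist_triangle z (TopologicalSpace.denseSeq X i) y
      rw [dist_comm] at hi
      linarith
    exact max_eq_left ((min_le_right _ _).trans (by linarith))

lemma measure_le_integral_test (ν : CountingMeasures X) {k : ℕ × ℕ} {U : Set X}
    (hU : MeasurableSet U) (h1 : ∀ z ∈ U, test k z = 1) :
    ν.1 U ≤ ENNReal.ofReal (ν.testVec k) := by
  rw [testVec, ofReal_integral ν _ (test_nonneg k), ← lintegral_indicator_one hU]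
  refine lintegral_mono fun z => ?_
  by_cases hz : z ∈ U
  · simp [hz, h1 z hz]
  · simp [hz]

lemma integral_test_le_measure (ν : CountingMeasures X) {k : ℕ × ℕ} {O : Set X}
    (hO : MeasurableSet O) (h0 : ∀ z ∉ O, test k z = 0) :
    ENNReal.ofReal (ν.testVec k) ≤ ν.1 O := by
  rw [testVec, ofReal_integral ν _ (test_nonneg k), ← lintegral_indicator_one hO]
  refine lintegral_mono fun z => ?_
  by_cases hz : z ∈ O
  · simp only [hz, indicator_of_mem, Pi.one_apply]
    exact ENNReal.ofReal_le_one.2 (test_le_one k z)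
  · simp [hz, h0 z hz]

/-! ### What convergence of the countably many test integrals says about points -/

section Convergence

variable {ι : Type*} {l : Filter ι} {νi : ι → CountingMeasures X} {ν : CountingMeasures X}

/-- A test function at y, supported where the limit has no mass, has integral eventually below 1; an
integer mass below 1 is 0. -/
lemma eventually_measure_eq_zero (h : Tendsto (fun i => (νi i).testVec) l (𝓝 ν.testVec)) {y : X}
    (hy : y ∉ ν.points) : ∃ U ∈ 𝓝 y, ∀ᶠ i in l, (νi i).1 U = 0 := by
  obtain ⟨r, hr, h0⟩ := ν.exists_measure_closedBall_diff y
  obtain ⟨k, U, hU, hUo, hUO, h1, h2⟩ := exists_test y (Metric.closedBall_mem_nhds y hr)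
  have hz : ν.1 (Metric.closedBall y r) = 0 := by
    refine measure_mono_null (t := (Metric.closedBall y r \ {y}) ∪ {y}) ?_
      (measure_union_null h0 (not_not.1 hy))
    rw [sdiff_union_self]
    exact subset_union_left
  have h3 : ν.testVec k ≤ 0 := by
    have := ν.integral_test_le_measure Metric.isClosed_closedBall.measurableSet h2
    rw [hz] at this
    exact ENNReal.ofReal_eq_zero.1 (le_antisymm this bot_le)
  refine ⟨U, hU, ?_⟩
  have h4 := (tendsto_pi_nhds.1 h k).eventually (gt_mem_nhds (h3.trans_lt one_pos))
  filter_upwards [h4] with i hi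
  by_contra hne
  have h5 := (νi i).one_le_of_ne_zero hUo.measurableSet
    ((isCompact_closedBall y r).closure_of_subset hUO) hne
  have h6 := h5.trans ((νi i).measure_le_integral_test hUo.measurableSet h1)
  rw [ENNReal.one_le_ofReal] at h6
  linarith

lemma eventually_exists_point (h : Tendsto (fun i => (νi i).testVec) l (𝓝 ν.testVec)) {y : X}
    (hy : y ∈ ν.points) {O : Set X} (hO : O ∈ 𝓝 y) :
    ∀ᶠ i in l, ∃ z ∈ O, z ∈ (νi i).points := by
  obtain ⟨O', hO'O, hO'o, hyO'⟩ := mem_nhds_iff.1 hO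
  obtain ⟨k, U, hU, hUo, hUO, h1, h2⟩ := exists_test y (hO'o.mem_nhds hyO')
  have h3 : 1 ≤ ν.testVec k := by
    rw [← ENNReal.one_le_ofReal]
    exact ((ν.one_le_singleton hy).trans
      (measure_mono (singleton_subset_iff.2 (mem_of_mem_nhds hU)))).trans
      (ν.measure_le_integral_test hUo.measurableSet h1)
  have h4 := (tendsto_pi_nhds.1 h k).eventually (lt_mem_nhds (zero_lt_one.trans_le h3))
  filter_upwards [h4] with i hi
  have h5 : (νi i).1 O' ≠ 0 := by
    refine (lt_of_lt_of_le ?_ ((νi i).integral_test_le_measure hO'o.measurableSet h2)).ne'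
    exact ENNReal.ofReal_pos.2 hi
  obtain ⟨z, hz, hz'⟩ := exists_point_of_ne_zero h5
  exact ⟨z, hO'O hz, hz'⟩

/-- Two points in U would make the test integral at least 2, while its limit is at most 1. -/
lemma eventually_subsingleton (h : Tendsto (fun i => (νi i).testVec) l (𝓝 ν.testVec)) {y : X}
    (hy : ν.1 {y} ≤ 1) :
    ∃ U ∈ 𝓝 y, ∀ᶠ i in l, ∀ a ∈ U, ∀ b ∈ U, a ∈ (νi i).points → b ∈ (νi i).points → a = b := by
  obtain ⟨r, hr, h0⟩ := ν.exists_measure_closedBall_diff y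
  obtain ⟨k, U, hU, hUo, hUO, h1, h2⟩ := exists_test y (Metric.closedBall_mem_nhds y hr)
  have hz : ν.1 (Metric.closedBall y r) ≤ 1 := by
    have : Metric.closedBall y r ⊆ (Metric.closedBall y r \ {y}) ∪ {y} := by
      rw [sdiff_union_self]
      exact subset_union_left
    refine (measure_mono this).trans ((measure_union_le _ _).trans ?_)
    rw [h0, zero_add]
    exact hy
  have h3 : ν.testVec k ≤ 1 := by
    have := (ν.integral_test_le_measure Metric.isClosed_closedBall.measurableSet h2).trans hz
    exact ENNReal.ofReal_le_one.1 this
  refine ⟨U, hU, ?_⟩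
  have h4 := (tendsto_pi_nhds.1 h k).eventually (gt_mem_nhds (h3.trans_lt one_lt_two))
  filter_upwards [h4] with i hi a ha b hb hap hbp
  by_contra hne
  have h5 : (2 : ℝ≥0∞) ≤ (νi i).1 U := by
    have h6 : (νi i).1 ({a} ∪ {b}) ≤ (νi i).1 U := measure_mono (by
      rintro z (rfl | rfl) <;> assumption)
    rw [measure_union (by simpa using hne) (measurableSet_singleton b)] at h6
    refine le_trans ?_ h6
    rw [← one_add_one_eq_two]
    exact add_le_add ((νi i).one_le_singleton hap) ((νi i).one_le_singleton hbp)
  have h7 := h5.trans ((νi i).measure_le_integral_test hUo.measurableSet h1)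
  have h8 : (2 : ℝ≥0∞) = ENNReal.ofReal 2 := by simp
  rw [h8, ENNReal.ofReal_le_ofReal_iff' ] at h7
  rcases h7 with h7 | h7 <;> linarith

/-- If the limit has exactly one point in a compact set, then so do the approximating measures,
except possibly for points outside of the compact set close to the limiting one. -/
lemma eventually_unique_point (h : Tendsto (fun i => (νi i).testVec) l (𝓝 ν.testVec))
    {F : Set X} (hF : IsCompact F) {y : X} (hy : y ∈ ν.points) (hy1 : ν.1 {y} ≤ 1)
    (huniq : ∀ z ∈ F, z ∈ ν.points → z = y) {O : Set X} (hO : O ∈ 𝓝 y) :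
    ∀ᶠ i in l, ∃ z ∈ O, z ∈ (νi i).points ∧ ∀ z' ∈ F, z' ∈ (νi i).points → z' = z := by
  obtain ⟨U, hU, hUu⟩ := eventually_subsingleton h hy1
  have hK : IsCompact (F \ interior U) := hF.diff isOpen_interior
  have hK0 : ∀ z ∈ F \ interior U, z ∉ ν.points := fun z hz hzp => by
    have := huniq z hz.1 hzp
    rw [this] at hz
    exact hz.2 (mem_interior_iff_mem_nhds.2 hU)
  have hloc : ∀ z ∈ F \ interior U, ∃ V ∈ 𝓝[F \ interior U] z, ∀ᶠ i in l, (νi i).1 V = 0 :=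
    fun z hz => by
      obtain ⟨V, hV, h'⟩ := eventually_measure_eq_zero h (hK0 z hz)
      exact ⟨V, mem_nhdsWithin_of_mem_nhds hV, h'⟩
  -- Off U the limit has no points in F, and compactness turns local emptiness into emptiness;
  -- inside U there is at most one point.
  have hzero : ∀ᶠ i in l, (νi i).1 (F \ interior U) = 0 := by
    refine hK.induction_on (p := fun A => ∀ᶠ i in l, (νi i).1 A = 0) ?_ ?_ ?_ hloc
    · simp
    · intro A B hAB hB
      filter_upwards [hB] with i hi using measure_mono_null hAB hi
    · intro A B hA hB
      filter_upwards [hA, hB] with i hi hj using measure_union_null hi hj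
  filter_upwards [hzero, hUu, eventually_exists_point h hy (inter_mem hO hU)] with i h1 h2 h3
  obtain ⟨z, hz, hzp⟩ := h3
  refine ⟨z, hz.1, hzp, fun z' hz' hzp' => ?_⟩
  by_cases hzU : z' ∈ interior U
  · exact h2 z' (interior_subset hzU) z hz.2 hzp' hzp
  · exact absurd (measure_mono_null (singleton_subset_iff.2 (show z' ∈ F \ interior U from
      ⟨hz', hzU⟩)) h1) hzp'

end Convergence

end Proper

end CountingMeasures

/-! ### Coordinates -/

section Coordinates

variable {n : ℕ}

/-- The vector `(t, w₁, …, w_{d-1})`. -/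
def consVec (t : ℝ) (w : Euc n) : Euc (n + 1) :=
  WithLp.toLp 2 (Fin.cons t (fun i => w i) : Fin (n + 1) → ℝ)

@[simp] lemma consVec_zero (t : ℝ) (w : Euc n) : consVec t w 0 = t := rfl

@[simp] lemma perp_consVec (t : ℝ) (w : Euc n) : perp (consVec t w) = w := by
  ext i; simp [perp, consVec]

@[simp] lemma consVec_perp (x : Euc (n + 1)) : consVec (x 0) (perp x) = x := by
  ext i
  refine Fin.cases ?_ (fun j => ?_) i <;> simp [perp, consVec]

lemma consVec_inj {t t' : ℝ} {w w' : Euc n} (h : consVec t w = consVec t' w') : t = t' ∧ w = w' :=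
  ⟨by simpa using congrArg (fun x : Euc (n + 1) => x 0) h, by simpa using congrArg perp h⟩

lemma continuous_perp : Continuous (perp : Euc (n + 1) → Euc n) := by
  unfold perp
  fun_prop

lemma continuous_consVec : Continuous fun p : ℝ × Euc n => consVec p.1 p.2 := by
  refine (PiLp.continuous_toLp 2 _).comp (continuous_pi fun i => ?_)
  refine Fin.cases ?_ (fun j => ?_) i
  · exact continuous_fst
  · simp only [Fin.cons_succ]
    fun_prop

lemma perp_add (x y : Euc (n + 1)) : perp (x + y) = perp x + perp y := by ext i; simp [perp]

lemma perp_sub (x y : Euc (n + 1)) : perp (x - y) = perp x - perp y := by ext i; simp [perp]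

lemma perp_smul (a : ℝ) (x : Euc (n + 1)) : perp (a • x) = a • perp x := by ext i; simp [perp]

@[simp] lemma perp_ofPerp (w : Euc n) : perp (ofPerp w) = w := by ext i; simp [perp, ofPerp]

@[simp] lemma ofPerp_zero (w : Euc n) : ofPerp w 0 = 0 := rfl

lemma abs_zero_le_norm (x : Euc (n + 1)) : |x 0| ≤ ‖x‖ := by
  refine abs_le_of_sq_le_sq ?_ (norm_nonneg _)
  nlinarith [norm_sq_split x, sq_nonneg ‖perp x‖]

lemma norm_perp_le (x : Euc (n + 1)) : ‖perp x‖ ≤ ‖x‖ := by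
  refine le_of_sq_le_sq ?_ (norm_nonneg _)
  nlinarith [norm_sq_split x, sq_nonneg (x 0)]

lemma norm_le_add (x : Euc (n + 1)) : ‖x‖ ≤ |x 0| + ‖perp x‖ := by
  refine le_of_sq_le_sq ?_ (by positivity)
  nlinarith [norm_sq_split x, sq_abs (x 0), abs_nonneg (x 0), norm_nonneg (perp x),
    mul_nonneg (abs_nonneg (x 0)) (norm_nonneg (perp x))]

end Coordinates

/-! ### First points -/

section First

variable {n : ℕ} {S : Type*} [MetricSpace S] [CompactSpace S] [MeasurableSpace S] [BorelSpace S]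

/-- `y` is the first point of `ν` in the half-cylinder of radius one over the ball around `x`. -/
def FirstAt (x : Euc n) (ν : CountingMeasures (Marked n S)) (y : Marked n S) : Prop :=
  (y ∈ ν.points ∧ 0 < y.1 0 ∧ ‖perp y.1 - x‖ < 1) ∧
    ∀ y' ∈ ν.points, 0 < y'.1 0 → ‖perp y'.1 - x‖ < 1 → y' ≠ y → y.1 0 < y'.1 0

lemma FirstAt.unique {x : Euc n} {ν : CountingMeasures (Marked n S)} {y y' : Marked n S}
    (h : FirstAt x ν y) (h' : FirstAt x ν y') : y = y' := by
  by_contra hne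
  exact lt_asymm (h.2 y' h'.1.1 h'.1.2.1 h'.1.2.2 (Ne.symm hne))
    (h'.2 y h.1.1 h.1.2.1 h.1.2.2 hne)

/-- The point of `ℝ^d × Σ` described by the data `(ξ, w, ς)` relative to `x`. -/
def place (x : Euc n) (z : Set.Ioi (0 : ℝ) × ImpactSpace n S) : Marked n S :=
  (consVec z.1 (x - z.2.1), z.2.2)

lemma place_injective (x : Euc n) : Function.Injective (place x (S := S)) := by
  rintro ⟨⟨t, ht⟩, ⟨w, hw⟩, s⟩ ⟨⟨t', ht'⟩, ⟨w', hw'⟩, s'⟩ h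
  simp only [place, Prod.mk.injEq] at h
  obtain ⟨h1, h2⟩ := consVec_inj h.1
  simp only [sub_right_inj] at h2
  simp [h1, h2, h.2]

lemma continuous_place : Continuous fun p : Euc n × (Set.Ioi (0 : ℝ) × ImpactSpace n S) =>
    place p.1 p.2 := by
  refine Continuous.prodMk (continuous_consVec.comp (Continuous.prodMk ?_ ?_)) ?_ <;> fun_prop

lemma exists_place {x : Euc n} {y : Marked n S} (h1 : 0 < y.1 0) (h2 : ‖perp y.1 - x‖ < 1) :
    ∃ z : Set.Ioi (0 : ℝ) × ImpactSpace n S, place x z = y :=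
  ⟨(⟨y.1 0, h1⟩, ⟨x - perp y.1, by rwa [mem_ball_zero_iff, norm_sub_rev]⟩, y.2), by
    simp [place]⟩

/-- The reflected first hit `ι(z(ν - x))`. -/
def hit (x : Euc n) (ν : CountingMeasures (Marked n S)) : HitSpace n S :=
  reflect (firstPoint (ν.map (shiftHomeo (ofPerp x))))

lemma mem_points_map {X : Type*} [TopologicalSpace X] [T1Space X] [MeasurableSpace X] [BorelSpace X]
    (e : X ≃ₜ X) (ν : CountingMeasures X) (y : X) :
    y ∈ (ν.map e).points ↔ e.symm y ∈ ν.points := by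
  change (ν.1.map e) {y} ≠ 0 ↔ ν.1 {e.symm y} ≠ 0
  rw [Measure.map_apply e.continuous.measurable (measurableSet_singleton y)]
  have : e ⁻¹' {y} = {e.symm y} := by
    ext z
    simp [Homeomorph.eq_symm_apply]
  rw [this]

lemma shiftHomeo_symm_apply (x : Euc (n + 1)) (y : Marked n S) :
    (shiftHomeo x).symm y = (y.1 + x, y.2) := rfl

lemma shiftHomeo_apply (x : Euc (n + 1)) (y : Marked n S) :
    shiftHomeo x y = (y.1 - x, y.2) := rfl

lemma isFirstPoint_iff (x : Euc n) (ν : CountingMeasures (Marked n S)) (y : Marked n S) :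
    IsFirstPoint (ν.map (shiftHomeo (ofPerp x))).points y ↔
      FirstAt x ν ((shiftHomeo (ofPerp x)).symm y) := by
  simp only [IsFirstPoint, FirstAt, mem_points_map, shiftHomeo_symm_apply, perp_add, perp_ofPerp,
    add_sub_cancel_right, PiLp.add_apply, ofPerp_zero, add_zero]
  refine and_congr_right fun _ => ⟨fun h y' h1 h2 h3 h4 => ?_, fun h y' h1 h2 h3 h4 => ?_⟩
  · have := h (shiftHomeo (ofPerp x) y')
    simp only [shiftHomeo_apply, sub_add_cancel, perp_sub, perp_ofPerp, PiLp.sub_apply, ofPerp_zero,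
      sub_zero] at this
    refine this h1 h2 h3 fun he => h4 ?_
    rw [← he]
    simp
  · have := h ((shiftHomeo (ofPerp x)).symm y')
    simp only [shiftHomeo_symm_apply, perp_add, perp_ofPerp,
      add_sub_cancel_right, PiLp.add_apply, ofPerp_zero, add_zero] at this
    refine this h1 h2 h3 fun he => h4 ?_
    simpa [Prod.ext_iff] using he

/-- Replaces the choice in `firstPoint` by a predicate on the unshifted configuration. The
reflection ι is the reason for x − w, rather than x + w, in `place`. -/
lemma hit_eq_inl_iff (x : Euc n) (ν : CountingMeasures (Marked n S))
    (z : Set.Ioi (0 : ℝ) × ImpactSpace n S) : hit x ν = Sum.inl z ↔ FirstAt x ν (place x z) := by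
  have key : ∀ h : ∃ y, IsFirstPoint (ν.map (shiftHomeo (ofPerp x))).points y,
      hit x ν = Sum.inl z ↔ place x z = (shiftHomeo (ofPerp x)).symm h.choose := by
    intro h
    have hc : hit x ν = reflect (Sum.inl (⟨h.choose.1 0, h.choose_spec.1.2.1⟩,
      (⟨perp h.choose.1, by simpa using h.choose_spec.1.2.2⟩, h.choose.2))) := by
      rw [hit, firstPoint, dif_pos h]
    rw [hc, reflect, shiftHomeo_symm_apply]
    obtain ⟨⟨t, ht⟩, ⟨w, hw⟩, s⟩ := z
    set y := h.choose
    simp only [Sum.inl.injEq, Prod.mk.injEq, Subtype.mk.injEq, place]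
    constructor
    · rintro ⟨h1, h2, h3⟩
      have h1' : y.1 0 = t := congrArg Subtype.val h1
      have h2' : -perp y.1 = w := h2
      refine ⟨?_, h3.symm⟩
      rw [← consVec_perp (y.1 + ofPerp x), perp_add, perp_ofPerp, ← h1', ← h2', sub_neg_eq_add,
        add_comm x]
      simp
    · rintro ⟨h1, h2⟩
      refine ⟨?_, ?_, h2.symm⟩
      · have := congrArg (fun u : Euc (n + 1) => u 0) h1
        exact Subtype.ext (by simpa using this.symm)
      · have := congrArg perp h1
        rw [perp_consVec, perp_add, perp_ofPerp] at this
        rw [sub_eq_iff_eq_add] at this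
        change -perp y.1 = w
        rw [add_right_comm, right_eq_add] at this
        exact neg_eq_of_add_eq_zero_right this
  constructor
  · intro h0
    have h : ∃ y, IsFirstPoint (ν.map (shiftHomeo (ofPerp x))).points y := by
      by_contra hc
      rw [hit, firstPoint, dif_neg hc] at h0
      simp [reflect] at h0
    rw [(key h).1 h0, ← isFirstPoint_iff]
    exact h.choose_spec
  · intro h0
    have h : ∃ y, IsFirstPoint (ν.map (shiftHomeo (ofPerp x))).points y :=
      ⟨shiftHomeo (ofPerp x) (place x z), by rw [isFirstPoint_iff]; simpa using h0⟩
    rw [key h]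
    exact h0.unique ((isFirstPoint_iff x ν _).1 h.choose_spec)

/-- The almost sure properties of the limit process needed for the stability of first points. -/
structure Good (x : Euc n) (ν : CountingMeasures (Marked n S)) : Prop where
  axis : ∀ y ∈ ν.points, y.1 0 ≠ 0
  wall : ∀ y ∈ ν.points, ‖perp y.1 - x‖ ≠ 1
  coincidence : ∀ t : ℝ, ν.1 {y | y.1 0 = t} ≤ 1
  nonempty : ∃ y ∈ ν.points, 0 < y.1 0 ∧ ‖perp y.1 - x‖ < 1

lemma Good.eq_of_eq {x : Euc n} {ν : CountingMeasures (Marked n S)} (h : Good x ν)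
    {y y' : Marked n S} (hy : y ∈ ν.points) (hy' : y' ∈ ν.points) (he : y.1 0 = y'.1 0) :
    y = y' := by
  by_contra hne
  have h1 := (measure_mono (μ := ν.1) (show ({y} ∪ {y'} : Set (Marked n S)) ⊆ {z | z.1 0 = y.1 0} by
    rintro z (rfl | rfl)
    · rfl
    · exact he.symm)).trans (h.coincidence _)
  rw [measure_union (by simpa using hne) (measurableSet_singleton y')] at h1
  have h2 := (add_le_add (ν.one_le_singleton hy) (ν.one_le_singleton hy')).trans h1
  norm_num at h2

lemma Good.singleton_le {x : Euc n} {ν : CountingMeasures (Marked n S)} (h : Good x ν)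
    (y : Marked n S) : ν.1 {y} ≤ 1 :=
  (measure_mono (singleton_subset_iff.2 (show y ∈ {z | z.1 0 = y.1 0} from rfl))).trans (h.coincidence (y.1 0))

lemma isCompact_slab (a b : ℝ) : IsCompact {y : Marked n S | |y.1 0| ≤ a ∧ ‖perp y.1‖ ≤ b} := by
  have hc : IsCompact ((Metric.closedBall (0 : Euc (n + 1)) (a + b)) ×ˢ (univ : Set S)) :=
    (isCompact_closedBall _ _).prod isCompact_univ
  refine hc.of_isClosed_subset ?_ fun y hy => ⟨?_, mem_univ _⟩
  · have h0 : Continuous fun y : Marked n S => |y.1 0| := by fun_prop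
    have h1 : Continuous fun y : Marked n S => ‖perp y.1‖ :=
      (continuous_perp.comp continuous_fst).norm
    exact (isClosed_le h0 continuous_const).inter (isClosed_le h1 continuous_const)
  · rw [mem_closedBall_zero_iff]
    exact (norm_le_add _).trans (add_le_add hy.1 hy.2)

/-- Below any given point of the cylinder there are only finitely many others; a minimal first
coordinate exists, and the absence of coincidences makes it strictly minimal. -/
lemma Good.exists_first {x : Euc n} {ν : CountingMeasures (Marked n S)} (h : Good x ν) :
    ∃ z, FirstAt x ν (place x z) := by
  obtain ⟨y, hy, hy0, hy1⟩ := h.nonempty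
  have hperp : ∀ {y' : Marked n S}, ‖perp y'.1 - x‖ < 1 → ‖perp y'.1‖ ≤ 1 + ‖x‖ := fun {y'} h' => by
    have := norm_add_le (perp y'.1 - x) x
    rw [sub_add_cancel] at this
    linarith
  have hfin := ν.finite_points_inter (isCompact_slab (S := S) (n := n) (y.1 0) (1 + ‖x‖))
  have hfin' : {y' | y' ∈ ν.points ∧ 0 < y'.1 0 ∧ y'.1 0 ≤ y.1 0 ∧ ‖perp y'.1 - x‖ < 1}.Finite := by
    refine hfin.subset fun y' hy' => ⟨hy'.1, ?_, hperp hy'.2.2.2⟩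
    rw [abs_of_pos hy'.2.1]
    exact hy'.2.2.1
  obtain ⟨y0, hy0m, hmin⟩ := hfin'.exists_minimalFor (fun y' => y'.1 0) _ ⟨y, hy, hy0, le_rfl, hy1⟩
  have hmin' : ∀ y' ∈ ν.points, 0 < y'.1 0 → ‖perp y'.1 - x‖ < 1 → y0.1 0 ≤ y'.1 0 := by
    intro y' h1 h2 h3
    rcases le_total (y0.1 0) (y'.1 0) with h4 | h4
    · exact h4
    · exact hmin ⟨h1, h2, h4.trans hy0m.2.2.1, h3⟩ h4
  obtain ⟨z, rfl⟩ := exists_place hy0m.2.1 hy0m.2.2.2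
  refine ⟨z, ⟨hy0m.1, hy0m.2.1, hy0m.2.2.2⟩, fun y' h1 h2 h3 h4 => ?_⟩
  exact lt_of_le_of_ne (hmin' y' h1 h2 h3) fun he => h4 (h.eq_of_eq hy0m.1 h1 he).symm

/-- Stability of the first point: near a good configuration with first point `y`, there is exactly
one point close to `y`, and no other point in certain enlarged regions. -/
lemma Good.eventually_first [Nonempty S] {x : Euc n} {ν : CountingMeasures (Marked n S)}
    (h : Good x ν) {y : Marked n S} (hy : FirstAt x ν y) (C : ℝ) :
    ∃ η : ℝ, 0 < η ∧ ∀ {ι : Type _} {l : Filter ι} {νi : ι → CountingMeasures (Marked n S)},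
      Tendsto (fun i => (νi i).testVec) l (𝓝 ν.testVec) → ∀ O ∈ 𝓝 y,
      ∀ᶠ i in l, ∃ z ∈ O, z ∈ (νi i).points ∧
        (∀ z' ∈ (νi i).points, -η ≤ z'.1 0 → z'.1 0 ≤ y.1 0 + 2 * η → ‖perp z'.1 - x‖ ≤ 1 + η →
          z' = z) ∧
        (∀ z' ∈ (νi i).points, |z'.1 0| ≤ η → C < ‖perp z'.1‖) ∧
        (∀ z' ∈ (νi i).points, |z'.1 0 - y.1 0| ≤ 2 * η → ‖perp z'.1‖ ≤ C → z' = z) := by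
  -- Three regions to be kept clear. The enlarged cylinder excludes earlier hits, even after
  -- perturbing axis and height. The slab around height 0 keeps the starting point free of other
  -- scatterers. The slab around the height of y makes the scatterer hit separated.
  let F : ℝ → Set (Marked n S) := fun η =>
    {z | (-η ≤ z.1 0 ∧ z.1 0 ≤ y.1 0 + 2 * η ∧ ‖perp z.1 - x‖ ≤ 1 + η) ∨
      (|z.1 0| ≤ η ∧ ‖perp z.1‖ ≤ C) ∨ (|z.1 0 - y.1 0| ≤ 2 * η ∧ ‖perp z.1‖ ≤ C)}
  have hy0 : 0 < y.1 0 := hy.1.2.1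
  have hFsub : ∀ η ≤ 1, F η ⊆ {z | |z.1 0| ≤ y.1 0 + 2 ∧ ‖perp z.1‖ ≤ max C (2 + ‖x‖)} := by
    intro η hη z hz
    rcases hz with ⟨h1, h2, h3⟩ | ⟨h1, h2⟩ | ⟨h1, h2⟩
    · refine ⟨abs_le.2 ⟨by linarith, by linarith⟩, le_max_of_le_right ?_⟩
      have := norm_add_le (perp z.1 - x) x
      rw [sub_add_cancel] at this
      linarith
    · exact ⟨by linarith, le_max_of_le_left h2⟩
    · rw [abs_le] at h1
      exact ⟨abs_le.2 ⟨by linarith, by linarith⟩, le_max_of_le_left h2⟩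
  have hc0 : Continuous fun z : Marked n S => z.1 0 := by fun_prop
  have hc1 : Continuous fun z : Marked n S => perp z.1 := continuous_perp.comp continuous_fst
  have hFc : ∀ η ≤ 1, IsCompact (F η) := by
    intro η hη
    refine (isCompact_slab _ _).of_isClosed_subset ?_ (hFsub η hη)
    refine IsClosed.union ?_ (IsClosed.union ?_ ?_)
    · exact (isClosed_le continuous_const hc0).inter ((isClosed_le hc0 continuous_const).inter
        (isClosed_le (hc1.sub continuous_const).norm continuous_const))
    · exact (isClosed_le hc0.abs continuous_const).inter (isClosed_le hc1.norm continuous_const)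
    · exact (isClosed_le (hc0.sub continuous_const).abs continuous_const).inter
        (isClosed_le hc1.norm continuous_const)
  have hfin := ν.finite_points_inter (isCompact_slab (S := S) (n := n) (y.1 0 + 2)
    (max C (2 + ‖x‖)))
  have hsmall : ∀ {c : ℝ}, 0 < c → ∀ᶠ η : ℝ in 𝓝[>] 0, η < c := fun {c} hc =>
    mem_nhdsWithin_of_mem_nhds (gt_mem_nhds hc)
  -- All regions with η ≤ 1 lie in one compact slab, which holds finitely many points of ν. Each of
  -- them other than y leaves the regions once η is small.
  have hev : ∀ᶠ η : ℝ in 𝓝[>] 0, ∀ z ∈ ν.points ∩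
      {z | |z.1 0| ≤ y.1 0 + 2 ∧ ‖perp z.1‖ ≤ max C (2 + ‖x‖)}, z ∈ F η → z = y := by
    refine (eventually_all_finite hfin).2 fun z hz => ?_
    by_cases hzy : z = y
    · exact Eventually.of_forall fun _ _ => hzy
    have hz0 : z.1 0 ≠ 0 := h.axis z hz.1
    have hzy0 : z.1 0 ≠ y.1 0 := fun he => hzy (h.eq_of_eq hz.1 hy.1.1 he)
    have e1 : ∀ᶠ η : ℝ in 𝓝[>] 0, η < |z.1 0| := hsmall (abs_pos.2 hz0)
    have e2 : ∀ᶠ η : ℝ in 𝓝[>] 0, η < |z.1 0 - y.1 0| / 2 :=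
      hsmall (half_pos (abs_pos.2 (sub_ne_zero.2 hzy0)))
    have e3 : ∀ᶠ η : ℝ in 𝓝[>] 0,
        ¬ (-η ≤ z.1 0 ∧ z.1 0 ≤ y.1 0 + 2 * η ∧ ‖perp z.1 - x‖ ≤ 1 + η) := by
      rcases lt_or_gt_of_ne hz0 with hneg | hpos
      · filter_upwards [hsmall (neg_pos.2 hneg)] with η hη h1
        linarith [h1.1]
      · rcases lt_or_gt_of_ne (h.wall z hz.1) with hin | hout
        · have hlt := hy.2 z hz.1 hpos hin hzy
          filter_upwards [hsmall (show 0 < (z.1 0 - y.1 0) / 2 by linarith)] with η hη h1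
          linarith [h1.2.1]
        · filter_upwards [hsmall (show 0 < ‖perp z.1 - x‖ - 1 by linarith)] with η hη h1
          linarith [h1.2.2]
    filter_upwards [e1, e2, e3] with η h1 h2 h3 hzF
    rcases hzF with h4 | h4 | h4
    · exact absurd h4 h3
    · linarith [h4.1]
    · linarith [h4.1]
  obtain ⟨η, ⟨⟨hη, hη1⟩, hηy⟩, hη0⟩ :=
    (((hev.and (hsmall one_pos)).and (hsmall hy0)).and self_mem_nhdsWithin).exists
  have hη0' : 0 < η := hη0
  refine ⟨η, hη0', fun {ι l νi} ht O hO => ?_⟩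
  -- Keeping the unique point above height η means that it is not in the slab around 0, so that slab
  -- has no point at all.
  have hO' : O ∩ {z | η < z.1 0} ∈ 𝓝 y :=
    inter_mem hO ((isOpen_lt continuous_const hc0).mem_nhds hηy)
  have := CountingMeasures.eventually_unique_point ht (hFc η hη1.le) hy.1.1 (h.singleton_le y)
    (fun z hz hzp => hη z ⟨hzp, hFsub η hη1.le hz⟩ hz) hO'
  filter_upwards [this] with i hi
  obtain ⟨z, hz, hzp, hu⟩ := hi
  refine ⟨z, hz.1, hzp, fun z' hz' h1 h2 h3 => hu z' (Or.inl ⟨h1, h2, h3⟩) hz',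
    fun z' hz' h1 => ?_, fun z' hz' h1 h2 => hu z' (Or.inr (Or.inr ⟨h1, h2⟩)) hz'⟩
  by_contra hc
  have h4 := hu z' (Or.inr (Or.inl ⟨h1, not_lt.1 hc⟩)) hz'
  have h5 : η < z.1 0 := hz.2
  rw [h4] at h1
  linarith [le_abs_self (z.1 0)]

end First

/-! ### Weak convergence -/

section Weak

/-- The portmanteau inequality under maps which are only asymptotically continuous. -/
lemma measure_le_liminf_of_eventually {M V : Type*} [TopologicalSpace M] [MeasurableSpace M]
    [MeasurableSpace V] {N : Measure M} {P : ℕ → Measure V} {W : ℕ → V → M}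
    (hW : ∀ T : Set M, IsOpen T → N T ≤ liminf (fun j => P j (W j ⁻¹' T)) atTop)
    {A : Set M} {B : ℕ → Set V}
    (h : ∀ w ∈ A, ∀ᶠ i in comap (fun i : ℕ × V => (i.1, W i.1 i.2)) (atTop ×ˢ 𝓝 w),
      i.2 ∈ B i.1) :
    N A ≤ liminf (fun j => P j (B j)) atTop := by
  -- Increasing open sets that cover A, with the preimages under the j-th map contained in `B j` for
  -- all j ≥ k. Neither A nor `B j` has to be measurable.
  let T : ℕ → Set M := fun k => interior {w | ∀ j ≥ k, ∀ ω, W j ω = w → ω ∈ B j}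
  have hT : Monotone T := fun k l hkl =>
    interior_mono fun w hw j hj => hw j (hkl.trans hj)
  have hA : A ⊆ ⋃ k, T k := fun w hw => by
    have h1 := eventually_comap.1 (h w hw)
    rw [eventually_prod_iff] at h1
    obtain ⟨pa, ha, pb, hb, h2⟩ := h1
    obtain ⟨k, hk⟩ := eventually_atTop.1 ha
    refine mem_iUnion.2 ⟨k, mem_interior_iff_mem_nhds.2 ?_⟩
    filter_upwards [hb] with w' hw' j hj ω hω
    exact h2 (hk j hj) hw' (j, ω) (by rw [hω])
  calc N A ≤ N (⋃ k, T k) := measure_mono hA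
    _ = ⨆ k, N (T k) := hT.measure_iUnion
    _ ≤ _ := iSup_le fun k => (hW _ isOpen_interior).trans ?_
  refine liminf_le_liminf ?_
  filter_upwards [eventually_ge_atTop k] with j hj
  exact measure_mono fun ω hω => interior_subset hω j hj ω rfl

/-- If `Y_j` converges in law to `ν` under the conditional laws of `λ` given an arbitrary event,
then `(v, Y_j(v))` converges in law to the product of `λ` and `ν`. -/
lemma prod_le_liminf {V M : Type*} [TopologicalSpace V] [SecondCountableTopology V]
    [TopologicalSpace.PseudoMetrizableSpace V] [MeasurableSpace V] [BorelSpace V]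
    [TopologicalSpace M] [SecondCountableTopology M]
    [TopologicalSpace.PseudoMetrizableSpace M] [MeasurableSpace M] [BorelSpace M]
    (lam : Measure V) [IsProbabilityMeasure lam] (ν : Measure M) [IsProbabilityMeasure ν]
    (Y : ℕ → V → M) (hY : ∀ j, Measurable (Y j))
    (h : ∀ A : Set V, MeasurableSet A → ∀ B : Set M, MeasurableSet B → ν (frontier B) = 0 →
      Tendsto (fun j => lam (A ∩ Y j ⁻¹' B)) atTop (𝓝 (lam A * ν B)))
    {T : Set (V × M)} (hT : IsOpen T) :
    (lam.prod ν) T ≤ liminf (fun j => lam ((fun v => (v, Y j v)) ⁻¹' T)) atTop := by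
  have hm : ∀ j, Measurable fun v => (v, Y j v) := fun j => measurable_id.prodMk (hY j)
  let P : ℕ → ProbabilityMeasure (V × M) := fun j =>
    ⟨lam.map fun v => (v, Y j v), Measure.isProbabilityMeasure_map (hm j).aemeasurable⟩
  let Q : ProbabilityMeasure (V × M) := ⟨lam.prod ν, inferInstance⟩
  -- Only the second factor must be a continuity set: the law of the first coordinate does not
  -- change with j.
  let S : Set (Set (V × M)) := {s | ∃ (A : Set V) (B : Set M), MeasurableSet A ∧ MeasurableSet B ∧
    ν (frontier B) = 0 ∧ s = A ×ˢ B}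
  have hS : IsPiSystem S := by
    rintro _ ⟨A, B, hA, hB, hB0, rfl⟩ _ ⟨A', B', hA', hB', hB0', rfl⟩ -
    refine ⟨A ∩ A', B ∩ B', hA.inter hA', hB.inter hB', ?_, prod_inter_prod⟩
    refine measure_mono_null (frontier_inter_subset B B') (measure_union_null ?_ ?_)
    · exact measure_mono_null inter_subset_left hB0
    · exact measure_mono_null inter_subset_right hB0'
  have hlim : Tendsto P atTop (𝓝 Q) := by
    refine hS.tendsto_probabilityMeasure_of_tendsto_of_mem ?_ ?_ ?_
    · rintro _ ⟨A, B, hA, hB, -, rfl⟩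
      exact hA.prod hB
    · rintro u hu ⟨v, y⟩ hx
      let _ := TopologicalSpace.pseudoMetrizableSpacePseudoMetric M
      obtain ⟨A, B, hA, hB, hvA, hyB, hsub⟩ := isOpen_prod_iff.1 hu v y hx
      obtain ⟨r, hr, hrB⟩ := Metric.isOpen_iff.1 hB y hyB
      -- Some radius below r gives a ball with null frontier, so the π-system contains a
      -- neighborhood base.
      obtain ⟨r', hr', h0⟩ := exists_null_frontier_thickening ν {y} hr
      refine ⟨A ×ˢ Metric.thickening r' {y}, ⟨A, _, hA.measurableSet,
        Metric.isOpen_thickening.measurableSet, h0, rfl⟩, ?_, ?_⟩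
      · refine prod_mem_nhds (hA.mem_nhds hvA) (Metric.isOpen_thickening.mem_nhds ?_)
        exact Metric.self_subset_thickening hr'.1 _ rfl
      · refine (Set.prod_mono_right ?_).trans hsub
        rw [Metric.thickening_singleton]
        exact (Metric.ball_subset_ball hr'.2.le).trans hrB
    · rintro _ ⟨A, B, hA, hB, hB0, rfl⟩
      rw [← ENNReal.tendsto_coe]
      simp only [ProbabilityMeasure.ennreal_coeFn_eq_coeFn_toMeasure]
      change Tendsto (fun j => (lam.map fun v => (v, Y j v)) (A ×ˢ B)) atTop
        (𝓝 ((lam.prod ν) (A ×ˢ B)))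
      rw [Measure.prod_prod]
      refine (h A hA B hB hB0).congr fun j => ?_
      rw [Measure.map_apply (hm j) (hA.prod hB)]
      rfl
  have h2 := ProbabilityMeasure.le_liminf_measure_open_of_tendsto hlim hT
  refine h2.trans (le_of_eq ?_)
  congr 1
  funext j
  exact Measure.map_apply (hm j) hT.measurableSet

end Weak

/-! ### The particle frame -/

section Frame

variable {n : ℕ}

lemma rowMul_add (x y : Euc n) (A : Matrix (Fin n) (Fin n) ℝ) :
    rowMul (x + y) A = rowMul x A + rowMul y A := by
  simp [rowMul, Matrix.add_vecMul]

lemma rowMul_sub (x y : Euc n) (A : Matrix (Fin n) (Fin n) ℝ) :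
    rowMul (x - y) A = rowMul x A - rowMul y A := by
  simp [rowMul, Matrix.sub_vecMul]

lemma rowMul_smul (a : ℝ) (x : Euc n) (A : Matrix (Fin n) (Fin n) ℝ) :
    rowMul (a • x) A = a • rowMul x A := by
  simp [rowMul, Matrix.smul_vecMul]

lemma continuous_rowMul : Continuous fun p : Euc n × Matrix (Fin n) (Fin n) ℝ =>
    rowMul p.1 p.2 := by
  refine (PiLp.continuous_toLp 2 _).comp ?_
  exact ((PiLp.continuous_ofLp 2 _).comp continuous_fst).matrix_vecMul continuous_snd

lemma rowMul_frame_zero (R : FrameMap n) (v : UnitSphere n) (x : Euc (n + 1)) :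
    rowMul x (R.toFun v).1 0 = inner ℝ x (v : Euc (n + 1)) := by
  rw [← inner_rowMul (R.toFun v) x v, R.map_to_e1, e1]
  simp [EuclideanSpace.inner_single_right]

lemma frameAction_zero (R : FrameMap n) (ρ : ℝ) (q : Euc (n + 1)) (v : UnitSphere n)
    {S : Type*} (y : Marked n S) :
    (frameAction R ρ q v y).1 0 = ρ ^ n * inner ℝ (y.1 - q) (v : Euc (n + 1)) := by
  rw [← rowMul_frame_zero R v]
  simp [frameAction, rowMul, scaleMatrix, Matrix.vecMul_diagonal, mul_comm,
    -Matrix.vecMul_vecMul]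

lemma perp_frameAction (R : FrameMap n) (ρ : ℝ) (q : Euc (n + 1)) (v : UnitSphere n)
    {S : Type*} (y : Marked n S) :
    perp (frameAction R ρ q v y).1 = ρ⁻¹ • perp (rowMul (y.1 - q) (R.toFun v).1) := by
  ext i
  simp [frameAction, perp, rowMul, scaleMatrix, Matrix.vecMul_diagonal, mul_comm,
    -Matrix.vecMul_vecMul]

/-- The vector `w ∈ ℝ^(d-1)`, viewed as an element of the orthogonal complement of `v` by means of
the inverse of the frame. -/
def unframe (R : FrameMap n) (v : UnitSphere n) (w : Euc n) : Euc (n + 1) :=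
  rowMul (ofPerp w) (R.toFun v).1.transpose

lemma frame_mul_transpose (A : Matrix.specialOrthogonalGroup (Fin n) ℝ) :
    A.1 * A.1.transpose = 1 := by
  have := (Matrix.mem_specialOrthogonalGroup_iff.1 A.2).1
  have h2 := (Matrix.mem_orthogonalGroup_iff (Fin n) ℝ).1 this
  simpa [Matrix.star_eq_conjTranspose] using h2

lemma rowMul_rowMul (x : Euc n) (A B : Matrix (Fin n) (Fin n) ℝ) :
    rowMul (rowMul x A) B = rowMul x (A * B) := by
  simp [rowMul, Matrix.vecMul_vecMul]

lemma rowMul_one (x : Euc n) : rowMul x (1 : Matrix (Fin n) (Fin n) ℝ) = x := by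
  simp [rowMul]

lemma norm_unframe (R : FrameMap n) (v : UnitSphere n) (w : Euc n) : ‖unframe R v w‖ = ‖w‖ := by
  have h1 : (R.toFun v).1.transpose * (R.toFun v).1 = 1 :=
    mul_eq_one_comm.1 (frame_mul_transpose (R.toFun v))
  rw [← norm_rowMul (R.toFun v), unframe, rowMul_rowMul, h1, rowMul_one]
  have := norm_sq_split (ofPerp w)
  rw [perp_ofPerp, ofPerp_zero] at this
  have h2 : ‖ofPerp w‖ ^ 2 = ‖w‖ ^ 2 := by rw [this]; ring
  exact (pow_left_inj₀ (norm_nonneg _) (norm_nonneg _) two_ne_zero).1 h2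

lemma unframe_sub (R : FrameMap n) (v : UnitSphere n) (w w' : Euc n) :
    unframe R v (w - w') = unframe R v w - unframe R v w' := by
  have : ofPerp (w - w') = ofPerp w - ofPerp w' := by
    ext i
    refine Fin.cases ?_ (fun j => ?_) i <;> simp [ofPerp]
  rw [unframe, this, rowMul_sub]
  rfl

lemma unframe_smul (R : FrameMap n) (v : UnitSphere n) (a : ℝ) (w : Euc n) :
    unframe R v (a • w) = a • unframe R v w := by
  have : ofPerp (a • w) = a • ofPerp w := by
    ext i
    refine Fin.cases ?_ (fun j => ?_) i <;> simp [ofPerp]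
  rw [unframe, this, rowMul_smul]
  rfl

/-- Orthogonal decomposition along v, the transverse part being expressed through the frame at v. -/
lemma eq_smul_add_unframe (R : FrameMap n) (v : UnitSphere n) (u : Euc (n + 1)) :
    u = inner ℝ u (v : Euc (n + 1)) • (v : Euc (n + 1)) +
      unframe R v (perp (rowMul u (R.toFun v).1)) := by
  have h1 : rowMul u (R.toFun v).1 = inner ℝ u (v : Euc (n + 1)) • e1 n +
      ofPerp (perp (rowMul u (R.toFun v).1)) := by
    ext i
    refine Fin.cases ?_ (fun j => ?_) i
    · simp [e1, rowMul_frame_zero]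
    · simp [e1, ofPerp, perp]
  have h2 : rowMul (rowMul u (R.toFun v).1) (R.toFun v).1.transpose = u := by
    rw [rowMul_rowMul, frame_mul_transpose, rowMul_one]
  have h3 : rowMul (e1 n) (R.toFun v).1.transpose = v := by
    rw [← R.map_to_e1 v, rowMul_rowMul, frame_mul_transpose, rowMul_one]
  calc u = rowMul (rowMul u (R.toFun v).1) (R.toFun v).1.transpose := h2.symm
    _ = _ := by
      conv_lhs => rw [h1, rowMul_add, rowMul_smul, h3]
      rfl

/-- Away from the exceptional point, the frames are uniformly continuous. -/
lemma exists_unframe_close (R : FrameMap n) {v₀ : UnitSphere n}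
    (h : ContinuousOn R.toFun {v₀}ᶜ) (M : ℝ) {ε : ℝ} (hε : 0 < ε) :
    ∃ δ : ℝ, 0 < δ ∧ ∀ v v' : UnitSphere n, 1 ≤ dist v v₀ → 1 ≤ dist v' v₀ → dist v v' < δ →
      ∀ w : Euc n, ‖w‖ ≤ M → ‖unframe R v w - unframe R v' w‖ < ε := by
  have hK : IsCompact ({v : UnitSphere n | 1 ≤ dist v v₀} ×ˢ Metric.closedBall (0 : Euc n) M) := by
    refine IsCompact.prod ?_ (isCompact_closedBall _ _)
    exact (isClosed_le continuous_const (by fun_prop)).isCompact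
  have hc : ContinuousOn (fun p : UnitSphere n × Euc n => unframe R p.1 p.2)
      ({v : UnitSphere n | 1 ≤ dist v v₀} ×ˢ Metric.closedBall (0 : Euc n) M) := by
    have h1 : ContinuousOn (fun p : UnitSphere n × Euc n => (R.toFun p.1).1.transpose)
        ({v : UnitSphere n | 1 ≤ dist v v₀} ×ˢ Metric.closedBall (0 : Euc n) M) := by
      refine (Continuous.matrix_transpose continuous_subtype_val).comp_continuousOn ?_
      refine h.comp continuousOn_fst fun p hp => ?_
      intro he
      have h3 : 1 ≤ dist p.1 v₀ := hp.1
      rw [mem_singleton_iff.1 he, dist_self] at h3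
      linarith
    have h2 : Continuous (ofPerp : Euc n → Euc (n + 1)) :=
      continuous_consVec.comp (Continuous.prodMk_right 0)
    exact continuous_rowMul.comp_continuousOn
      ((h2.comp continuous_snd).continuousOn.prodMk h1)
  obtain ⟨δ, hδ, hd⟩ := Metric.uniformContinuousOn_iff.1
    (hK.uniformContinuousOn_of_continuous hc) ε hε
  refine ⟨δ, hδ, fun v v' hv hv' hvv w hw => ?_⟩
  have := hd (v, w) ⟨hv, by simpa using hw⟩ (v', w) ⟨hv', by simpa using hw⟩ (by
    rw [Prod.dist_eq]
    simpa using hvv)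
  rwa [dist_eq_norm] at this

lemma measurable_rowMul_frame (R : FrameMap n) (u : Euc (n + 1)) :
    Measurable fun v => rowMul u (R.toFun v).1 := by
  obtain ⟨v₀, hv₀⟩ := R.continuousOn_compl
  refine measurable_of_continuousOn_compl_singleton v₀ ?_
  exact continuous_rowMul.comp_continuousOn
    (continuousOn_const.prodMk (continuous_subtype_val.comp_continuousOn hv₀))

end Frame

/-! ### Caps on the sphere -/

section Caps

open scoped Pointwise

variable {n : ℕ}

lemma norm_coe_sphere (v : UnitSphere n) : ‖(v : Euc (n + 1))‖ = 1 := by simp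

/-- Surface measure is proportional to the volume of the truncated cone over the cap. For t ≤ 1 the
cone is covered by O(1/t) balls of radius 2t along its axis, of total volume O(t^n); for t ≥ 1 the
total mass suffices. -/
lemma sphereMeasure_closedBall_le (n : ℕ) : ∃ C : NNReal, ∀ (v : UnitSphere n) (t : ℝ), 0 < t →
    sphereMeasure n (Metric.closedBall v t) ≤ C * ENNReal.ofReal (t ^ n) := by
  set b : ℝ≥0∞ := volume (Metric.ball (0 : Euc (n + 1)) 1) with hb
  have hbtop : b ≠ ⊤ := measure_ball_lt_top.ne
  have htop : sphereMeasure n univ ≠ ⊤ := by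
    unfold sphereMeasure
    exact measure_ne_top _ _
  have hCtop : (n + 1 : ℕ) * (ENNReal.ofReal (2 ^ (n + 2)) * b) + sphereMeasure n univ ≠ ⊤ :=
    ENNReal.add_ne_top.2 ⟨ENNReal.mul_ne_top (ENNReal.natCast_ne_top _)
      (ENNReal.mul_ne_top ENNReal.ofReal_ne_top hbtop), htop⟩
  refine ⟨((n + 1 : ℕ) * (ENNReal.ofReal (2 ^ (n + 2)) * b) + sphereMeasure n univ).toNNReal,
    fun v t ht => ?_⟩
  rw [ENNReal.coe_toNNReal hCtop]
  rcases le_total 1 t with h1 | h1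
  · calc sphereMeasure n (Metric.closedBall v t) ≤ sphereMeasure n univ := measure_mono (subset_univ _)
      _ = sphereMeasure n univ * 1 := (mul_one _).symm
      _ ≤ _ := by
        gcongr
        · exact le_add_self
        · rw [ENNReal.one_le_ofReal]
          exact one_le_pow₀ h1
  · rw [sphereMeasure, Measure.toSphere_apply' _ Metric.isClosed_closedBall.measurableSet]
    rw [finrank_euclideanSpace_fin]
    have hsub : Ioo (0 : ℝ) 1 • (((↑) : UnitSphere n → Euc (n + 1)) '' Metric.closedBall v t) ⊆
        ⋃ k ∈ Finset.range (⌊1 / t⌋₊ + 1),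
          Metric.closedBall (((k : ℝ) * t) • (v : Euc (n + 1))) (2 * t) := by
      rintro _ ⟨s, hs, _, ⟨v', hv', rfl⟩, rfl⟩
      have hs0 : 0 < s := hs.1
      have hs1 : s < 1 := hs.2
      refine mem_iUnion₂.2 ⟨⌊s / t⌋₊, ?_, ?_⟩
      · rw [Finset.mem_range, Nat.lt_succ_iff]
        exact Nat.floor_le_floor (by gcongr)
      · rw [mem_closedBall_iff_norm]
        set k := ⌊s / t⌋₊
        have hk1 : (k : ℝ) * t ≤ s := by
          rw [← le_div_iff₀ ht]
          exact Nat.floor_le (by positivity)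
        have hk2 : s < ((k : ℝ) + 1) * t := by
          rw [← div_lt_iff₀ ht]
          exact Nat.lt_floor_add_one _
        have e : s • (v' : Euc (n + 1)) - ((k : ℝ) * t) • (v : Euc (n + 1)) =
            s • ((v' : Euc (n + 1)) - v) + (s - k * t) • (v : Euc (n + 1)) := by
          rw [smul_sub, sub_smul]
          abel
        change ‖s • (v' : Euc (n + 1)) - ((k : ℝ) * t) • (v : Euc (n + 1))‖ ≤ 2 * t
        rw [e]
        refine (norm_add_le _ _).trans ?_
        rw [norm_smul, norm_smul, norm_coe_sphere, Real.norm_of_nonneg hs0.le,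
          Real.norm_of_nonneg (by linarith)]
        have h2 : ‖(v' : Euc (n + 1)) - v‖ ≤ t := by
          have : dist v' v ≤ t := hv'
          rwa [Subtype.dist_eq, dist_eq_norm] at this
        nlinarith [norm_nonneg ((v' : Euc (n + 1)) - v)]
    have hvol : volume (Ioo (0 : ℝ) 1 •
        (((↑) : UnitSphere n → Euc (n + 1)) '' Metric.closedBall v t)) ≤
        ENNReal.ofReal (2 ^ (n + 2)) * b * ENNReal.ofReal (t ^ n) := by
      refine (measure_mono hsub).trans ((measure_biUnion_finset_le _ _).trans ?_)
      simp_rw [Measure.addHaar_closedBall volume _ (show 0 ≤ 2 * t by positivity),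
        finrank_euclideanSpace_fin]
      rw [Finset.sum_const, Finset.card_range, nsmul_eq_mul, ← mul_assoc, mul_right_comm _ b]
      refine mul_le_mul' ?_ le_rfl
      rw [← ENNReal.ofReal_natCast, ← ENNReal.ofReal_mul (by positivity),
        ← ENNReal.ofReal_mul (by positivity)]
      refine ENNReal.ofReal_le_ofReal ?_
      have h3 : ((⌊1 / t⌋₊ + 1 : ℕ) : ℝ) ≤ 2 / t := by
        push_cast
        have h4 := Nat.floor_le (show 0 ≤ 1 / t by positivity)
        have h5 : 1 ≤ 1 / t := by rwa [le_div_iff₀ ht, one_mul]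
        have : 2 / t = 1 / t + 1 / t := by ring
        linarith
      calc ((⌊1 / t⌋₊ + 1 : ℕ) : ℝ) * (2 * t) ^ (n + 1) ≤ 2 / t * (2 * t) ^ (n + 1) := by gcongr
        _ = 2 ^ (n + 2) * t ^ n := by field_simp; ring
    calc ((n + 1 : ℕ) : ℝ≥0∞) * volume (Ioo (0 : ℝ) 1 •
        (((↑) : UnitSphere n → Euc (n + 1)) '' Metric.closedBall v t)) ≤
        ((n + 1 : ℕ) : ℝ≥0∞) * (ENNReal.ofReal (2 ^ (n + 2)) * b * ENNReal.ofReal (t ^ n)) := by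
          gcongr
      _ = ((n + 1 : ℕ) * (ENNReal.ofReal (2 ^ (n + 2)) * b)) * ENNReal.ofReal (t ^ n) := by ring
      _ ≤ _ := by
        gcongr
        exact le_self_add

/-- Uniform measure on the sphere with a neighborhood of one point removed. -/
lemma exists_capMeasure (v₀ : UnitSphere n) : ∃ (lam : ProbabilityMeasure (UnitSphere n))
    (C : NNReal), (lam : Measure (UnitSphere n)) ≪ sphereMeasure n ∧
    (lam : Measure (UnitSphere n)) {v | 1 ≤ dist v v₀}ᶜ = 0 ∧
    ∀ (v : UnitSphere n) (t : ℝ), 0 < t →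
      (lam : Measure (UnitSphere n)) (Metric.closedBall v t) ≤ C * ENNReal.ofReal (t ^ n) := by
  obtain ⟨C, hC⟩ := sphereMeasure_closedBall_le n
  set A : Set (UnitSphere n) := {v | 1 ≤ dist v v₀} with hA
  have hAm : MeasurableSet A := (isClosed_le continuous_const (by fun_prop)).measurableSet
  have hpos : sphereMeasure n A ≠ 0 := by
    have hopen : IsOpen {v : UnitSphere n | 1 < dist v v₀} :=
      isOpen_lt continuous_const (by fun_prop)
    have hne : (-v₀) ∈ {v : UnitSphere n | 1 < dist v v₀} := by
      change 1 < dist (-v₀) v₀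
      rw [Subtype.dist_eq, dist_eq_norm]
      have : ((-v₀ : UnitSphere n) : Euc (n + 1)) - v₀ = (-2 : ℝ) • (v₀ : Euc (n + 1)) := by
        rw [coe_neg_sphere]
        module
      rw [this, norm_smul, norm_coe_sphere]
      norm_num
    have h1 : 0 < sphereMeasure n {v : UnitSphere n | 1 < dist v v₀} := by
      unfold sphereMeasure
      exact hopen.measure_pos _ ⟨_, hne⟩
    exact (h1.trans_le (measure_mono fun v (hv : 1 < dist v v₀) => hv.le)).ne'
  have hfin : IsFiniteMeasure (sphereMeasure n) := by
    unfold sphereMeasure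
    infer_instance
  have hprob : IsProbabilityMeasure (ProbabilityTheory.cond (sphereMeasure n) A) :=
    ProbabilityTheory.cond_isProbabilityMeasure hpos
  refine ⟨⟨ProbabilityTheory.cond (sphereMeasure n) A, hprob⟩,
    ((sphereMeasure n A)⁻¹).toNNReal * C, ?_, ?_, fun v t ht => ?_⟩
  · exact ProbabilityTheory.cond_absolutelyContinuous
  · change ProbabilityTheory.cond (sphereMeasure n) A Aᶜ = 0
    rw [ProbabilityTheory.cond_apply hAm]
    simp
  · change ProbabilityTheory.cond (sphereMeasure n) A _ ≤ _
    rw [ProbabilityTheory.cond_apply hAm, ENNReal.coe_mul,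
      ENNReal.coe_toNNReal (ENNReal.inv_ne_top.2 hpos), mul_assoc]
    gcongr
    exact (measure_mono inter_subset_right).trans (hC v t ht)

/-- The lengths t and t' differ by at most the distance between t v and t' v', so replacing t' by t
costs that distance once more. -/
lemma mul_norm_sub_le {a t t' : ℝ} {v v' : UnitSphere n} (ha : 0 < a) (ht : a ≤ t) (ht' : a ≤ t') :
    a * ‖(v : Euc (n + 1)) - v'‖ ≤ 2 * ‖t • (v : Euc (n + 1)) - t' • (v' : Euc (n + 1))‖ := by
  set b := ‖t • (v : Euc (n + 1)) - t' • (v' : Euc (n + 1))‖ with hb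
  have h1 : |t - t'| ≤ b := by
    have := abs_norm_sub_norm_le (t • (v : Euc (n + 1))) (t' • (v' : Euc (n + 1)))
    rwa [norm_smul, norm_smul, norm_coe_sphere, norm_coe_sphere, mul_one, mul_one,
      Real.norm_of_nonneg (by linarith), Real.norm_of_nonneg (by linarith)] at this
  have h2 : t • ((v : Euc (n + 1)) - v') =
      (t • (v : Euc (n + 1)) - t' • (v' : Euc (n + 1))) + (t' - t) • (v' : Euc (n + 1)) := by
    rw [smul_sub, sub_smul]
    abel
  have h3 : t * ‖(v : Euc (n + 1)) - v'‖ ≤ b + |t - t'| := by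
    have h4 := congrArg norm h2
    rw [norm_smul, Real.norm_of_nonneg (by linarith)] at h4
    rw [h4]
    refine (norm_add_le _ _).trans ?_
    rw [norm_smul, norm_coe_sphere, mul_one, Real.norm_eq_abs, abs_sub_comm]
  have h5 : a * ‖(v : Euc (n + 1)) - v'‖ ≤ t * ‖(v : Euc (n + 1)) - v'‖ := by gcongr
  linarith

/-- A set of directions of diameter at most b / a lies in the cap of that radius about any of its
members. -/
lemma measure_cap_le {lam : Measure (UnitSphere n)} {C : NNReal}
    (hC : ∀ (v : UnitSphere n) (t : ℝ), 0 < t →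
      lam (Metric.closedBall v t) ≤ C * ENNReal.ofReal (t ^ n))
    {A : Set (UnitSphere n)} {a b : ℝ} (ha : 0 < a) (hb : 0 < b)
    (h : ∀ v ∈ A, ∀ v' ∈ A, a * ‖(v : Euc (n + 1)) - v'‖ ≤ b) :
    lam A ≤ C * ENNReal.ofReal ((b / a) ^ n) := by
  rcases A.eq_empty_or_nonempty with rfl | ⟨v, hv⟩
  · simp
  refine (measure_mono fun v' hv' => ?_).trans (hC v (b / a) (by positivity))
  rw [Metric.mem_closedBall, Subtype.dist_eq, dist_eq_norm, le_div_iff₀ ha, mul_comm]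
  exact h v' hv' v hv

end Caps

/-! ### Counting scatterers -/

section Topology

/-- Turns closeness in the metric hidden in `UniformWeakConv` into a statement about the weak
topology alone. -/
lemma tendsto_of_dist {Y : Type*} [t : TopologicalSpace Y] (δ : MetricSpace Y)
    (hδ : δ.toPseudoMetricSpace.toUniformSpace.toTopologicalSpace = t) {ι : Type*} {l : Filter ι}
    {x y : ι → Y} {z : Y} (hy : Tendsto y l (𝓝 z))
    (hxy : ∀ ε : ℝ, 0 < ε → ∀ᶠ j in l, δ.dist (x j) (y j) < ε) : Tendsto x l (𝓝 z) := by
  subst hδ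
  rw [Metric.tendsto_nhds] at hy ⊢
  intro ε hε
  filter_upwards [hy (ε / 2) (half_pos hε), hxy (ε / 2) (half_pos hε)] with j h1 h2
  have := dist_triangle (x j) (y j) z
  have h3 : dist (x j) (y j) < ε / 2 := h2
  linarith

lemma t2Space_of_metric {Y : Type*} [t : TopologicalSpace Y] (δ : MetricSpace Y)
    (hδ : δ.toPseudoMetricSpace.toUniformSpace.toTopologicalSpace = t) : T2Space Y := by
  subst hδ
  infer_instance

end Topology

section Counting

variable {n : ℕ} {S : Type*}

/-- A sequence of radii tending to zero. -/
def radSeq (j : ℕ) : Radius := ⟨1 / ((j : ℝ) + 2), by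
  constructor
  · positivity
  · rw [div_lt_one (by positivity)]
    linarith [Nat.cast_nonneg (α := ℝ) j]⟩

lemma tendsto_radSeq : Tendsto (fun j => (radSeq j : ℝ)) atTop (𝓝 0) := by
  have := (tendsto_one_div_add_atTop_nhds_zero_nat (𝕜 := ℝ)).comp (tendsto_add_atTop_nat 1)
  refine this.congr fun j => ?_
  simp only [Function.comp_apply, radSeq]
  push_cast
  ring

lemma ScattererConfig.finite_punctured (Q : ScattererConfig n S) (q : Euc (n + 1)) (L : ℝ) :
    {p | p ∈ Q.centers ∧ p ≠ q ∧ ‖p - q‖ < L}.Finite :=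
  (Q.finite_near q L).subset fun _ hp => ⟨hp.1, mem_closedBall_iff_norm.2 hp.2.2.le⟩

/-- The scatterer centers other than `q` at distance less than `L` from `q`. -/
def ScattererConfig.nearCenters (Q : ScattererConfig n S) (q : Euc (n + 1)) (L : ℝ) :
    Finset (Euc (n + 1)) :=
  (Q.finite_punctured q L).toFinset

lemma ScattererConfig.mem_nearCenters {Q : ScattererConfig n S} {q p : Euc (n + 1)} {L : ℝ} :
    p ∈ Q.nearCenters q L ↔ p ∈ Q.centers ∧ p ≠ q ∧ ‖p - q‖ < L :=
  (Q.finite_punctured q L).mem_toFinset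

lemma ScattererConfig.countable_centers (Q : ScattererConfig n S) : Q.centers.Countable := by
  have : Q.centers ⊆ ⋃ k : ℕ, Q.centers ∩ Metric.closedBall 0 k := fun p hp => by
    obtain ⟨k, hk⟩ := exists_nat_ge ‖p‖
    exact mem_iUnion.2 ⟨k, hp, by simpa using hk⟩
  exact (countable_iUnion fun k : ℕ => (Q.locallyFinite k).countable).mono this

variable [MetricSpace S] [CompactSpace S] [MeasurableSpace S] [BorelSpace S]

lemma StandingAssumptions.tendsto_ncard {R : FrameMap n} {Q : ScattererConfig n S} {c : ℝ}
    {m : ProbabilityMeasure S} {μ : S → ProbabilityMeasure (CountingMeasures (Marked n S))}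
    {E : Set (Euc (n + 1))} (hyp : StandingAssumptions R Q c m μ E) {A : Set (Euc (n + 1))}
    (hA : Bornology.IsBounded A) (hA0 : volume (frontier A) = 0) {V : Set S}
    (hV : (m : Measure S) (frontier V) = 0) :
    Tendsto (fun T : ℝ => ((Q.marked ∩ (fun y : Marked n S => (T • y.1, y.2)) '' (A ×ˢ V)).ncard : ℝ) /
      T ^ (n + 1)) atTop (𝓝 (c * (volume A * (m : Measure S) V).toReal)) := by
  rw [← Measure.prod_prod]
  refine hyp.uniform_density _ (hA.prod (isCompact_univ.isBounded.subset (subset_univ V))) ?_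
  rw [frontier_prod_eq]
  refine measure_union_null ?_ ?_
  · rw [Measure.prod_prod, hV, mul_zero]
  · rw [Measure.prod_prod, hA0, zero_mul]

/-- For L ≥ ‖q‖ the L-ball about q lies in the 2L-ball about 0, where [P1] bounds the count. The
constant does not depend on q; only the threshold does. -/
lemma StandingAssumptions.exists_card_le {R : FrameMap n} {Q : ScattererConfig n S} {c : ℝ}
    {m : ProbabilityMeasure S} {μ : S → ProbabilityMeasure (CountingMeasures (Marked n S))}
    {E : Set (Euc (n + 1))} (hyp : StandingAssumptions R Q c m μ E) :
    ∃ C : ℝ, 0 < C ∧ ∀ q, ∃ L₁ : ℝ, 1 ≤ L₁ ∧ ∀ L ≥ L₁,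
      ((Q.nearCenters q L).card : ℝ) ≤ C * L ^ (n + 1) := by
  have h := hyp.tendsto_ncard (A := Metric.ball 0 1) (V := univ) Metric.isBounded_ball
    (measure_mono_null Metric.frontier_ball_subset_sphere (Measure.addHaar_sphere _ _ _)) (by simp)
  set b := c * (volume (Metric.ball (0 : Euc (n + 1)) 1) * (m : Measure S) univ).toReal with hb
  have hb0 : 0 ≤ b := mul_nonneg hyp.density_pos.le ENNReal.toReal_nonneg
  obtain ⟨T₀, hT₀⟩ := eventually_atTop.1 ((h.eventually (gt_mem_nhds (lt_add_one b))))
  refine ⟨(b + 1) * 2 ^ (n + 1), by positivity, fun q => ⟨max 1 (max (‖q‖) T₀), le_max_left _ _,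
    fun L hL => ?_⟩⟩
  have hL1 : 1 ≤ L := (le_max_left _ _).trans hL
  have hLq : ‖q‖ ≤ L := ((le_max_left _ _).trans (le_max_right _ _)).trans hL
  have hLT : T₀ ≤ L := ((le_max_right _ _).trans (le_max_right _ _)).trans hL
  have h2 := hT₀ (2 * L) (by linarith)
  rw [div_lt_iff₀ (by positivity)] at h2
  have h3 : (Q.nearCenters q L).card ≤
      (Q.marked ∩ (fun y : Marked n S => ((2 * L) • y.1, y.2)) '' (Metric.ball 0 1 ×ˢ univ)).ncard := by
    rw [← Set.ncard_coe_finset]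
    refine Set.ncard_le_ncard_of_injOn (fun p => (p, Q.mark p)) ?_ ?_ ?_
    · intro p hp
      rw [Finset.mem_coe, ScattererConfig.mem_nearCenters] at hp
      refine ⟨⟨p, hp.1, rfl⟩, ⟨((2 * L)⁻¹ • p, Q.mark p), ⟨?_, mem_univ _⟩, ?_⟩⟩
      · rw [mem_ball_zero_iff, norm_smul, norm_inv, Real.norm_of_nonneg (by linarith),
          inv_mul_lt_iff₀ (by linarith)]
        have := norm_add_le (p - q) q
        rw [sub_add_cancel] at this
        linarith [hp.2.2]
      · simp only [Prod.mk.injEq, and_true]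
        rw [smul_smul, mul_inv_cancel₀ (by linarith), one_smul]
    · intro p _ p' _ h
      exact (Prod.mk.inj h).1
    · refine ((Q.locallyFinite (2 * L)).image (fun p => (p, Q.mark p))).subset ?_
      rintro y ⟨⟨p, hp, rfl⟩, ⟨z, hz, hzy⟩⟩
      refine ⟨p, ⟨hp, ?_⟩, rfl⟩
      have h4 : (2 * L) • z.1 = p := congrArg Prod.fst hzy
      rw [← h4, mem_closedBall_zero_iff, norm_smul, Real.norm_of_nonneg (by linarith)]
      have : ‖z.1‖ < 1 := mem_ball_zero_iff.1 hz.1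
      nlinarith
  have h4 : ((Q.nearCenters q L).card : ℝ) ≤ (b + 1) * (2 * L) ^ (n + 1) :=
    (by exact_mod_cast h3 : ((Q.nearCenters q L).card : ℝ) ≤ _).trans h2.le
  rw [mul_pow, ← mul_assoc] at h4
  exact h4

/-- Weighted count of the scatterer centers near `q`, by dyadic decomposition. -/
lemma StandingAssumptions.exists_sum_le {R : FrameMap n} {Q : ScattererConfig n S} {c : ℝ}
    {m : ProbabilityMeasure S} {μ : S → ProbabilityMeasure (CountingMeasures (Marked n S))}
    {E : Set (Euc (n + 1))} (hyp : StandingAssumptions R Q c m μ E) :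
    ∃ C : ℝ, 0 < C ∧ ∀ q, ∃ L₀ : ℝ, ∀ L ≥ L₀,
      ∑ p ∈ Q.nearCenters q L, (‖p - q‖ ^ n)⁻¹ ≤ C * L := by
  obtain ⟨C, hC, h⟩ := hyp.exists_card_le
  refine ⟨C * 2 ^ (n + 1) * 2 + 1, by positivity, fun q => ?_⟩
  obtain ⟨L₁, hL₁, h1⟩ := h q
  set W : ℝ → ℝ := fun L => ∑ p ∈ Q.nearCenters q L, (‖p - q‖ ^ n)⁻¹ with hW
  have hmono : ∀ {L L' : ℝ}, L ≤ L' → W L ≤ W L' := fun {L L'} hLL' =>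
    Finset.sum_le_sum_of_subset_of_nonneg (fun p hp => by
      rw [ScattererConfig.mem_nearCenters] at hp ⊢
      exact ⟨hp.1, hp.2.1, hp.2.2.trans_le hLL'⟩) (fun p _ _ => by positivity)
  -- In the shell between L and 2L each weight is at most L^(-n) and there are O(L^(n+1)) centers.
  -- The resulting increments of order L sum geometrically.
  have hdouble : ∀ L ≥ L₁, W (2 * L) ≤ W L + C * 2 ^ (n + 1) * L := by
    intro L hL
    have hL0 : 0 < L := by linarith
    have hsub : Q.nearCenters q L ⊆ Q.nearCenters q (2 * L) := fun p hp => by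
      rw [ScattererConfig.mem_nearCenters] at hp ⊢
      exact ⟨hp.1, hp.2.1, by linarith [hp.2.2]⟩
    simp only [hW]
    rw [← Finset.sum_sdiff hsub, add_comm]
    gcongr
    calc ∑ p ∈ Q.nearCenters q (2 * L) \ Q.nearCenters q L, (‖p - q‖ ^ n)⁻¹
        ≤ ∑ p ∈ Q.nearCenters q (2 * L) \ Q.nearCenters q L, (L ^ n)⁻¹ := by
          refine Finset.sum_le_sum fun p hp => ?_
          rw [Finset.mem_sdiff, ScattererConfig.mem_nearCenters, ScattererConfig.mem_nearCenters] at hp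
          have : L ≤ ‖p - q‖ := by
            by_contra hc
            exact hp.2 ⟨hp.1.1, hp.1.2.1, not_le.1 hc⟩
          gcongr
      _ ≤ (Q.nearCenters q (2 * L)).card * (L ^ n)⁻¹ := by
          rw [Finset.sum_const, nsmul_eq_mul]
          gcongr
          exact Finset.sdiff_subset
      _ ≤ (C * (2 * L) ^ (n + 1)) * (L ^ n)⁻¹ := by
          gcongr
          exact h1 _ (by linarith)
      _ = C * 2 ^ (n + 1) * L := by
          field_simp
          ring
  have hpow : ∀ k : ℕ, W (2 ^ k * L₁) ≤ W L₁ + C * 2 ^ (n + 1) * (2 ^ k * L₁) := by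
    intro k
    induction k with
    | zero =>
      simp only [pow_zero, one_mul]
      have : 0 ≤ C * 2 ^ (n + 1) * L₁ := by positivity
      linarith
    | succ k ih =>
      have h2 : L₁ ≤ 2 ^ k * L₁ := le_mul_of_one_le_left (by linarith) (one_le_pow₀ (by norm_num))
      have h3 := hdouble _ h2
      rw [← mul_assoc, ← pow_succ'] at h3
      have h4 : (2 : ℝ) ^ (k + 1) * L₁ = 2 * (2 ^ k * L₁) := by ring
      rw [h4] at h3 ⊢
      nlinarith
  -- The threshold absorbs the initial sum into L, which is the + 1 in the constant; rounding L / L₁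
  -- up to a power of two costs the factor 2.
  refine ⟨max L₁ (W L₁), fun L hL => ?_⟩
  have hL1 : L₁ ≤ L := (le_max_left _ _).trans hL
  have hL2 : W L₁ ≤ L := (le_max_right _ _).trans hL
  have hLL : 1 ≤ L / L₁ := by rwa [le_div_iff₀ (by linarith), one_mul]
  obtain ⟨k, hk1, hk2⟩ := exists_nat_pow_near hLL one_lt_two
  rw [le_div_iff₀ (by linarith)] at hk1
  rw [div_lt_iff₀ (by linarith)] at hk2
  have h5 := (hmono hk2.le).trans (hpow (k + 1))
  have h6 : (2 : ℝ) ^ (k + 1) * L₁ ≤ 2 * L := by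
    rw [pow_succ']
    linarith
  have h7 : C * 2 ^ (n + 1) * (2 ^ (k + 1) * L₁) ≤ C * 2 ^ (n + 1) * (2 * L) := by gcongr
  calc W L ≤ W L₁ + C * 2 ^ (n + 1) * (2 ^ (k + 1) * L₁) := h5
    _ ≤ L + C * 2 ^ (n + 1) * (2 * L) := add_le_add hL2 h7
    _ = _ := by ring

/-! ### Expected number of points of the rescaled configuration -/

lemma measurable_frameAction (R : FrameMap n) (ρ : ℝ) (q : Euc (n + 1)) (y : Marked n S) :
    Measurable fun v => frameAction R ρ q v y := by
  refine Measurable.prodMk ?_ measurable_const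
  have hc : Continuous fun x : Euc (n + 1) => rowMul x (scaleMatrix n ρ) :=
    continuous_rowMul.comp (Continuous.prodMk_left (scaleMatrix n ρ))
  exact hc.measurable.comp (measurable_rowMul_frame R (y.1 - q))

lemma ScattererConfig.mem_view {Q : ScattererConfig n S} {R : FrameMap n} {ρ : ℝ}
    {q : Euc (n + 1)} {v : UnitSphere n} {y : Marked n S} :
    y ∈ Q.view R ρ q v ↔ ∃ p ∈ Q.centers, p ≠ q ∧ frameAction R ρ q v (p, Q.mark p) = y := by
  constructor
  · rintro ⟨_, ⟨⟨p, hp, rfl⟩, hpq⟩, rfl⟩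
    exact ⟨p, hp, hpq, rfl⟩
  · rintro ⟨p, hp, hpq, rfl⟩
    exact ⟨_, ⟨⟨p, hp, rfl⟩, hpq⟩, rfl⟩

lemma ScattererConfig.points_viewMeasure {Q : ScattererConfig n S} {R : FrameMap n} {ρ : Radius}
    {q : Euc (n + 1)} {v : UnitSphere n} :
    (Q.viewMeasure R ρ q v).points = Q.view R ρ q v := by
  ext y
  change (Measure.sum fun y : Q.view R ρ q v => Measure.dirac (y : Marked n S)) {y} ≠ 0 ↔ _
  rw [Measure.sum_apply _ (measurableSet_singleton y)]
  simp only [ne_eq, ENNReal.tsum_eq_zero, not_forall]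
  constructor
  · rintro ⟨z, hz⟩
    rw [Measure.dirac_apply' _ (measurableSet_singleton y)] at hz
    have : (z : Marked n S) = y := by
      by_contra hne
      exact hz (by simp [hne])
    exact this ▸ z.2
  · intro hy
    exact ⟨⟨y, hy⟩, by simp⟩

lemma ScattererConfig.viewMeasure_apply (Q : ScattererConfig n S) (R : FrameMap n) (ρ : Radius)
    (q : Euc (n + 1)) (v : UnitSphere n) {G : Set (Marked n S)} (hG : MeasurableSet G) :
    (Q.viewMeasure R ρ q v).1 G = ∑' p : {p | p ∈ Q.centers ∧ p ≠ q},
      {v | frameAction R ρ q v ((p : Euc (n + 1)), Q.mark p) ∈ G}.indicator 1 v := by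
  change (Measure.sum fun y : Q.view R ρ q v => Measure.dirac (y : Marked n S)) G = _
  rw [Measure.sum_apply _ hG]
  simp_rw [Measure.dirac_apply' _ hG]
  have hinj : Function.Injective fun p => frameAction R ρ q v (p, Q.mark p) := fun p p' h => by
    have := frameAction_injective R ρ q v h
    exact (Prod.mk.inj this).1
  have himg : Q.view R ρ q v =
      (fun p => frameAction R ρ q v (p, Q.mark p)) '' {p | p ∈ Q.centers ∧ p ≠ q} := by
    ext y
    rw [ScattererConfig.mem_view]
    simp only [mem_image, mem_ofPred_eq, and_assoc]
  rw [himg, tsum_image (fun y => G.indicator (1 : Marked n S → ℝ≥0∞) y) hinj.injOn]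
  rfl

/-- Campbell's formula: the randomness is only in the direction, so expected counts are sums of
direction probabilities over the countably many centers. -/
lemma ScattererConfig.lintegral_viewLaw (Q : ScattererConfig n S) (R : FrameMap n) (ρ : Radius)
    (q : Euc (n + 1)) (lam : ProbabilityMeasure (UnitSphere n)) {G : Set (Marked n S)}
    (hG : MeasurableSet G) :
    ∫⁻ ν, ν.1 G ∂(Q.viewLaw R lam q ρ : Measure (CountingMeasures (Marked n S))) =
      ∑' p : {p | p ∈ Q.centers ∧ p ≠ q},
        (lam : Measure (UnitSphere n)) {v | frameAction R ρ q v ((p : Euc (n + 1)), Q.mark p) ∈ G} := by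
  have hcount : Countable {p | p ∈ Q.centers ∧ p ≠ q} :=
    (Q.countable_centers.mono fun p hp => hp.1).to_subtype
  rw [ScattererConfig.viewLaw, ProbabilityMeasure.toMeasure_map,
    lintegral_map (CountingMeasures.measurable_apply hG) (Q.measurable_viewMeasure R ρ q)]
  simp_rw [Q.viewMeasure_apply R ρ q _ hG]
  have hm : ∀ p : {p | p ∈ Q.centers ∧ p ≠ q},
      MeasurableSet {v | frameAction R ρ q v ((p : Euc (n + 1)), Q.mark p) ∈ G} := fun p =>
    measurable_frameAction R ρ q _ hG
  rw [lintegral_tsum fun p => (measurable_one.indicator (hm p)).aemeasurable]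
  exact tsum_congr fun p => lintegral_indicator_one (hm p)

lemma ScattererConfig.lintegral_viewLaw_le (Q : ScattererConfig n S) (R : FrameMap n) (ρ : Radius)
    (q : Euc (n + 1)) (lam : ProbabilityMeasure (UnitSphere n)) {G : Set (Marked n S)}
    (hG : MeasurableSet G) (F : Finset (Euc (n + 1))) (g : Euc (n + 1) → ℝ≥0∞)
    (h : ∀ p ∈ Q.centers, p ≠ q → (lam : Measure (UnitSphere n))
      {v | frameAction R ρ q v (p, Q.mark p) ∈ G} ≤ if p ∈ F then g p else 0) :
    ∫⁻ ν, ν.1 G ∂(Q.viewLaw R lam q ρ : Measure (CountingMeasures (Marked n S))) ≤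
      ∑ p ∈ F, g p := by
  classical
  rw [Q.lintegral_viewLaw R ρ q lam hG]
  calc _ ≤ ∑' p : {p | p ∈ Q.centers ∧ p ≠ q}, (if (p : Euc (n + 1)) ∈ F then g p else 0) :=
        ENNReal.tsum_le_tsum fun p => by convert h p p.2.1 p.2.2
    _ ≤ ∑' p : Euc (n + 1), (if p ∈ F then g p else 0) :=
        ENNReal.tsum_comp_le_tsum_of_injective Subtype.val_injective
          (fun p => if p ∈ F then g p else 0)
    _ = ∑ p ∈ F, g p := by
        rw [tsum_eq_sum (s := F) fun p hp => by simp [hp]]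
        exact Finset.sum_congr rfl fun p hp => by simp [hp]

/-- [P2] compares the law with the limit at the moving mark ς(q_j), uniformly; continuity of ς ↦ μ_ς
then moves that limit to s. -/
lemma StandingAssumptions.tendsto_viewLaw {R : FrameMap n} {Q : ScattererConfig n S} {c : ℝ}
    {m : ProbabilityMeasure S} {μ : S → ProbabilityMeasure (CountingMeasures (Marked n S))}
    {E : Set (Euc (n + 1))} (hyp : StandingAssumptions R Q c m μ E) {T : ℝ} (hT : 1 ≤ T)
    {lam : ProbabilityMeasure (UnitSphere n)}
    (hlam : (lam : Measure (UnitSphere n)) ≪ sphereMeasure n) {ρ : ℕ → Radius}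
    (hρ : Tendsto (fun j => (ρ j : ℝ)) atTop (𝓝 0)) {q : ℕ → Euc (n + 1)}
    (hq : ∀ᶠ j in atTop, q j ∈ Q.centersIn E T (ρ j)) {s : S}
    (hs : Tendsto (fun j => Q.mark (q j)) atTop (𝓝 s)) :
    Tendsto (fun j => Q.viewLaw R lam (q j) (ρ j)) atTop (𝓝 (μ s)) := by
  obtain ⟨δ, hδ, h⟩ := hyp.spherical_equidistribution T hT lam hlam
  refine tendsto_of_dist δ hδ ((hyp.continuous_limit.tendsto s).comp hs) fun ε hε => ?_
  obtain ⟨ρ₀, hρ₀⟩ := h ε hε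
  filter_upwards [hq, hρ.eventually (gt_mem_nhds ρ₀.2.1)] with j hj hj'
  exact hρ₀ (ρ j) hj' (q j) hj

/-- [P2], for any admissible λ, asserts that the weak topology is metrizable. Needed for uniqueness
of limits in the dilation invariance. -/
lemma StandingAssumptions.t2Space {R : FrameMap n} {Q : ScattererConfig n S} {c : ℝ}
    {m : ProbabilityMeasure S} {μ : S → ProbabilityMeasure (CountingMeasures (Marked n S))}
    {E : Set (Euc (n + 1))} (hyp : StandingAssumptions R Q c m μ E) :
    T2Space (ProbabilityMeasure (CountingMeasures (Marked n S))) := by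
  obtain ⟨v₀, -⟩ := R.continuousOn_compl
  obtain ⟨lam, -, hlam, -⟩ := exists_capMeasure v₀
  obtain ⟨δ, hδ, -⟩ := hyp.spherical_equidistribution 1 le_rfl lam hlam
  exact t2Space_of_metric δ hδ

lemma ScattererConfig.eventually_mem_centersIn (Q : ScattererConfig n S) {E : Set (Euc (n + 1))}
    {q : Euc (n + 1)} (hn : 1 ≤ n) (hq : q ∈ Q.centers \ E) {ρ : ℕ → Radius}
    (hρ : Tendsto (fun j => (ρ j : ℝ)) atTop (𝓝 0)) :
    ∀ᶠ j in atTop, q ∈ Q.centersIn E 1 (ρ j) := by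
  have h1 : Tendsto (fun j => (ρ j : ℝ) ^ n * ‖q‖) atTop (𝓝 0) := by
    have := (hρ.pow n).mul_const ‖q‖
    rwa [zero_pow (by omega), zero_mul] at this
  filter_upwards [h1.eventually (gt_mem_nhds one_pos)] with j hj
  refine ⟨⟨hq.1, ?_⟩, hq.2⟩
  rw [mem_ball_zero_iff, one_mul, ← one_div, lt_div_iff₀ (pow_pos (ρ j).2.1 n), mul_comm]
  exact hj

end Counting

/-! ### Directions sending a scatterer to a given region -/

section Directions

variable {n : ℕ}

/-- Both frames decompose the same vector u, so the axial parts differ by exactly as much as the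
transverse parts. A constraint on transverse parts becomes one on the angle between v and v'. -/
lemma norm_smul_sub_smul_le (R : FrameMap n) (u : Euc (n + 1)) (v v' : UnitSphere n) :
    ‖inner ℝ u (v : Euc (n + 1)) • (v : Euc (n + 1)) -
      inner ℝ u (v' : Euc (n + 1)) • (v' : Euc (n + 1))‖ =
    ‖unframe R v (perp (rowMul u (R.toFun v).1)) - unframe R v' (perp (rowMul u (R.toFun v').1))‖ := by
  have h1 := eq_smul_add_unframe R v u
  have h2 := eq_smul_add_unframe R v' u
  rw [norm_sub_rev (unframe _ _ _)]
  congr 1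
  rw [sub_eq_sub_iff_add_eq_add, add_comm (unframe _ _ _), ← h1, ← h2]

lemma norm_le_abs_inner_add (R : FrameMap n) (u : Euc (n + 1)) (v : UnitSphere n) :
    ‖u‖ ≤ |inner ℝ u (v : Euc (n + 1))| + ‖perp (rowMul u (R.toFun v).1)‖ := by
  rw [← rowMul_frame_zero R v, ← norm_rowMul (R.toFun v) u]
  exact norm_le_add _

lemma abs_inner_le (u : Euc (n + 1)) (v : UnitSphere n) : |inner ℝ u (v : Euc (n + 1))| ≤ ‖u‖ := by
  have := abs_real_inner_le_norm u (v : Euc (n + 1))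
  rwa [norm_coe_sphere, mul_one] at this

/-- Vectors `t v` and `t' v'` with `t` and `t'` of the same sign. -/
lemma mul_norm_sub_le_of_sign {a t t' : ℝ} {v v' : UnitSphere n} (ha : 0 < a)
    (h : (a ≤ t ∧ a ≤ t') ∨ (t ≤ -a ∧ t' ≤ -a)) :
    a * ‖(v : Euc (n + 1)) - v'‖ ≤ 2 * ‖t • (v : Euc (n + 1)) - t' • (v' : Euc (n + 1))‖ := by
  rcases h with ⟨h1, h2⟩ | ⟨h1, h2⟩
  · exact mul_norm_sub_le ha h1 h2
  · have := mul_norm_sub_le (v := v) (v' := v') ha (le_neg.2 h1) (le_neg.2 h2)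
    rwa [neg_smul, neg_smul, ← neg_sub', norm_neg] at this

/-- Admissible directions see u at axial distance of order |x₁| ρ^(-n), with transverse part ρ times
a vector within r of x_⊥. Two such directions therefore differ by O(r ρ^(n+1) / |x₁|). Comparing
transverse parts in different frames uses uniform continuity of the frame, hence the excluded
neighborhood of v₀. -/
lemma measure_directions_ball_le {R : FrameMap n} {v₀ : UnitSphere n}
    (hR : ContinuousOn R.toFun {v₀}ᶜ) {lam : Measure (UnitSphere n)} {C : NNReal}
    (h0 : lam {v | 1 ≤ dist v v₀}ᶜ = 0)
    (hC : ∀ (v : UnitSphere n) (t : ℝ), 0 < t →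
      lam (Metric.closedBall v t) ≤ C * ENNReal.ofReal (t ^ n))
    (x : Euc (n + 1)) (hx : x 0 ≠ 0) {r : ℝ} (hr : 0 < r) (hrx : r ≤ |x 0| / 4) :
    ∃ ρ₀ : ℝ, 0 < ρ₀ ∧ ∀ ρ : Radius, (ρ : ℝ) < ρ₀ → ∀ u : Euc (n + 1),
      lam {v | |(ρ : ℝ) ^ n * inner ℝ u (v : Euc (n + 1)) - x 0| < r ∧
          ‖(ρ : ℝ)⁻¹ • perp (rowMul u (R.toFun v).1) - perp x‖ < r} ≤
        if |x 0| - r < (ρ : ℝ) ^ n * ‖u‖ ∧ (ρ : ℝ) ^ n * ‖u‖ < |x 0| + 2 * r then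
          C * ENNReal.ofReal ((8 * r * (ρ : ℝ) ^ (n + 1) / |x 0|) ^ n) else 0 := by
  have ha : 0 < |x 0| := abs_pos.2 hx
  set a := |x 0| with ha_def
  set M := ‖perp x‖ + r with hM_def
  have hM : 0 < M := by positivity
  obtain ⟨δ, hδ, hclose⟩ := exists_unframe_close R hR M hr
  -- The first bound makes the crude estimate below give distance less than δ; the second makes the
  -- transverse contribution to the rescaled ‖u‖ less than r.
  refine ⟨min (δ * a / (6 * M)) (r / M), by positivity, fun ρ hρ u => ?_⟩
  obtain ⟨ρ, hρ0, hρ1⟩ := ρ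
  simp only at hρ ⊢
  obtain ⟨hρa, hρb⟩ := lt_min_iff.1 hρ
  rw [lt_div_iff₀ (by positivity)] at hρa
  rw [lt_div_iff₀ hM] at hρb
  have hρn : ρ ^ (n + 1) ≤ ρ := by
    rw [pow_succ]
    exact mul_le_of_le_one_left hρ0.le (pow_le_one₀ hρ0.le hρ1.le)
  have hρnpos : 0 < ρ ^ n := by positivity
  set B : Set (UnitSphere n) := {v | |ρ ^ n * inner ℝ u (v : Euc (n + 1)) - x 0| < r ∧
          ‖ρ⁻¹ • perp (rowMul u (R.toFun v).1) - perp x‖ < r} with hB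
  have hBM : ∀ v ∈ B, ‖ρ⁻¹ • perp (rowMul u (R.toFun v).1)‖ ≤ M := fun v hv => by
    have := norm_add_le (ρ⁻¹ • perp (rowMul u (R.toFun v).1) - perp x) (perp x)
    rw [sub_add_cancel] at this
    linarith [hv.2]
  have hperp : ∀ v, perp (rowMul u (R.toFun v).1) = ρ • (ρ⁻¹ • perp (rowMul u (R.toFun v).1)) :=
    fun v => by rw [smul_smul, mul_inv_cancel₀ hρ0.ne', one_smul]
  split_ifs with hcond
  · have hle : lam B ≤ lam (B ∩ {v | 1 ≤ dist v v₀}) := by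
      calc lam B ≤ lam ((B ∩ {v | 1 ≤ dist v v₀}) ∪ {v | 1 ≤ dist v v₀}ᶜ) := measure_mono (by
            intro v hv
            by_cases hv' : v ∈ {v | 1 ≤ dist v v₀}
            · exact Or.inl ⟨hv, hv'⟩
            · exact Or.inr hv')
        _ ≤ _ := (measure_union_le _ _).trans (by rw [h0, add_zero])
    refine hle.trans ?_
    have e : 8 * r * ρ ^ (n + 1) / a = (6 * r * ρ ^ (n + 1)) / (3 / 4 * a) := by
      field_simp
      ring
    rw [e]
    refine measure_cap_le hC (by positivity) (by positivity) ?_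
    rintro v ⟨hv, hv1⟩ v' ⟨hv', hv1'⟩
    have hsign : (3 / 4 * a / ρ ^ n ≤ inner ℝ u (v : Euc (n + 1)) ∧
        3 / 4 * a / ρ ^ n ≤ inner ℝ u (v' : Euc (n + 1))) ∨
        (inner ℝ u (v : Euc (n + 1)) ≤ -(3 / 4 * a / ρ ^ n) ∧
          inner ℝ u (v' : Euc (n + 1)) ≤ -(3 / 4 * a / ρ ^ n)) := by
      have h1 := abs_lt.1 hv.1
      have h2 := abs_lt.1 hv'.1
      rcases lt_or_gt_of_ne hx with hneg | hpos
      · right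
        have : a = -x 0 := abs_of_neg hneg
        constructor <;> rw [le_neg, div_le_iff₀ hρnpos] <;> linarith
      · left
        have : a = x 0 := abs_of_pos hpos
        rw [div_le_iff₀ hρnpos, div_le_iff₀ hρnpos]
        constructor <;> linarith
    have hbase := mul_norm_sub_le_of_sign (v := v) (v' := v') (by positivity) hsign
    have hun : ∀ v, unframe R v (perp (rowMul u (R.toFun v).1)) =
        ρ • unframe R v (ρ⁻¹ • perp (rowMul u (R.toFun v).1)) := fun v => by
      rw [← unframe_smul, ← hperp v]
    rw [norm_smul_sub_smul_le R, hun v, hun v', ← smul_sub,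
      norm_smul, Real.norm_of_nonneg hρ0.le, div_mul_eq_mul_div, div_le_iff₀ hρnpos] at hbase
    set w := ρ⁻¹ • perp (rowMul u (R.toFun v).1) with hw
    set w' := ρ⁻¹ • perp (rowMul u (R.toFun v').1) with hw'
    -- Bootstrap: this bound, which ignores that w and w' are close, already brings v and v' within
    -- δ of each other.
    have hcrude : ‖unframe R v w - unframe R v' w'‖ ≤ 2 * M := by
      refine (norm_sub_le _ _).trans ?_
      rw [norm_unframe, norm_unframe]
      linarith [hBM v hv, hBM v' hv']
    have hd : ‖(v : Euc (n + 1)) - v'‖ < δ := by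
      have h3 : 3 / 4 * a * ‖(v : Euc (n + 1)) - v'‖ ≤ 4 * M * ρ := by
        calc _ ≤ 2 * (ρ * ‖unframe R v w - unframe R v' w'‖) * ρ ^ n := hbase
          _ ≤ 2 * (ρ * (2 * M)) * ρ ^ n := by gcongr
          _ = 4 * M * ρ ^ (n + 1) := by ring
          _ ≤ 4 * M * ρ := by gcongr
      by_contra hc
      have h4 : 3 / 4 * a * δ ≤ 3 / 4 * a * ‖(v : Euc (n + 1)) - v'‖ := by
        gcongr
        exact not_lt.1 hc
      nlinarith [mul_pos ha hδ]
    -- Now the change of frame costs only r and the change of transverse vector 2r, which yields a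
    -- bound proportional to r instead of M.
    have hfine : ‖unframe R v w - unframe R v' w'‖ ≤ 3 * r := by
      have h5 : unframe R v w - unframe R v' w' =
          (unframe R v w - unframe R v' w) + unframe R v' (w - w') := by
        rw [unframe_sub]
        abel
      rw [h5]
      refine (norm_add_le _ _).trans ?_
      rw [norm_unframe]
      have h6 := hclose v v' hv1 hv1' (by rwa [Subtype.dist_eq, dist_eq_norm]) w (hBM v hv)
      have h7 : ‖w - w'‖ ≤ 2 * r := by
        have h8 : w - w' = (w - perp x) - (w' - perp x) := by abel
        rw [h8]
        refine (norm_sub_le _ _).trans ?_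
        linarith [hv.2, hv'.2]
      linarith
    calc _ ≤ 2 * (ρ * ‖unframe R v w - unframe R v' w'‖) * ρ ^ n := hbase
      _ ≤ 2 * (ρ * (3 * r)) * ρ ^ n := by gcongr
      _ = 6 * r * ρ ^ (n + 1) := by ring
  · have : B = ∅ := by
      refine eq_empty_of_forall_notMem fun v hv => hcond ⟨?_, ?_⟩
      · have h1 := abs_lt.1 hv.1
        have h2 : a - r < ρ ^ n * |inner ℝ u (v : Euc (n + 1))| := by
          rw [← abs_of_pos hρnpos, ← abs_mul]
          have := abs_sub_abs_le_abs_sub (x 0) (ρ ^ n * inner ℝ u (v : Euc (n + 1)))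
          rw [abs_sub_comm (x 0)] at this
          linarith [hv.1]
        exact h2.trans_le (by gcongr; exact abs_inner_le u v)
      · have h1 : ρ ^ n * |inner ℝ u (v : Euc (n + 1))| < a + r := by
          rw [← abs_of_pos hρnpos, ← abs_mul]
          have := abs_sub_abs_le_abs_sub (ρ ^ n * inner ℝ u (v : Euc (n + 1))) (x 0)
          linarith [hv.1]
        have h2 := norm_le_abs_inner_add R u v
        have h3 : ‖perp (rowMul u (R.toFun v).1)‖ ≤ ρ * M := by
          rw [hperp v, norm_smul, Real.norm_of_nonneg hρ0.le]
          gcongr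
          exact hBM v hv
        calc ρ ^ n * ‖u‖ ≤ ρ ^ n * (|inner ℝ u (v : Euc (n + 1))| + ρ * M) := by
              gcongr
              linarith
          _ = ρ ^ n * |inner ℝ u (v : Euc (n + 1))| + ρ ^ (n + 1) * M := by ring
          _ ≤ ρ ^ n * |inner ℝ u (v : Euc (n + 1))| + ρ * M := by gcongr
          _ < a + 2 * r := by linarith
    rw [this, measure_empty]

/-- The sign of the axial component is not determined here, so two opposite caps occur. The lower
bound on ‖u‖ makes this component at least ‖u‖ / 2 in absolute value, and the crude transverse bound
suffices, so continuity of the frame is not needed. -/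
lemma measure_directions_slab_le {R : FrameMap n} {lam : Measure (UnitSphere n)} {C : NNReal}
    (hC : ∀ (v : UnitSphere n) (t : ℝ), 0 < t →
      lam (Metric.closedBall v t) ≤ C * ENNReal.ofReal (t ^ n))
    {ε r : ℝ} (hr : 0 < r) (ρ : Radius) (u : Euc (n + 1)) (hu : u ≠ 0)
    (hur : 2 * ρ * r ≤ ‖u‖) :
      lam {v | |(ρ : ℝ) ^ n * inner ℝ u (v : Euc (n + 1))| < ε ∧
          ‖(ρ : ℝ)⁻¹ • perp (rowMul u (R.toFun v).1)‖ < r} ≤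
        if (ρ : ℝ) ^ n * ‖u‖ < ε + ρ * r then
          2 * C * ENNReal.ofReal ((8 * ρ * r / ‖u‖) ^ n) else 0 := by
  obtain ⟨ρ, hρ0, hρ1⟩ := ρ
  simp only at hur ⊢
  have hu0 : 0 < ‖u‖ := norm_pos_iff.2 hu
  have hρnpos : 0 < ρ ^ n := by positivity
  set B : Set (UnitSphere n) := {v | |ρ ^ n * inner ℝ u (v : Euc (n + 1))| < ε ∧
          ‖ρ⁻¹ • perp (rowMul u (R.toFun v).1)‖ < r} with hB
  have hperp : ∀ v ∈ B, ‖perp (rowMul u (R.toFun v).1)‖ ≤ ρ * r := fun v hv => by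
    have := hv.2
    rw [norm_smul, norm_inv, Real.norm_of_nonneg hρ0.le, inv_mul_lt_iff₀ hρ0] at this
    exact this.le
  split_ifs with hcond
  · have hsub : B ⊆ (B ∩ {v | 0 ≤ inner ℝ u (v : Euc (n + 1))}) ∪
        (B ∩ {v | inner ℝ u (v : Euc (n + 1)) ≤ 0}) := fun v hv => by
      rcases le_total 0 (inner ℝ u (v : Euc (n + 1))) with h | h
      · exact Or.inl ⟨hv, h⟩
      · exact Or.inr ⟨hv, h⟩
    have e : 8 * ρ * r / ‖u‖ = (4 * (ρ * r)) / (‖u‖ / 2) := by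
      field_simp
      ring
    have hlow : ∀ v ∈ B, ‖u‖ / 2 ≤ |inner ℝ u (v : Euc (n + 1))| := fun v hv => by
      linarith [norm_le_abs_inner_add R u v, hperp v hv]
    have hdiff : ∀ v ∈ B, ∀ v' ∈ B, ‖inner ℝ u (v : Euc (n + 1)) • (v : Euc (n + 1)) -
        inner ℝ u (v' : Euc (n + 1)) • (v' : Euc (n + 1))‖ ≤ 2 * (ρ * r) := fun v hv v' hv' => by
      rw [norm_smul_sub_smul_le R]
      refine (norm_sub_le _ _).trans ?_
      rw [norm_unframe, norm_unframe]
      linarith [hperp v hv, hperp v' hv']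
    refine (measure_mono hsub).trans ((measure_union_le _ _).trans ?_)
    rw [two_mul, add_mul, e]
    refine add_le_add ?_ ?_ <;>
      refine measure_cap_le hC (by positivity) (by positivity) fun v hv v' hv' => ?_
    · refine (mul_norm_sub_le_of_sign (t := inner ℝ u (v : Euc (n + 1)))
        (t' := inner ℝ u (v' : Euc (n + 1))) (by positivity) (Or.inl ⟨?_, ?_⟩)).trans ?_
      · have := hlow v hv.1
        rwa [abs_of_nonneg hv.2] at this
      · have := hlow v' hv'.1
        rwa [abs_of_nonneg hv'.2] at this
      · linarith [hdiff v hv.1 v' hv'.1]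
    · refine (mul_norm_sub_le_of_sign (t := inner ℝ u (v : Euc (n + 1)))
        (t' := inner ℝ u (v' : Euc (n + 1))) (by positivity) (Or.inr ⟨?_, ?_⟩)).trans ?_
      · have := hlow v hv.1
        rw [abs_of_nonpos hv.2] at this
        linarith
      · have := hlow v' hv'.1
        rw [abs_of_nonpos hv'.2] at this
        linarith
      · linarith [hdiff v hv.1 v' hv'.1]
  · have : B = ∅ := by
      refine eq_empty_of_forall_notMem fun v hv => hcond ?_
      have h1 : ρ ^ n * |inner ℝ u (v : Euc (n + 1))| < ε := by
        rw [← abs_of_pos hρnpos, ← abs_mul]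
        exact hv.1
      calc ρ ^ n * ‖u‖ ≤ ρ ^ n * (|inner ℝ u (v : Euc (n + 1))| + ρ * r) := by
            gcongr
            exact (norm_le_abs_inner_add R u v).trans (by gcongr; exact hperp v hv)
        _ = ρ ^ n * |inner ℝ u (v : Euc (n + 1))| + ρ ^ n * (ρ * r) := by ring
        _ ≤ ρ ^ n * |inner ℝ u (v : Euc (n + 1))| + 1 * (ρ * r) := by
            gcongr
            exact pow_le_one₀ hρ0.le hρ1.le
        _ < _ := by linarith
    rw [this, measure_empty]

end Directions

/-! ### The intensity of the limit processes -/

section Intensity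

variable {n : ℕ} {S : Type*} [MetricSpace S] [CompactSpace S] [MeasurableSpace S] [BorelSpace S]

/-- The intensity measure of a point process. -/
def intensity (P : ProbabilityMeasure (CountingMeasures (Marked n S))) : Measure (Marked n S) :=
  (P : Measure (CountingMeasures (Marked n S))).bind fun ν => ν.1

lemma intensity_apply (P : ProbabilityMeasure (CountingMeasures (Marked n S)))
    {A : Set (Marked n S)} (hA : MeasurableSet A) :
    intensity P A = ∫⁻ ν, ν.1 A ∂(P : Measure (CountingMeasures (Marked n S))) :=
  Measure.bind_apply hA CountingMeasures.measurable_val.aemeasurable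

lemma intensity_le_liminf {ι : Type*} {l : Filter ι}
    {P : ProbabilityMeasure (CountingMeasures (Marked n S))}
    {Pi : ι → ProbabilityMeasure (CountingMeasures (Marked n S))} (h : Tendsto Pi l (𝓝 P))
    {G : Set (Marked n S)} (hG : IsOpen G) :
    intensity P G ≤ liminf (fun i => intensity (Pi i) G) l := by
  simp_rw [intensity_apply _ hG.measurableSet]
  exact CountingMeasures.lintegral_apply_isOpen_le_liminf h hG

/-- A point process almost surely has no points in a null set of its intensity. -/
lemma ae_no_points {P : ProbabilityMeasure (CountingMeasures (Marked n S))}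
    {A : Set (Marked n S)} (hA : intensity P A = 0) :
    ∀ᵐ ν ∂(P : Measure (CountingMeasures (Marked n S))), ∀ y ∈ A, y ∉ ν.points := by
  set A' := toMeasurable (intensity P) A
  have hA' : intensity P A' = 0 := by rw [measure_toMeasurable, hA]
  have hm : MeasurableSet A' := measurableSet_toMeasurable _ _
  rw [intensity_apply P hm, lintegral_eq_zero_iff (CountingMeasures.measurable_apply hm)] at hA'
  filter_upwards [hA'] with ν hν y hy hyp
  exact hyp (measure_mono_null (singleton_subset_iff.2 (subset_toMeasurable _ _ hy)) hν)

variable {R : FrameMap n} {Q : ScattererConfig n S} {c : ℝ}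
    {m : ProbabilityMeasure S} {μ : S → ProbabilityMeasure (CountingMeasures (Marked n S))}
    {E : Set (Euc (n + 1))}

/-- Marks of non-exceptional centers are dense, ς ↦ μ_ς is continuous, and the intensity of an open
set is lower semicontinuous. -/
lemma StandingAssumptions.intensity_le_of_centers (hyp : StandingAssumptions R Q c m μ E)
    {G : Set (Marked n S)} (hG : IsOpen G) {b : ℝ≥0∞}
    (h : ∀ q ∈ Q.centers \ E, intensity (μ (Q.mark q)) G ≤ b) (s : S) :
    intensity (μ s) G ≤ b := by
  have hs : s ∈ closure (Q.mark '' (Q.centers \ E)) := by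
    rw [hyp.marks_dense]
    exact mem_univ s
  obtain ⟨t, ht, hlim⟩ := mem_closure_iff_seq_limit.1 hs
  refine (intensity_le_liminf ((hyp.continuous_limit.tendsto s).comp hlim) hG).trans ?_
  refine (liminf_le_liminf (Eventually.of_forall fun k => ?_)).trans
    (liminf_const (f := atTop (α := ℕ)) b).le
  obtain ⟨q, hq, hqt⟩ := ht k
  simp only [Function.comp_apply]
  rw [← hqt]
  exact h q hq

lemma pow_succ_sub_pow_le {a b : ℝ} (ha : 0 ≤ a) (hab : a ≤ b) (k : ℕ) :
    b ^ (k + 1) - a ^ (k + 1) ≤ (k + 1) * (b - a) * b ^ k := by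
  induction k with
  | zero => simp
  | succ k ih =>
    have hb : 0 ≤ b := ha.trans hab
    have h1 : a ^ (k + 1) ≤ b ^ (k + 1) := by gcongr
    have e : b ^ (k + 1 + 1) - a ^ (k + 1 + 1) =
        b * (b ^ (k + 1) - a ^ (k + 1)) + (b - a) * a ^ (k + 1) := by ring
    rw [e]
    push_cast
    calc b * (b ^ (k + 1) - a ^ (k + 1)) + (b - a) * a ^ (k + 1)
        ≤ b * ((k + 1) * (b - a) * b ^ k) + (b - a) * b ^ (k + 1) := by
          gcongr
      _ = _ := by ring

/-- The annulus has thickness 5r and outer radius at most 2a, so its volume is linear in r. -/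
lemma volume_annulus_le {a r : ℝ} (hr : 0 < r) (hra : r ≤ a / 4) :
    volume.real (Metric.ball (0 : Euc (n + 1)) (a + 3 * r) \ Metric.closedBall 0 (a - 2 * r)) ≤
      volume.real (Metric.ball (0 : Euc (n + 1)) 1) * ((n + 1) * (5 * r) * (2 * a) ^ n) := by
  rw [measureReal_sdiff (Metric.closedBall_subset_ball (by linarith))
    Metric.isClosed_closedBall.measurableSet, measureReal_def, measureReal_def,
    Measure.addHaar_ball volume _ (show 0 ≤ a + 3 * r by linarith),
    Measure.addHaar_closedBall volume _ (show 0 ≤ a - 2 * r by linarith)]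
  rw [ENNReal.toReal_mul, ENNReal.toReal_mul, finrank_euclideanSpace_fin,
    ENNReal.toReal_ofReal (pow_nonneg (by linarith) _),
    ENNReal.toReal_ofReal (pow_nonneg (by linarith) _), ← sub_mul, mul_comm, ← measureReal_def]
  gcongr
  refine (pow_succ_sub_pow_le (show 0 ≤ a - 2 * r by linarith)
    (show a - 2 * r ≤ a + 3 * r by linarith) n).trans ?_
  have e : a + 3 * r - (a - 2 * r) = 5 * r := by ring
  rw [e]
  gcongr
  · linarith
  · linarith

/-- Relevant centers have marks in V and lie in an annulus of radius about |x₁| ρ^(-n) and thickness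
of order r ρ^(-n). [P1] counts of order r |x₁|^n m(V) ρ^(-n(n+1)) of them, and each contributes at
most order (r ρ^(n+1) / |x₁|)^n. The powers of ρ and |x₁| cancel, leaving r^(n+1) m(V). -/
lemma StandingAssumptions.exists_intensity_ball_le (hyp : StandingAssumptions R Q c m μ E)
    (hn : 1 ≤ n) :
    ∃ K : NNReal, ∀ (s : S) (x : Euc (n + 1)), x 0 ≠ 0 → ∀ r : ℝ, 0 < r → r ≤ |x 0| / 4 →
      ∀ V : Set S, IsOpen V → (m : Measure S) (frontier V) = 0 →
      intensity (μ s) (Metric.ball x r ×ˢ V) ≤ K * ENNReal.ofReal (r ^ (n + 1)) * (m : Measure S) V := by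
  classical
  obtain ⟨v₀, hv₀⟩ := R.continuousOn_compl
  obtain ⟨lam, C, hlam, h0, hC⟩ := exists_capMeasure v₀
  set vb := volume.real (Metric.ball (0 : Euc (n + 1)) 1) with hvb
  set K : ℝ := c * vb * (n + 1) * 5 * 16 ^ n with hK
  have hc := hyp.density_pos
  have hK0 : 0 ≤ K := by positivity
  refine ⟨C * K.toNNReal, fun s x hx r hr hrx V hV hV0 => ?_⟩
  refine hyp.intensity_le_of_centers (Metric.isOpen_ball.prod hV) (fun q hq => ?_) s
  set a := |x 0| with ha_def
  have ha : 0 < a := abs_pos.2 hx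
  -- One r wider on each side than the annulus about q in the direction estimate: for small ρ the
  -- rescaled q has norm below r.
  set A : Set (Euc (n + 1)) := Metric.ball 0 (a + 3 * r) \ Metric.closedBall 0 (a - 2 * r) with hA
  have hAb : Bornology.IsBounded A := Metric.isBounded_ball.subset sdiff_subset
  have hA0 : volume (frontier A) = 0 := by
    rw [hA, sdiff_eq]
    refine measure_mono_null (frontier_inter_subset _ _) (measure_union_null ?_ ?_)
    · refine measure_mono_null inter_subset_left ?_
      exact measure_mono_null Metric.frontier_ball_subset_sphere (Measure.addHaar_sphere _ _ _)
    · refine measure_mono_null inter_subset_right ?_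
      rw [frontier_compl]
      exact measure_mono_null Metric.frontier_closedBall_subset_sphere (Measure.addHaar_sphere _ _ _)
  have hlim := hyp.tendsto_ncard hAb hA0 hV0
  have hρ0 : Tendsto (fun j => ((radSeq j : ℝ) ^ n)) atTop (𝓝 0) := by
    have := tendsto_radSeq.pow n
    rwa [zero_pow (by omega)] at this
  have hTinf : Tendsto (fun j => ((radSeq j : ℝ) ^ n)⁻¹) atTop atTop := by
    refine Tendsto.inv_tendsto_nhdsGT_zero (tendsto_nhdsWithin_iff.2 ⟨hρ0, ?_⟩)
    exact Eventually.of_forall fun j => pow_pos (radSeq j).2.1 n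
  have hlim2 := (hlim.comp hTinf).mul_const ((8 * r / a) ^ n)
  obtain ⟨ρ₀, hρ₀, hdir⟩ := measure_directions_ball_le hv₀ h0 hC x hx hr hrx
  have hview := hyp.tendsto_viewLaw le_rfl hlam tendsto_radSeq (q := fun _ => q)
    (Q.eventually_mem_centersIn hn hq tendsto_radSeq) tendsto_const_nhds
  have hev : ∀ᶠ j in atTop, intensity (Q.viewLaw R lam q (radSeq j)) (Metric.ball x r ×ˢ V) ≤
      C * ENNReal.ofReal (((Q.marked ∩ (fun y : Marked n S =>
        ((((radSeq j : ℝ) ^ n)⁻¹ • y.1, y.2))) '' (A ×ˢ V)).ncard : ℝ) /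
          (((radSeq j : ℝ) ^ n)⁻¹) ^ (n + 1) * (8 * r / a) ^ n) := by
    have e1 := tendsto_radSeq.eventually (gt_mem_nhds hρ₀)
    have e2 : ∀ᶠ j in atTop, (radSeq j : ℝ) ^ n * ‖q‖ < r := by
      have := hρ0.mul_const ‖q‖
      rw [zero_mul] at this
      exact this.eventually (gt_mem_nhds hr)
    filter_upwards [e1, e2] with j hj1 hj2
    set ρ := radSeq j
    have hρpos : 0 < (ρ : ℝ) := ρ.2.1
    have hρn : 0 < (ρ : ℝ) ^ n := pow_pos hρpos n
    have hfin : {p | p ∈ Q.centers ∧ Q.mark p ∈ V ∧ a - 2 * r < (ρ : ℝ) ^ n * ‖p‖ ∧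
        (ρ : ℝ) ^ n * ‖p‖ < a + 3 * r}.Finite := by
      refine (Q.locallyFinite ((a + 3 * r) / (ρ : ℝ) ^ n)).subset fun p hp => ⟨hp.1, ?_⟩
      rw [mem_closedBall_zero_iff, le_div_iff₀ hρn, mul_comm]
      exact hp.2.2.2.le
    rw [intensity_apply _ (Metric.isOpen_ball.prod hV).measurableSet]
    refine (Q.lintegral_viewLaw_le R ρ q lam (Metric.isOpen_ball.prod hV).measurableSet
      hfin.toFinset (fun _ => C * ENNReal.ofReal ((8 * r * (ρ : ℝ) ^ (n + 1) / a) ^ n)) ?_).trans ?_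
    · intro p hp hpq
      by_cases hpV : Q.mark p ∈ V
      · have hsub : {v | frameAction R ρ q v (p, Q.mark p) ∈ Metric.ball x r ×ˢ V} ⊆
            {v | |(ρ : ℝ) ^ n * inner ℝ (p - q) (v : Euc (n + 1)) - x 0| < r ∧
            ‖(ρ : ℝ)⁻¹ • perp (rowMul (p - q) (R.toFun v).1) - perp x‖ < r} := by
          intro v hv
          have h1 : ‖(frameAction R ρ q v (p, Q.mark p)).1 - x‖ < r :=
            mem_ball_iff_norm.1 hv.1
          constructor
          · have := abs_zero_le_norm ((frameAction R ρ q v (p, Q.mark p)).1 - x)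
            rw [PiLp.sub_apply, frameAction_zero] at this
            exact this.trans_lt h1
          · have := norm_perp_le ((frameAction R ρ q v (p, Q.mark p)).1 - x)
            rw [perp_sub, perp_frameAction] at this
            exact this.trans_lt h1
        refine (measure_mono hsub).trans ((hdir ρ hj1 (p - q)).trans ?_)
        by_cases hcond : a - r < (ρ : ℝ) ^ n * ‖p - q‖ ∧ (ρ : ℝ) ^ n * ‖p - q‖ < a + 2 * r
        · rw [if_pos hcond, if_pos]
          rw [Finite.mem_toFinset]
          refine ⟨hp, hpV, ?_, ?_⟩
          · have := norm_sub_le p q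
            nlinarith [hcond.1]
          · have := norm_le_norm_sub_add p q
            nlinarith [hcond.2]
        · rw [if_neg hcond]
          exact bot_le
      · have : {v | frameAction R ρ q v (p, Q.mark p) ∈ Metric.ball x r ×ˢ V} = ∅ :=
          eq_empty_of_forall_notMem fun v hv => hpV hv.2
        rw [this, measure_empty]
        exact bot_le
    · rw [Finset.sum_const, nsmul_eq_mul, mul_left_comm]
      gcongr
      rw [← ENNReal.ofReal_natCast, ← ENNReal.ofReal_mul (by positivity)]
      refine ENNReal.ofReal_le_ofReal ?_
      have hcard : hfin.toFinset.card ≤ (Q.marked ∩ (fun y : Marked n S =>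
        ((((ρ : ℝ) ^ n)⁻¹ • y.1, y.2))) '' (A ×ˢ V)).ncard := by
        rw [← Set.ncard_coe_finset]
        refine Set.ncard_le_ncard_of_injOn (fun p => (p, Q.mark p)) ?_ ?_ ?_
        · intro p hp
          rw [Finset.mem_coe, Finite.mem_toFinset] at hp
          refine ⟨⟨p, hp.1, rfl⟩, ⟨((ρ : ℝ) ^ n • p, Q.mark p), ⟨⟨?_, ?_⟩, hp.2.1⟩, ?_⟩⟩
          · rw [mem_ball_zero_iff, norm_smul, Real.norm_of_nonneg hρn.le]
            exact hp.2.2.2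
          · rw [mem_closedBall_zero_iff, norm_smul, Real.norm_of_nonneg hρn.le, not_le]
            exact hp.2.2.1
          · simp only [smul_smul, inv_mul_cancel₀ hρn.ne', one_smul]
        · intro p _ p' _ h
          exact (Prod.mk.inj h).1
        · refine ((Q.locallyFinite (((ρ : ℝ) ^ n)⁻¹ * (a + 3 * r))).image
            (fun p => (p, Q.mark p))).subset ?_
          rintro y ⟨⟨p, hp, rfl⟩, ⟨z, hz, hzy⟩⟩
          refine ⟨p, ⟨hp, ?_⟩, rfl⟩
          have h4 : ((ρ : ℝ) ^ n)⁻¹ • z.1 = p := congrArg Prod.fst hzy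
          rw [← h4, mem_closedBall_zero_iff, norm_smul, Real.norm_of_nonneg (by positivity)]
          have : ‖z.1‖ < a + 3 * r := mem_ball_zero_iff.1 hz.1.1
          gcongr
      -- The cap bound supplies exactly the normalization by the d-th power of the dilation factor
      -- that [P1] needs.
      have e : (8 * r * (ρ : ℝ) ^ (n + 1) / a) ^ n =
          (8 * r / a) ^ n / (((ρ : ℝ) ^ n)⁻¹) ^ (n + 1) := by
        rw [inv_pow, div_inv_eq_mul, ← pow_mul, mul_comm n (n + 1), pow_mul, ← mul_pow]
        congr 1
        ring
      rw [e]
      calc _ ≤ ((Q.marked ∩ (fun y : Marked n S =>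
            ((((ρ : ℝ) ^ n)⁻¹ • y.1, y.2))) '' (A ×ˢ V)).ncard : ℝ) *
            ((8 * r / a) ^ n / (((ρ : ℝ) ^ n)⁻¹) ^ (n + 1)) := by gcongr
        _ = _ := by ring
  refine (intensity_le_liminf hview (Metric.isOpen_ball.prod hV)).trans ?_
  refine (liminf_le_liminf hev).trans ?_
  have hlim3 := ENNReal.Tendsto.const_mul (a := (C : ℝ≥0∞)) (ENNReal.tendsto_ofReal hlim2)
    (Or.inr ENNReal.coe_ne_top)
  refine (le_of_eq (Tendsto.liminf_eq hlim3)).trans ?_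
  have hreal : c * (volume A * (m : Measure S) V).toReal * (8 * r / a) ^ n ≤
      K * r ^ (n + 1) * (m : Measure S).real V := by
    have hvol := volume_annulus_le (n := n) hr hrx
    rw [← hA, ← hvb] at hvol
    rw [ENNReal.toReal_mul, ← measureReal_def, ← measureReal_def]
    have h16 : (2 * a) ^ n * (8 * r / a) ^ n = 16 ^ n * r ^ n := by
      rw [← mul_pow, ← mul_pow]
      congr 1
      field_simp
      ring
    calc _ ≤ c * ((vb * ((n + 1) * (5 * r) * (2 * a) ^ n)) * (m : Measure S).real V) *
          (8 * r / a) ^ n := by gcongr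
      _ = c * vb * (n + 1) * 5 * r * ((2 * a) ^ n * (8 * r / a) ^ n) * (m : Measure S).real V := by
        ring
      _ = _ := by
        rw [h16, hK]
        ring
  have hmV : (m : Measure S) V = ENNReal.ofReal ((m : Measure S).real V) :=
    (ENNReal.ofReal_toReal (measure_ne_top _ _)).symm
  calc _ ≤ (C : ℝ≥0∞) * ENNReal.ofReal (K * r ^ (n + 1) * (m : Measure S).real V) := by gcongr
    _ = _ := by
      rw [ENNReal.ofReal_mul (by positivity), ENNReal.ofReal_mul hK0, ← hmV, ENNReal.coe_mul,
        ENNReal.ofReal]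
      ring

/-- Close to the hyperplane x₁ = 0 centers at all scales contribute, so the dyadic weighted count is
used. Weights (ρ r / ‖p − q‖)^n summed up to distance 2 ε ρ^(-n) give O(ε), with all powers of ρ
cancelling. -/
lemma StandingAssumptions.exists_intensity_slab_le (hyp : StandingAssumptions R Q c m μ E)
    (hn : 1 ≤ n) (r : ℝ) (hr : 0 < r) :
    ∃ K : NNReal, ∀ (s : S) (ε : ℝ), 0 < ε →
      intensity (μ s) {y | |y.1 0| < ε ∧ ‖perp y.1‖ < r} ≤ K * ENNReal.ofReal ε := by
  classical
  obtain ⟨v₀, hv₀⟩ := R.continuousOn_compl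
  obtain ⟨lam, C, hlam, h0, hC⟩ := exists_capMeasure v₀
  obtain ⟨C', hC', hsum⟩ := hyp.exists_sum_le
  refine ⟨2 * C * (2 * C' * (8 * r) ^ n).toNNReal, fun s ε hε => ?_⟩
  have hG : IsOpen {y : Marked n S | |y.1 0| < ε ∧ ‖perp y.1‖ < r} := by
    have h1 : Continuous fun y : Marked n S => |y.1 0| := by fun_prop
    have h2 : Continuous fun y : Marked n S => ‖perp y.1‖ :=
      (continuous_perp.comp continuous_fst).norm
    exact (isOpen_lt h1 continuous_const).inter (isOpen_lt h2 continuous_const)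
  refine hyp.intensity_le_of_centers hG (fun q hq => ?_) s
  have hρ0 : Tendsto (fun j => ((radSeq j : ℝ) ^ n)) atTop (𝓝 0) := by
    have := tendsto_radSeq.pow n
    rwa [zero_pow (by omega)] at this
  have hTinf : Tendsto (fun j => ((radSeq j : ℝ) ^ n)⁻¹) atTop atTop := by
    refine Tendsto.inv_tendsto_nhdsGT_zero (tendsto_nhdsWithin_iff.2 ⟨hρ0, ?_⟩)
    exact Eventually.of_forall fun j => pow_pos (radSeq j).2.1 n
  have hview := hyp.tendsto_viewLaw le_rfl hlam tendsto_radSeq (q := fun _ => q)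
    (Q.eventually_mem_centersIn hn hq tendsto_radSeq) tendsto_const_nhds
  obtain ⟨L₀, hL₀⟩ := hsum q
  have hev : ∀ᶠ j in atTop, intensity (Q.viewLaw R lam q (radSeq j))
      {y : Marked n S | |y.1 0| < ε ∧ ‖perp y.1‖ < r} ≤
      2 * C * ENNReal.ofReal (2 * C' * (8 * r) ^ n * ε) := by
    have e1 : ∀ᶠ j in atTop, (radSeq j : ℝ) * r < ε := by
      have := tendsto_radSeq.mul_const r
      rw [zero_mul] at this
      exact this.eventually (gt_mem_nhds hε)
    have e2' : ∀ d : ℝ, 0 < d → ∀ᶠ j in atTop, 2 * (radSeq j : ℝ) * r < d := fun d hd => by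
      have := (tendsto_radSeq.const_mul 2).mul_const r
      rw [mul_zero, zero_mul] at this
      exact this.eventually (gt_mem_nhds hd)
    -- The finitely many centers within distance 1 of q satisfy the lower bound of the direction
    -- estimate for small ρ; the others do so uniformly.
    have e2 : ∀ᶠ j in atTop, ∀ p ∈ {p | p ∈ Q.centers ∧ p ≠ q ∧ ‖p - q‖ < 1},
        2 * (radSeq j : ℝ) * r < ‖p - q‖ :=
      (eventually_all_finite (Q.finite_punctured q 1)).2 fun p hp =>
        e2' _ (norm_pos_iff.2 (sub_ne_zero.2 hp.2.1))
    have e3 : ∀ᶠ j in atTop, L₀ ≤ 2 * ε * ((radSeq j : ℝ) ^ n)⁻¹ :=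
      (hTinf.const_mul_atTop (by positivity)).eventually_ge_atTop L₀
    filter_upwards [e1, e2, e2' 1 one_pos, e3] with j hj1 hj2 hj3 hj4
    set ρ := radSeq j
    have hρpos : 0 < (ρ : ℝ) := ρ.2.1
    have hρn : 0 < (ρ : ℝ) ^ n := pow_pos hρpos n
    rw [intensity_apply _ hG.measurableSet]
    refine (Q.lintegral_viewLaw_le R ρ q lam hG.measurableSet
      (Q.nearCenters q (2 * ε * ((ρ : ℝ) ^ n)⁻¹))
      (fun p => 2 * C * ENNReal.ofReal ((8 * ρ * r / ‖p - q‖) ^ n)) ?_).trans ?_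
    · intro p hp hpq
      have hu : 2 * ρ * r ≤ ‖p - q‖ := by
        rcases lt_or_ge ‖p - q‖ 1 with h | h
        · exact (hj2 p ⟨hp, hpq, h⟩).le
        · linarith
      have hsub : {v | frameAction R ρ q v (p, Q.mark p) ∈
          {y : Marked n S | |y.1 0| < ε ∧ ‖perp y.1‖ < r}} ⊆
          {v | |(ρ : ℝ) ^ n * inner ℝ (p - q) (v : Euc (n + 1))| < ε ∧
          ‖(ρ : ℝ)⁻¹ • perp (rowMul (p - q) (R.toFun v).1)‖ < r} := by
        intro v hv
        have hv1 := hv.1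
        have hv2 := hv.2
        rw [frameAction_zero] at hv1
        rw [perp_frameAction] at hv2
        exact ⟨hv1, hv2⟩
      refine (measure_mono hsub).trans ((measure_directions_slab_le hC hr ρ (p - q)
        (sub_ne_zero.2 hpq) hu).trans ?_)
      by_cases hcond : (ρ : ℝ) ^ n * ‖p - q‖ < ε + ρ * r
      · rw [if_pos hcond, if_pos]
        rw [ScattererConfig.mem_nearCenters]
        refine ⟨hp, hpq, ?_⟩
        rw [← div_eq_mul_inv, lt_div_iff₀ hρn]
        linarith
      · rw [if_neg hcond]
        exact bot_le
    · rw [← Finset.mul_sum, ← ENNReal.ofReal_sum_of_nonneg (fun p _ => by positivity)]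
      gcongr
      have e : ∀ p, (8 * ρ * r / ‖p - q‖) ^ n = (8 * ρ * r) ^ n * (‖p - q‖ ^ n)⁻¹ := fun p => by
        rw [div_pow, div_eq_mul_inv]
      simp_rw [e]
      rw [← Finset.mul_sum]
      calc _ ≤ (8 * ρ * r) ^ n * (C' * (2 * ε * ((ρ : ℝ) ^ n)⁻¹)) := by
            gcongr
            exact hL₀ _ hj4
        _ = _ := by
            rw [show 8 * (ρ : ℝ) * r = ρ * (8 * r) by ring, mul_pow]
            field_simp
  refine (intensity_le_liminf hview hG).trans ?_
  refine (liminf_le_liminf hev).trans ?_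
  rw [liminf_const, ENNReal.ofReal_mul (by positivity)]
  refine le_of_eq ?_
  rw [ENNReal.coe_mul, ENNReal.coe_mul, ENNReal.ofReal]
  push_cast
  ring

end Intensity

/-! ### Absolute continuity of the intensity -/

section Rectangles

variable {X Y : Type*} [MetricSpace X] [SecondCountableTopology X] [MeasurableSpace X]
  [BorelSpace X] [MetricSpace Y] [SecondCountableTopology Y] [MeasurableSpace Y] [BorelSpace Y]

lemma exists_partition (X : Type*) [MetricSpace X] [SecondCountableTopology X] [MeasurableSpace X]
    [BorelSpace X] {ε : ℝ} (hε : 0 < ε) :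
    ∃ A : ℕ → Set X, (∀ i, MeasurableSet (A i)) ∧ Pairwise (Function.onFun Disjoint A) ∧
      (⋃ i, A i) = univ ∧ (∀ i, Bornology.IsBounded (A i)) ∧
      ∀ i, ∀ x ∈ A i, ∀ y ∈ A i, dist x y < ε := by
  rcases isEmpty_or_nonempty X with h | h
  · exact ⟨fun _ => ∅, fun _ => MeasurableSet.empty, fun _ _ _ => by simp [Function.onFun],
      Subsingleton.elim _ _, fun _ => Bornology.isBounded_empty, fun _ x hx => by simp at hx⟩
  let B : ℕ → Set X := fun i => Metric.ball (TopologicalSpace.denseSeq X i) (ε / 2)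
  refine ⟨disjointed B, fun i => MeasurableSet.disjointed (fun j => Metric.isOpen_ball.measurableSet) i,
    disjoint_disjointed B, ?_, fun i => Metric.isBounded_ball.subset (disjointed_subset B i),
    fun i x hx y hy => ?_⟩
  · rw [iUnion_disjointed]
    refine eq_univ_of_forall fun x => ?_
    obtain ⟨i, hi⟩ := (TopologicalSpace.denseRange_denseSeq X).exists_dist_lt x (half_pos hε)
    exact mem_iUnion.2 ⟨i, hi⟩
  · have h1 : dist x (TopologicalSpace.denseSeq X i) < ε / 2 := disjointed_subset B i hx
    have h2 : dist y (TopologicalSpace.denseSeq X i) < ε / 2 := disjointed_subset B i hy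
    have := dist_triangle_right x y (TopologicalSpace.denseSeq X i)
    linarith

/-- An open set is exhausted by the rectangles of finer and finer grids that it contains; outer
regularity of J passes from open sets to arbitrary ones. -/
lemma measure_le_of_rectangles {I J : Measure (X × Y)} [J.OuterRegular]
    (h : ∀ (A : Set X) (V : Set Y), MeasurableSet A → Bornology.IsBounded A → MeasurableSet V →
      I (A ×ˢ V) ≤ J (A ×ˢ V)) (N : Set (X × Y)) : I N ≤ J N := by
  have hopen : ∀ O : Set (X × Y), IsOpen O → I O ≤ J O := by
    intro O hO
    have hpos : ∀ k : ℕ, (0 : ℝ) < 1 / ((k : ℝ) + 1) := fun k => Nat.one_div_pos_of_nat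
    choose A hAm hAd hAu hAb hAε using fun k : ℕ => exists_partition X (hpos k)
    choose B hBm hBd hBu hBb hBε using fun k : ℕ => exists_partition Y (hpos k)
    let Z : ℕ → Set (ℕ × ℕ) := fun k => {p | A k p.1 ×ˢ B k p.2 ⊆ O}
    let Ok : ℕ → Set (X × Y) := fun k => ⋃ p ∈ Z k, A k p.1 ×ˢ B k p.2
    have hOk : ∀ k, I (Ok k) ≤ J O := by
      intro k
      have hd : (Z k).PairwiseDisjoint fun p => A k p.1 ×ˢ B k p.2 := by
        rintro ⟨i, j⟩ - ⟨i', j'⟩ - hne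
        rw [Function.onFun, Set.disjoint_prod]
        by_cases hi : i = i'
        · exact Or.inr (hBd k fun hj => hne (Prod.ext hi hj))
        · exact Or.inl (hAd k hi)
      have hm : ∀ p ∈ Z k, MeasurableSet (A k p.1 ×ˢ B k p.2) := fun p _ =>
        (hAm k p.1).prod (hBm k p.2)
      calc I (Ok k) = ∑' p : Z k, I (A k p.1.1 ×ˢ B k p.1.2) :=
            measure_biUnion (Set.to_countable _) hd hm
        _ ≤ ∑' p : Z k, J (A k p.1.1 ×ˢ B k p.1.2) :=
            ENNReal.tsum_le_tsum fun p => h _ _ (hAm k _) (hAb k _) (hBm k _)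
        _ = J (Ok k) := (measure_biUnion (Set.to_countable _) hd hm).symm
        _ ≤ J O := measure_mono (iUnion₂_subset fun p hp => hp)
    -- Successive grids are not nested, so a set-theoretic lim inf takes the place of an increasing
    -- union.
    have hsub : O ⊆ ⋃ k, ⋂ l ≥ k, Ok l := by
      intro x hx
      obtain ⟨ε, hε, hb⟩ := Metric.isOpen_iff.1 hO x hx
      obtain ⟨k, hk⟩ := exists_nat_one_div_lt hε
      refine mem_iUnion.2 ⟨k, mem_iInter₂.2 fun l hl => ?_⟩
      have hl' : 1 / ((l : ℝ) + 1) < ε := (Nat.one_div_le_one_div hl).trans_lt hk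
      obtain ⟨i, hi⟩ := mem_iUnion.1 ((hAu l).symm ▸ mem_univ x.1)
      obtain ⟨j, hj⟩ := mem_iUnion.1 ((hBu l).symm ▸ mem_univ x.2)
      refine mem_iUnion₂.2 ⟨(i, j), fun y hy => hb ?_, ⟨hi, hj⟩⟩
      rw [Metric.mem_ball, Prod.dist_eq]
      exact max_lt ((hAε l i _ hy.1 _ hi).trans hl') ((hBε l j _ hy.2 _ hj).trans hl')
    have hmono : Monotone fun k => ⋂ l ≥ k, Ok l := fun k k' hkk' =>
      biInter_subset_biInter_left fun l hl => le_trans hkk' hl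
    calc I O ≤ I (⋃ k, ⋂ l ≥ k, Ok l) := measure_mono hsub
      _ = ⨆ k, I (⋂ l ≥ k, Ok l) := hmono.measure_iUnion
      _ ≤ J O := iSup_le fun k => (measure_mono (biInter_subset_of_mem (le_refl k))).trans (hOk k)
  rw [N.measure_eq_iInf_isOpen J]
  refine le_iInf₂ fun O hNO => le_iInf fun hO => ?_
  exact (measure_mono hNO).trans (hopen O hO)

end Rectangles

/-! ### Domination of the intensity by Lebesgue measure times the mark distribution -/

section AbsolutelyContinuous

variable {n : ℕ} {S : Type*} [MetricSpace S] [CompactSpace S] [MeasurableSpace S] [BorelSpace S]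
variable {R : FrameMap n} {Q : ScattererConfig n S} {c : ℝ}
    {m : ProbabilityMeasure S} {μ : S → ProbabilityMeasure (CountingMeasures (Marked n S))}
    {E : Set (Euc (n + 1))}

lemma StandingAssumptions.isLocallyFiniteMeasure_intensity (hyp : StandingAssumptions R Q c m μ E)
    (hn : 1 ≤ n) (s : S) : IsLocallyFiniteMeasure (intensity (μ s)) := by
  refine ⟨fun y => ?_⟩
  by_cases hy : y.1 0 = 0
  · obtain ⟨K, hK⟩ := hyp.exists_intensity_slab_le hn (‖perp y.1‖ + 1) (by positivity)
    refine ⟨{z | |z.1 0| < 1 ∧ ‖perp z.1‖ < ‖perp y.1‖ + 1}, ?_, (hK s 1 one_pos).trans_lt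
      (ENNReal.mul_lt_top ENNReal.coe_lt_top ENNReal.ofReal_lt_top)⟩
    have h1 : Continuous fun y : Marked n S => |y.1 0| := by fun_prop
    have h2 : Continuous fun y : Marked n S => ‖perp y.1‖ :=
      (continuous_perp.comp continuous_fst).norm
    refine ((isOpen_lt h1 continuous_const).inter (isOpen_lt h2 continuous_const)).mem_nhds ⟨?_, ?_⟩
    · simp [hy]
    · simp
  · obtain ⟨K, hK⟩ := hyp.exists_intensity_ball_le hn
    have hr : 0 < |y.1 0| / 4 := by positivity
    refine ⟨Metric.ball y.1 (|y.1 0| / 4) ×ˢ univ,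
      prod_mem_nhds (Metric.ball_mem_nhds _ hr) univ_mem,
      (hK s y.1 hy _ hr le_rfl univ isOpen_univ (by simp)).trans_lt ?_⟩
    exact ENNReal.mul_lt_top (ENNReal.mul_lt_top ENNReal.coe_lt_top ENNReal.ofReal_lt_top)
      (measure_lt_top _ _)

/-- The ball bound holds only for small balls and open continuity sets V. Differentiation of
measures extends it to all A, thickenings extend it to closed V, and inner regularity to measurable
V. -/
lemma StandingAssumptions.exists_intensity_prod_le (hyp : StandingAssumptions R Q c m μ E)
    (hn : 1 ≤ n) (s : S) : ∃ K : NNReal, ∀ (A : Set (Euc (n + 1))) (V : Set S), MeasurableSet A →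
      Bornology.IsBounded A → A ⊆ {x | x 0 ≠ 0} → MeasurableSet V →
      intensity (μ s) (A ×ˢ V) ≤ K * (volume A * (m : Measure S) V) := by
  obtain ⟨K, hK⟩ := hyp.exists_intensity_ball_le hn
  have := hyp.isLocallyFiniteMeasure_intensity hn s
  set I := intensity (μ s) with hI
  set vb := volume (Metric.ball (0 : Euc (n + 1)) 1) with hvb
  have hvb0 : vb ≠ 0 := (Metric.measure_ball_pos _ _ one_pos).ne'
  have hvbtop : vb ≠ ⊤ := measure_ball_lt_top.ne
  have hK₁top : (K : ℝ≥0∞) * ENNReal.ofReal (2 ^ (n + 1)) / vb ≠ ⊤ :=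
    (ENNReal.div_lt_top (ENNReal.mul_ne_top ENNReal.coe_ne_top ENNReal.ofReal_ne_top) hvb0).ne
  set K₁ : NNReal := ((K : ℝ≥0∞) * ENNReal.ofReal (2 ^ (n + 1)) / vb).toNNReal with hK₁
  have hK₁' : (K₁ : ℝ≥0∞) * vb = K * ENNReal.ofReal (2 ^ (n + 1)) := by
    rw [hK₁, ENNReal.coe_toNNReal hK₁top, ENNReal.div_mul_cancel hvb0 hvbtop]
  have hopen : ∀ (A : Set (Euc (n + 1))) (V : Set S), MeasurableSet A → A ⊆ {x | x 0 ≠ 0} →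
      IsOpen V → (m : Measure S) (frontier V) = 0 →
      I (A ×ˢ V) ≤ K₁ * (volume A * (m : Measure S) V) := by
    intro A V hA hA0 hV hV0
    set J : Measure (Euc (n + 1)) := (I.restrict (univ ×ˢ V)).map Prod.fst with hJ
    have hJa : ∀ B, MeasurableSet B → J B = I (B ×ˢ V) := fun B hB => by
      rw [hJ, Measure.map_apply measurable_fst hB, Measure.restrict_apply (measurable_fst hB)]
      congr 1
      ext y
      simp
    let b : NNReal := K₁ * ((m : Measure S) V).toNNReal
    have hb : (b : ℝ≥0∞) = K₁ * (m : Measure S) V := by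
      rw [ENNReal.coe_mul, ENNReal.coe_toNNReal (measure_ne_top _ _)]
    -- Comparison on small closed balls about every point of A suffices. Enclosing a closed ball in
    -- the open one of twice the radius costs the factor 2^(n+1) in `K₁`.
    have := (Besicovitch.vitaliFamily J).measure_le_of_frequently_le (ρ := J)
      (b • (volume : Measure (Euc (n + 1)))) Measure.AbsolutelyContinuous.rfl A (by
        intro x hx
        have hx0 : x 0 ≠ 0 := hA0 hx
        refine (Besicovitch.tendsto_filterAt J x).frequently (Eventually.frequently ?_)
        have hr8 : 0 < |x 0| / 8 := by positivity
        filter_upwards [self_mem_nhdsWithin, mem_nhdsWithin_of_mem_nhds (gt_mem_nhds hr8)]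
          with r hr hr'
        have hr0 : 0 < r := hr
        rw [hJa _ Metric.isClosed_closedBall.measurableSet]
        calc I (Metric.closedBall x r ×ˢ V) ≤ I (Metric.ball x (2 * r) ×ˢ V) :=
              measure_mono (Set.prod_mono_left (Metric.closedBall_subset_ball (by linarith)))
          _ ≤ K * ENNReal.ofReal ((2 * r) ^ (n + 1)) * (m : Measure S) V :=
              hK s x hx0 _ (by linarith) (by linarith) V hV hV0
          _ = (b • (volume : Measure (Euc (n + 1)))) (Metric.closedBall x r) := by
              rw [Measure.smul_apply, Measure.addHaar_closedBall volume _ hr0.le,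
                finrank_euclideanSpace_fin, ENNReal.smul_def, smul_eq_mul, hb, mul_pow,
                ENNReal.ofReal_mul (by positivity), ← mul_assoc, ← hK₁', ← hvb]
              ring)
    rw [hJa A hA, Measure.smul_apply, ENNReal.smul_def, smul_eq_mul, hb] at this
    exact this.trans (le_of_eq (by ring))
  have hclosed : ∀ (A : Set (Euc (n + 1))) (V : Set S), MeasurableSet A →
      Bornology.IsBounded A → A ⊆ {x | x 0 ≠ 0} →
      IsClosed V → I (A ×ˢ V) ≤ K₁ * (volume A * (m : Measure S) V) := by
    intro A V hA hAb hA0 hV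
    obtain ⟨r, hr0, hr⟩ := exists_null_frontiers_thickening (m : Measure S) V
    have hlim : Tendsto (fun k => (m : Measure S) (Metric.thickening (r k) V)) atTop
        (𝓝 ((m : Measure S) V)) := by
      refine (tendsto_measure_thickening_of_isClosed (μ := (m : Measure S))
        ⟨1, one_pos, measure_ne_top _ _⟩ hV).comp ?_
      exact tendsto_nhdsWithin_iff.2 ⟨hr0, Eventually.of_forall fun k => (hr k).1⟩
    have hlim2 := ENNReal.Tendsto.const_mul (a := (K₁ : ℝ≥0∞)) (ENNReal.Tendsto.const_mul
      (a := volume A) hlim (Or.inr hAb.measure_lt_top.ne)) (Or.inr ENNReal.coe_ne_top)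
    refine ge_of_tendsto' hlim2 fun k => ?_
    refine (measure_mono (Set.prod_mono_right (Metric.self_subset_thickening (hr k).1 V))).trans ?_
    exact hopen A _ hA hA0 Metric.isOpen_thickening (hr k).2
  refine ⟨K₁, fun A V hA hAb hA0 hV => ?_⟩
  set J : Measure S := (I.restrict (A ×ˢ univ)).map Prod.snd with hJ
  have hJa : ∀ B, MeasurableSet B → J B = I (A ×ˢ B) := fun B hB => by
    rw [hJ, Measure.map_apply measurable_snd hB, Measure.restrict_apply (measurable_snd hB)]
    congr 1
    ext y
    simp [and_comm]
  have hAfin : I (A ×ˢ univ) < ⊤ := by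
    obtain ⟨r, hr⟩ := hAb.subset_closedBall 0
    refine (measure_mono (Set.prod_mono_left hr)).trans_lt ?_
    exact ((isCompact_closedBall _ _).prod isCompact_univ).measure_lt_top
  have hJfin : IsFiniteMeasure J := ⟨by rwa [hJa _ MeasurableSet.univ]⟩
  rw [← hJa V hV, hV.measure_eq_iSup_isClosed_of_ne_top (measure_ne_top J V)]
  refine iSup₂_le fun F hF => iSup_le fun hFc => ?_
  rw [hJa F hFc.measurableSet]
  refine (hclosed A F hA hAb hA0 hFc).trans ?_
  gcongr

/-- The limit processes have an absolutely continuous intensity. -/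
lemma StandingAssumptions.intensity_absolutelyContinuous (hyp : StandingAssumptions R Q c m μ E)
    (hn : 1 ≤ n) (s : S) :
    intensity (μ s) ≪ (volume : Measure (Euc (n + 1))).prod (m : Measure S) := by
  have hc0 : Continuous fun x : Euc (n + 1) => x 0 := by fun_prop
  have hH : MeasurableSet {x : Euc (n + 1) | x 0 ≠ 0} :=
    (isOpen_ne_fun hc0 continuous_const).measurableSet
  obtain ⟨K, hK⟩ := hyp.exists_intensity_prod_le hn s
  set I := intensity (μ s) with hI
  have hrect := measure_le_of_rectangles (I := I.restrict ({x : Euc (n + 1) | x 0 ≠ 0} ×ˢ univ))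
    (J := K • ((volume : Measure (Euc (n + 1))).prod (m : Measure S))) (fun A V hA hAb hV => by
      rw [Measure.restrict_apply (hA.prod hV), prod_inter_prod, inter_univ, Measure.smul_apply,
        Measure.prod_prod, ENNReal.smul_def, smul_eq_mul]
      refine (hK _ V (hA.inter hH) (hAb.subset inter_subset_left) inter_subset_right hV).trans ?_
      gcongr
      exact inter_subset_left)
  -- The ball bound says nothing on this hyperplane; the slab bound, with its width tending to 0,
  -- shows that it is null.
  have hzero : I {y | y.1 0 = 0} = 0 := by
    have hsub : {y : Marked n S | y.1 0 = 0} ⊆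
        ⋃ k : ℕ, {y : Marked n S | y.1 0 = 0 ∧ ‖perp y.1‖ < (k : ℝ) + 1} := fun y hy => by
      obtain ⟨k, hk⟩ := exists_nat_ge ‖perp y.1‖
      exact mem_iUnion.2 ⟨k, hy, by linarith⟩
    refine measure_mono_null hsub (measure_iUnion_null fun k => ?_)
    obtain ⟨K', hK'⟩ := hyp.exists_intensity_slab_le hn ((k : ℝ) + 1) (by positivity)
    have hlim : Tendsto (fun j : ℕ => (K' : ℝ≥0∞) * ENNReal.ofReal (1 / ((j : ℝ) + 1))) atTop
        (𝓝 0) := by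
      have := ENNReal.Tendsto.const_mul (a := (K' : ℝ≥0∞))
        (ENNReal.tendsto_ofReal tendsto_one_div_add_atTop_nhds_zero_nat) (Or.inr ENNReal.coe_ne_top)
      simpa using this
    refine le_antisymm (ge_of_tendsto' hlim fun j => ?_) bot_le
    refine (measure_mono fun y hy => ?_).trans (hK' s _ (Nat.one_div_pos_of_nat (n := j)))
    refine ⟨?_, hy.2⟩
    rw [hy.1, abs_zero]
    exact Nat.one_div_pos_of_nat
  intro N hN
  have h1 := hrect N
  rw [Measure.smul_apply, hN, smul_zero, nonpos_iff_eq_zero,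
    Measure.restrict_apply' (hH.prod MeasurableSet.univ)] at h1
  refine measure_mono_null (fun y hy => ?_) (measure_union_null h1 hzero)
  by_cases hy0 : y.1 0 = 0
  · exact Or.inr hy0
  · exact Or.inl ⟨hy, hy0, mem_univ _⟩

end AbsolutelyContinuous

/-! ### Invariance under dilations and non-emptiness of cylinders -/

lemma CountingMeasures.continuous_map {X : Type*} [MetricSpace X] [ProperSpace X] [MeasurableSpace X]
    [BorelSpace X] (e : X ≃ₜ X) :
    Continuous (CountingMeasures.map e : CountingMeasures X → CountingMeasures X) := by
  refine continuous_iInf_rng.2 fun f => continuous_induced_rng.2 ?_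
  let g : CompactlySupportedContinuousMap X ℝ :=
    ⟨⟨f ∘ e, f.continuous.comp e.continuous⟩,
      f.hasCompactSupport.comp_isClosedEmbedding e.isClosedEmbedding⟩
  have h : ((fun ν : CountingMeasures X => ∫ x, f x ∂ν.1) ∘ CountingMeasures.map e) =
      fun ν : CountingMeasures X => ∫ x, g x ∂ν.1 := by
    funext ν
    exact integral_map_equiv e.toMeasurableEquiv f
  rw [h]
  exact continuous_integral g

section Dilation

variable {n : ℕ} {S : Type*} [MetricSpace S] [CompactSpace S] [MeasurableSpace S] [BorelSpace S]

/-- The anisotropic dilation `(x, ς) ↦ (x D_a, ς)`. -/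
def stretchHomeo (n : ℕ) (S : Type*) [TopologicalSpace S] (a : Radius) :
    Marked n S ≃ₜ Marked n S where
  toFun y := (consVec ((a : ℝ) ^ n * y.1 0) ((a : ℝ)⁻¹ • perp y.1), y.2)
  invFun y := (consVec (((a : ℝ) ^ n)⁻¹ * y.1 0) ((a : ℝ) • perp y.1), y.2)
  left_inv y := by
    have h := a.2.1.ne'
    simp [smul_smul, h]
  right_inv y := by
    have h := a.2.1.ne'
    simp [smul_smul, h]
  continuous_toFun := by
    refine Continuous.prodMk (continuous_consVec.comp (Continuous.prodMk (by fun_prop) ?_))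
      continuous_snd
    have : Continuous fun y : Marked n S => perp y.1 := continuous_perp.comp continuous_fst
    fun_prop
  continuous_invFun := by
    refine Continuous.prodMk (continuous_consVec.comp (Continuous.prodMk (by fun_prop) ?_))
      continuous_snd
    have : Continuous fun y : Marked n S => perp y.1 := continuous_perp.comp continuous_fst
    fun_prop

lemma stretchHomeo_apply (a : Radius) (y : Marked n S) :
    stretchHomeo n S a y = (consVec ((a : ℝ) ^ n * y.1 0) ((a : ℝ)⁻¹ • perp y.1), y.2) := rfl

lemma stretchHomeo_frameAction (R : FrameMap n) (a ρ : Radius) (q : Euc (n + 1))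
    (v : UnitSphere n) (y : Marked n S) :
    stretchHomeo n S a (frameAction R ρ q v y) = frameAction R ((a * ρ : ℝ)) q v y := by
  refine Prod.ext ?_ rfl
  rw [← consVec_perp (frameAction R ((a * ρ : ℝ)) q v y).1, stretchHomeo_apply]
  simp only [frameAction_zero, perp_frameAction, smul_smul, mul_pow, mul_inv, mul_assoc]

/-- The product of two radii. -/
def Radius.mul (a ρ : Radius) : Radius :=
  ⟨a * ρ, mul_pos a.2.1 ρ.2.1, mul_lt_one_of_nonneg_of_lt_one_left a.2.1.le a.2.2 ρ.2.2.le⟩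

lemma ScattererConfig.viewMeasure_mul (Q : ScattererConfig n S) (R : FrameMap n) (a ρ : Radius)
    (q : Euc (n + 1)) (v : UnitSphere n) :
    Q.viewMeasure R (a.mul ρ) q v = (Q.viewMeasure R ρ q v).map (stretchHomeo n S a) := by
  refine Subtype.ext (Measure.ext fun G hG => ?_)
  have hc := (stretchHomeo n S a).continuous.measurable
  change _ = ((Q.viewMeasure R ρ q v).1.map (stretchHomeo n S a)) G
  rw [Measure.map_apply hc hG, Q.viewMeasure_apply R _ q v hG, Q.viewMeasure_apply R _ q v (hc hG)]
  refine tsum_congr fun p => ?_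
  have he : {v | frameAction R ((a.mul ρ : Radius) : ℝ) q v ((p : Euc (n + 1)), Q.mark p) ∈ G} =
      {v | frameAction R (ρ : ℝ) q v ((p : Euc (n + 1)), Q.mark p) ∈ stretchHomeo n S a ⁻¹' G} := by
    ext v
    simp only [mem_ofPred_eq, mem_preimage, stretchHomeo_frameAction]
    rfl
  rw [he]

variable {R : FrameMap n} {Q : ScattererConfig n S} {c : ℝ}
    {m : ProbabilityMeasure S} {μ : S → ProbabilityMeasure (CountingMeasures (Marked n S))}
    {E : Set (Euc (n + 1))}

/-- Since D_a D_ρ = D_{aρ}, stretching 𝒬_ρ by D_a gives 𝒬_{aρ}, and both have the same limit as ρ →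
0. The invariance is closed in ς, so density of the marks extends it. -/
lemma StandingAssumptions.map_stretch (hyp : StandingAssumptions R Q c m μ E) (hn : 1 ≤ n)
    (a : Radius) (s : S) :
    (μ s).map (CountingMeasures.continuous_map (stretchHomeo n S a)).measurable.aemeasurable =
      μ s := by
  have := hyp.t2Space
  have hc := CountingMeasures.continuous_map (stretchHomeo n S a)
  have hcl : IsClosed {s | (μ s).map hc.measurable.aemeasurable = μ s} :=
    isClosed_eq ((ProbabilityMeasure.continuous_map hc).comp hyp.continuous_limit)
      hyp.continuous_limit
  have hsub : Q.mark '' (Q.centers \ E) ⊆ {s | (μ s).map hc.measurable.aemeasurable = μ s} := by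
    rintro _ ⟨q, hq, rfl⟩
    obtain ⟨v₀, -⟩ := R.continuousOn_compl
    obtain ⟨lam, -, hlam, -⟩ := exists_capMeasure v₀
    have h1 := hyp.tendsto_viewLaw le_rfl hlam tendsto_radSeq
      (Q.eventually_mem_centersIn hn hq tendsto_radSeq) (q := fun _ => q) tendsto_const_nhds
    have hr : Tendsto (fun j => ((a.mul (radSeq j) : Radius) : ℝ)) atTop (𝓝 0) := by
      have := tendsto_radSeq.const_mul (a : ℝ)
      rwa [mul_zero] at this
    have h2 := hyp.tendsto_viewLaw le_rfl hlam hr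
      (Q.eventually_mem_centersIn hn hq hr) (q := fun _ => q) tendsto_const_nhds
    have h3 := ((ProbabilityMeasure.continuous_map hc).tendsto _).comp h1
    refine tendsto_nhds_unique (h3.congr fun j => ?_) h2
    refine Subtype.ext ?_
    change ((lam : Measure (UnitSphere n)).map _).map _ = (lam : Measure (UnitSphere n)).map _
    rw [Measure.map_map hc.measurable (Q.measurable_viewMeasure R _ q)]
    congr 1
    funext v
    exact (Q.viewMeasure_mul R a (radSeq j) q v).symm
  have := closure_minimal hsub hcl
  rw [hyp.marks_dense] at this
  exact this (mem_univ s)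

/-- Almost surely, there is a point in every given half-cylinder of radius one. -/
lemma StandingAssumptions.ae_nonempty (hyp : StandingAssumptions R Q c m μ E) (hn : 1 ≤ n)
    (s : S) (x : Euc n) : ∀ᵐ ν ∂(μ s : Measure (CountingMeasures (Marked n S))),
      ∃ y ∈ ν.points, 0 < y.1 0 ∧ ‖perp y.1 - x‖ < 1 := by
  have hC : MeasurableSet {y : Marked n S | 0 < y.1 0 ∧ ‖perp y.1 - x‖ < 1} := by
    have h0 : Continuous fun y : Marked n S => y.1 0 := by fun_prop
    have h1 : Continuous fun y : Marked n S => ‖perp y.1 - x‖ :=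
      ((continuous_perp.comp continuous_fst).sub continuous_const).norm
    exact ((isOpen_lt continuous_const h0).inter (isOpen_lt h1 continuous_const)).measurableSet
  set C : Set (Marked n S) := {y | 0 < y.1 0 ∧ ‖perp y.1 - x‖ < 1} with hCdef
  suffices h : (μ s : Measure (CountingMeasures (Marked n S))) {ν | ν.1 C = 0} = 0 by
    filter_upwards [measure_eq_zero_iff_ae_notMem.1 h] with ν hν
    obtain ⟨y, hy, hy'⟩ := CountingMeasures.exists_point_of_ne_zero (A := C) hν
    exact ⟨y, hy', hy⟩
  by_contra hne
  -- [Q3] is applied with ε equal to the supposed positive probability of the void itself, which the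
  -- stretching below contradicts.
  obtain ⟨r, hr, hvoid⟩ := hyp.small_voids _ (pos_iff_ne_zero.2 hne)
  -- Stretching by D_a turns the unit cylinder into one of radius r + 1, which contains a ball of
  -- radius r centered on its axis at height r + 1.
  let a : Radius := ⟨1 / (r + 1), by positivity, by rw [div_lt_one (by positivity)]; linarith⟩
  have ha : (a : ℝ)⁻¹ = r + 1 := by simp [a]
  have ha1 : (a : ℝ) * (r + 1) = 1 := by rw [← ha]; exact mul_inv_cancel₀ a.2.1.ne'
  have hc := CountingMeasures.continuous_map (stretchHomeo n S a)
  set G : Set (Marked n S) := Metric.ball (consVec (r + 1) ((a : ℝ)⁻¹ • x)) r ×ˢ (univ : Set S)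
  have hG : MeasurableSet G := (Metric.isOpen_ball.prod isOpen_univ).measurableSet
  have hGC : stretchHomeo n S a ⁻¹' G ⊆ C := by
    rintro y ⟨hy, -⟩
    rw [mem_ball_iff_norm, stretchHomeo_apply] at hy
    have h0 := (abs_zero_le_norm _).trans_lt hy
    have h1 := (norm_perp_le _).trans_lt hy
    simp only [PiLp.sub_apply, consVec_zero] at h0
    rw [perp_sub, perp_consVec, perp_consVec, ← smul_sub, norm_smul, ha,
      Real.norm_of_nonneg (by linarith)] at h1
    rw [abs_lt] at h0
    refine ⟨?_, ?_⟩
    · by_contra hle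
      have := mul_nonpos_of_nonneg_of_nonpos (pow_pos a.2.1 n).le (not_lt.1 hle)
      linarith [h0.1]
    · by_contra hle
      nlinarith [not_lt.1 hle]
  refine absurd (hvoid s (consVec (r + 1) ((a : ℝ)⁻¹ • x))) (not_lt.2 ?_)
  have hmap := congrArg (fun P : ProbabilityMeasure (CountingMeasures (Marked n S)) =>
    (P : Measure (CountingMeasures (Marked n S)))) (hyp.map_stretch hn a s)
  simp only [ProbabilityMeasure.toMeasure_map] at hmap
  conv_rhs => rw [← hmap]
  rw [Measure.map_apply hc.measurable
    (measurableSet_eq_fun (CountingMeasures.measurable_apply hG) measurable_const)]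
  refine measure_mono fun ν hν => ?_
  change (ν.1.map (stretchHomeo n S a)) G = 0
  rw [Measure.map_apply (stretchHomeo n S a).continuous.measurable hG]
  exact measure_mono_null hGC hν

end Dilation

/-! ### The transition probabilities -/

section Product

variable {n : ℕ} {S : Type*} [MetricSpace S] [CompactSpace S] [MeasurableSpace S] [BorelSpace S]

lemma measurePreserving_consVec (n : ℕ) :
    MeasurePreserving (fun p : ℝ × Euc n => consVec p.1 p.2) (volume.prod volume) volume := by
  have h1 : MeasurePreserving (Prod.map id (WithLp.ofLp : Euc n → Fin n → ℝ))
      ((volume : Measure ℝ).prod volume) ((volume : Measure ℝ).prod volume) :=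
    (MeasurePreserving.id _).prod (PiLp.volume_preserving_ofLp (Fin n))
  have h2 := (volume_preserving_piFinSuccAbove (fun _ : Fin (n + 1) => ℝ) 0).symm
  have h3 := PiLp.volume_preserving_toLp (Fin (n + 1))
  have he : (WithLp.toLp 2 ∘ (MeasurableEquiv.piFinSuccAbove (fun _ : Fin (n + 1) => ℝ) 0).symm ∘
      Prod.map id (WithLp.ofLp : Euc n → Fin n → ℝ)) = fun p : ℝ × Euc n => consVec p.1 p.2 := by
    funext p
    ext i
    refine Fin.cases ?_ (fun j => ?_) i <;>
      simp [consVec, MeasurableEquiv.piFinSuccAbove, Fin.insertNthEquiv]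
  rw [← he]
  exact h3.comp (h2.comp h1)

lemma volume_axis (n : ℕ) : volume {x : Euc (n + 1) | x 0 = 0} = 0 := by
  have hm : MeasurableSet {x : Euc (n + 1) | x 0 = 0} :=
    (isClosed_eq (by fun_prop) continuous_const).measurableSet
  rw [← (measurePreserving_consVec n).measure_preimage hm.nullMeasurableSet]
  have : (fun p : ℝ × Euc n => consVec p.1 p.2) ⁻¹' {x : Euc (n + 1) | x 0 = 0} = {0} ×ˢ univ := by
    ext p
    simp
  rw [this, Measure.prod_prod]
  simp

lemma volume_wall (hn : 1 ≤ n) (x : Euc n) : volume {y : Euc (n + 1) | ‖perp y - x‖ = 1} = 0 := by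
  have hm : MeasurableSet {y : Euc (n + 1) | ‖perp y - x‖ = 1} :=
    (isClosed_eq (continuous_perp.sub continuous_const).norm continuous_const).measurableSet
  rw [← (measurePreserving_consVec n).measure_preimage hm.nullMeasurableSet]
  have h : (fun p : ℝ × Euc n => consVec p.1 p.2) ⁻¹' {y : Euc (n + 1) | ‖perp y - x‖ = 1} =
      univ ×ˢ Metric.sphere x 1 := by
    ext p
    simp
  have : Nonempty (Fin n) := ⟨⟨0, hn⟩⟩
  rw [h, Measure.prod_prod, Measure.addHaar_sphere, mul_zero]

/-- The inclusion of `ℝ_{>0} × Ω` in `ℝ × ℝ^(d-1) × Σ`. -/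
def ambient (z : Set.Ioi (0 : ℝ) × ImpactSpace n S) : ℝ × Euc n × S := (z.1, z.2.1, z.2.2)

lemma isOpenEmbedding_ambient : Topology.IsOpenEmbedding (ambient (n := n) (S := S)) :=
  isOpen_Ioi.isOpenEmbedding_subtypeVal.prodMap
    (Metric.isOpen_ball.isOpenEmbedding_subtypeVal.prodMap Topology.IsOpenEmbedding.id)

/-- Openness is joint in the base point, since exit parameters move along with configurations. -/
lemma isOpen_place {G : Set (Set.Ioi (0 : ℝ) × ImpactSpace n S)} (hG : IsOpen G) :
    IsOpen {p : Euc n × Marked n S | ∃ z ∈ G, place p.1 z = p.2} := by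
  have hc : Continuous fun p : Euc n × Marked n S => (p.2.1 0, p.1 - perp p.2.1, p.2.2) := by
    have : Continuous fun p : Euc n × Marked n S => perp p.2.1 :=
      continuous_perp.comp (continuous_fst.comp continuous_snd)
    fun_prop
  convert (isOpenEmbedding_ambient.isOpenMap G hG).preimage hc using 1
  ext ⟨x, y, s⟩
  constructor
  · rintro ⟨z, hz, he⟩
    refine ⟨z, hz, ?_⟩
    simp only [place, Prod.mk.injEq] at he
    obtain ⟨rfl, rfl⟩ := he
    simp [ambient]
  · rintro ⟨z, hz, he⟩
    refine ⟨z, hz, ?_⟩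
    simp only [ambient, Prod.mk.injEq] at he
    obtain ⟨h1, h2, h3⟩ := he
    simp [place, h1, h2, h3]

lemma measurableEmbedding_place (x : Euc n) : MeasurableEmbedding (place x (S := S)) := by
  have h : Topology.IsOpenEmbedding (place x (S := S)) := by
    refine Topology.IsOpenEmbedding.of_continuous_injective_isOpenMap
      (continuous_place.comp (Continuous.prodMk_right x)) (place_injective x) fun G hG => ?_
    convert (isOpen_place hG).preimage (Continuous.prodMk_right (Y := Marked n S) x) using 1
    rfl
  exact h.measurableEmbedding

instance : SigmaFinite posMeasure := by
  refine SigmaFinite.of_map (f := Subtype.val) _ measurable_subtype_coe.aemeasurable ?_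
  rw [posMeasure, map_comap_subtype_coe measurableSet_Ioi]
  infer_instance

instance : IsFiniteMeasure ((volume : Measure (Euc n)).comap
    (Subtype.val : Metric.ball (0 : Euc n) 1 → Euc n)) := by
  refine ⟨?_⟩
  rw [comap_subtype_coe_apply measurableSet_ball, image_univ, Subtype.range_coe]
  exact measure_ball_lt_top

instance (m : Measure S) [IsFiniteMeasure m] : IsFiniteMeasure (impactMeasure n m) := by
  refine ⟨?_⟩
  rw [impactMeasure, Measure.smul_apply, smul_eq_mul]
  exact ENNReal.mul_lt_top (ENNReal.inv_lt_top.2 (Metric.measure_ball_pos _ _ one_pos))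
    (measure_lt_top _ _)

/-- Up to the constant normalizing the impact measure, `place x` preserves measure: it is a
reflection and translation in the transverse variable. -/
lemma prod_place_eq_zero (m : Measure S) [IsProbabilityMeasure m] (x : Euc n)
    {A : Set (Set.Ioi (0 : ℝ) × ImpactSpace n S)} (hA : MeasurableSet A)
    (h : (posMeasure.prod (impactMeasure n m)) A = 0) :
    ((volume : Measure (Euc (n + 1))).prod m) (place x '' A) = 0 := by
  have hamb : MeasurableEmbedding (ambient (n := n) (S := S)) :=
    isOpenEmbedding_ambient.measurableEmbedding
  have h1 : MeasurePreserving (fun p : ℝ × Euc n × S =>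
      ((consVec p.1 (x - p.2.1), p.2.2) : Marked n S))
      ((volume : Measure ℝ).prod ((volume : Measure (Euc n)).prod m)) (volume.prod m) := by
    have e1 := (MeasurePreserving.id (volume : Measure ℝ)).prod
      (Measure.measurePreserving_sub_left (volume : Measure (Euc n)) x)
    have e2 := ((measurePreserving_consVec n).comp e1).prod (MeasurePreserving.id m)
    have e3 := (MeasureTheory.measurePreserving_prodAssoc (volume : Measure ℝ) (volume : Measure (Euc n)) m).symm
    exact e2.comp e3
  rw [← h1.measure_preimage (((measurableEmbedding_place x).measurableSet_image.2 hA).nullMeasurableSet)]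
  have h2 : (fun p : ℝ × Euc n × S => ((consVec p.1 (x - p.2.1), p.2.2) : Marked n S)) ⁻¹'
      (place x '' A) = ambient '' A := by
    ext ⟨t, w, s⟩
    constructor
    · rintro ⟨z, hz, he⟩
      simp only [place, Prod.mk.injEq] at he
      obtain ⟨h3, h4⟩ := consVec_inj he.1
      exact ⟨z, hz, by simp [ambient, h3, sub_right_inj.1 h4, he.2]⟩
    · rintro ⟨z, hz, he⟩
      simp only [ambient, Prod.mk.injEq] at he
      exact ⟨z, hz, by simp [place, he]⟩
  rw [h2]
  have h3 : (posMeasure.prod (((volume : Measure (Euc n)).comap Subtype.val).prod m)).map ambient =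
      ((volume : Measure ℝ).restrict (Ioi 0)).prod
        (((volume : Measure (Euc n)).restrict (Metric.ball 0 1)).prod m) := by
    have e1 : MeasurePreserving (Subtype.val : Set.Ioi (0 : ℝ) → ℝ) posMeasure
        ((volume : Measure ℝ).restrict (Ioi 0)) :=
      ⟨measurable_subtype_coe, map_comap_subtype_coe measurableSet_Ioi _⟩
    have e2 : MeasurePreserving (Subtype.val : Metric.ball (0 : Euc n) 1 → Euc n)
        ((volume : Measure (Euc n)).comap Subtype.val)
        ((volume : Measure (Euc n)).restrict (Metric.ball 0 1)) :=
      ⟨measurable_subtype_coe, map_comap_subtype_coe measurableSet_ball _⟩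
    exact (e1.prod (e2.prod (MeasurePreserving.id m))).map_eq
  have h4 : (posMeasure.prod (((volume : Measure (Euc n)).comap Subtype.val).prod m)) A = 0 := by
    refine Measure.AbsolutelyContinuous.prod Measure.AbsolutelyContinuous.rfl
      (Measure.absolutelyContinuous_smul ?_) h
    simp [measure_ball_lt_top.ne]
  have h5 := congrArg (fun M => M (ambient '' A)) h3
  change Measure.map _ _ _ = _ at h5
  rw [hamb.map_apply, hamb.injective.preimage_image, h4] at h5
  have h6 : ((volume : Measure ℝ).restrict (Ioi 0)).prod
        (((volume : Measure (Euc n)).restrict (Metric.ball 0 1)).prod m) =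
      ((volume : Measure ℝ).prod ((volume : Measure (Euc n)).prod m)).restrict
        (Ioi 0 ×ˢ (Metric.ball 0 1 ×ˢ univ)) := by
    rw [← Measure.prod_restrict, ← Measure.prod_restrict, Measure.restrict_univ]
  rw [h6, Measure.restrict_apply (hamb.measurableSet_image.2 hA), inter_eq_left.2] at h5
  · exact h5.symm
  · rintro _ ⟨z, -, rfl⟩
    exact ⟨z.1.2, z.2.1.2, mem_univ _⟩

end Product

/-! ### The law of the first hit: measurability, total mass, density and semicontinuity -/

section HitLaw

variable {n : ℕ} {S : Type*} [MetricSpace S] [CompactSpace S] [MeasurableSpace S] [BorelSpace S]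
variable {R : FrameMap n} {Q : ScattererConfig n S} {c : ℝ}
    {m : ProbabilityMeasure S} {μ : S → ProbabilityMeasure (CountingMeasures (Marked n S))}
    {E : Set (Euc (n + 1))}

/-- The limit process is almost surely in general position with respect to a given cylinder. -/
lemma StandingAssumptions.ae_good (hyp : StandingAssumptions R Q c m μ E) (hn : 1 ≤ n)
    (s : S) (x : Euc n) :
    ∀ᵐ ν ∂(μ s : Measure (CountingMeasures (Marked n S))), Good x ν := by
  have hac := hyp.intensity_absolutelyContinuous hn s
  have h1 : intensity (μ s) {y | y.1 0 = 0} = 0 := by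
    refine hac ?_
    have : {y : Marked n S | y.1 0 = 0} = {x : Euc (n + 1) | x 0 = 0} ×ˢ univ := by
      ext y; simp
    rw [this, Measure.prod_prod, volume_axis, zero_mul]
  have h2 : intensity (μ s) {y | ‖perp y.1 - x‖ = 1} = 0 := by
    refine hac ?_
    have : {y : Marked n S | ‖perp y.1 - x‖ = 1} =
        {y : Euc (n + 1) | ‖perp y - x‖ = 1} ×ˢ univ := by
      ext y; simp
    rw [this, Measure.prod_prod, volume_wall hn, zero_mul]
  filter_upwards [ae_no_points h1, ae_no_points h2,
    measure_eq_zero_iff_ae_notMem.1 (hyp.coincidence_free s), hyp.ae_nonempty hn s x]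
    with ν e1 e2 e3 e4
  refine ⟨fun y hy h => e1 y h hy, fun y hy h => e2 y h hy, fun t => ?_, e4⟩
  by_contra hc
  exact e3 ⟨t, not_le.1 hc⟩

lemma isOpen_cyl (x : Euc n) (t : ℝ) :
    IsOpen {y : Marked n S | 0 < y.1 0 ∧ y.1 0 < t ∧ ‖perp y.1 - x‖ < 1} := by
  have h0 : Continuous fun y : Marked n S => y.1 0 := by fun_prop
  have h1 : Continuous fun y : Marked n S => ‖perp y.1 - x‖ :=
    ((continuous_perp.comp continuous_fst).sub continuous_const).norm
  exact (isOpen_lt continuous_const h0).inter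
    ((isOpen_lt h0 continuous_const).inter (isOpen_lt h1 continuous_const))

/-- For configurations in general position, a first point in a given set is detected by the
masses of countably many sets. -/
lemma Good.exists_firstAt_iff {x : Euc n} {ν : CountingMeasures (Marked n S)} (h : Good x ν)
    {A : Set (Set.Ioi (0 : ℝ) × ImpactSpace n S)} (hA : MeasurableSet A) :
    (∃ z ∈ A, FirstAt x ν (place x z)) ↔
      ∃ t : ℚ, ν.1 {y | 0 < y.1 0 ∧ y.1 0 < t ∧ ‖perp y.1 - x‖ < 1} = 1 ∧
        ν.1 ({y | 0 < y.1 0 ∧ y.1 0 < t ∧ ‖perp y.1 - x‖ < 1} ∩ place x '' A) = 1 := by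
  constructor
  · rintro ⟨z, hz, hf⟩
    set y := place x z with hy
    have hy0 : 0 < y.1 0 := hf.1.2.1
    have hperp : ∀ {y' : Marked n S}, ‖perp y'.1 - x‖ < 1 → ‖perp y'.1‖ ≤ 1 + ‖x‖ :=
      fun {y'} h' => by
        have := norm_add_le (perp y'.1 - x) x
        rw [sub_add_cancel] at this
        linarith
    have hfin := ν.finite_points_inter (isCompact_slab (S := S) (n := n) (y.1 0 + 1) (1 + ‖x‖))
    -- Finiteness leaves a gap above the first point before the next one in the cylinder; a rational
    -- t in the gap isolates it.
    have hev : ∀ᶠ t in 𝓝[>] (y.1 0), ∀ y' ∈ ν.points ∩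
        {y' | |y'.1 0| ≤ y.1 0 + 1 ∧ ‖perp y'.1‖ ≤ 1 + ‖x‖},
        0 < y'.1 0 → ‖perp y'.1 - x‖ < 1 → y'.1 0 < t → y' = y := by
      refine (eventually_all_finite hfin).2 fun y' hy' => ?_
      by_cases hc : 0 < y'.1 0 ∧ ‖perp y'.1 - x‖ < 1 ∧ y' ≠ y
      · have hlt := hf.2 y' hy'.1 hc.1 hc.2.1 hc.2.2
        filter_upwards [mem_nhdsWithin_of_mem_nhds (gt_mem_nhds hlt)] with t ht _ _ h3
        exact absurd (h3.trans ht) (lt_irrefl _)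
      · refine Eventually.of_forall fun t h1 h2 _ => ?_
        by_contra h3
        exact hc ⟨h1, h2, h3⟩
    have hev1 : ∀ᶠ t in 𝓝[>] (y.1 0), t < y.1 0 + 1 :=
      mem_nhdsWithin_of_mem_nhds (gt_mem_nhds (lt_add_one _))
    obtain ⟨u, hu, hu'⟩ := (mem_nhdsGT_iff_exists_Ioo_subset).1 (hev.and hev1)
    obtain ⟨t, ht1, ht2⟩ := exists_rat_btwn (show y.1 0 < u from hu)
    obtain ⟨ht3, ht4⟩ := hu' ⟨ht1, ht2⟩
    have key : ∀ B : Set (Marked n S), MeasurableSet B → y ∈ B →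
        ν.1 ({y | 0 < y.1 0 ∧ y.1 0 < t ∧ ‖perp y.1 - x‖ < 1} ∩ B) = 1 := by
      intro B hB hyB
      have hyD : y ∈ {y : Marked n S | 0 < y.1 0 ∧ y.1 0 < t ∧ ‖perp y.1 - x‖ < 1} ∩ B :=
        ⟨⟨hy0, ht1, hf.1.2.2⟩, hyB⟩
      refine le_antisymm ?_ ((ν.one_le_singleton hf.1.1).trans
        (measure_mono (singleton_subset_iff.2 hyD)))
      rw [← union_sdiff_cancel (singleton_subset_iff.2 hyD)]
      refine (measure_union_le _ _).trans ?_
      rw [CountingMeasures.measure_eq_zero_of_points (A := _ \ {y}) ?_, add_zero]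
      · exact h.singleton_le y
      · rintro y' ⟨⟨h1, -⟩, h2⟩ hy'
        refine h2 (ht3 y' ⟨hy', ?_, hperp h1.2.2⟩ h1.1 h1.2.2 h1.2.1)
        rw [abs_of_pos h1.1]
        have := h1.2.1
        linarith
    refine ⟨t, ?_, key _ ((measurableEmbedding_place x).measurableSet_image.2 hA)
      (mem_image_of_mem _ hz)⟩
    have := key univ MeasurableSet.univ (mem_univ _)
    rwa [inter_univ] at this
  · rintro ⟨t, h1, h2⟩
    obtain ⟨y, ⟨hyD, z, hz, rfl⟩, hyp⟩ := CountingMeasures.exists_point_of_ne_zero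
      (ν := ν) (by rw [h2]; exact one_ne_zero)
    refine ⟨z, hz, ⟨hyp, hyD.1, hyD.2.2⟩, fun y' hy' h3 h4 h5 => ?_⟩
    by_contra h6
    have h7 : ({place x z} ∪ {y'} : Set (Marked n S)) ⊆
        {y | 0 < y.1 0 ∧ y.1 0 < t ∧ ‖perp y.1 - x‖ < 1} := by
      rintro w (rfl | rfl)
      · exact hyD
      · exact ⟨h3, (not_lt.1 h6).trans_lt hyD.2.1, h4⟩
    have h8 := measure_mono (μ := ν.1) h7
    rw [h1, measure_union (by simpa using h5.symm) (measurableSet_singleton y')] at h8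
    have h9 := (add_le_add (ν.one_le_singleton hyp) (ν.one_le_singleton hy')).trans h8
    norm_num at h9

/-- The map is built by choice, but on good configurations its preimages are given by countably many
mass conditions, so they agree with measurable sets up to null sets. -/
lemma StandingAssumptions.aemeasurable_hit (hyp : StandingAssumptions R Q c m μ E) (hn : 1 ≤ n)
    (s : S) (x : Euc n) :
    AEMeasurable (hit x) (μ s : Measure (CountingMeasures (Marked n S))) := by
  classical
  -- An arbitrary value, taken only on configurations without a first point, which form a null set.
  let z₀ : Set.Ioi (0 : ℝ) × ImpactSpace n S :=
    (⟨1, mem_Ioi.2 one_pos⟩, ⟨0, Metric.mem_ball_self one_pos⟩, s)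
  let f : CountingMeasures (Marked n S) → Set.Ioi (0 : ℝ) × ImpactSpace n S := fun ν =>
    if h : ∃ z, FirstAt x ν (place x z) then h.choose else z₀
  have hf : ∀ ν, Good x ν → FirstAt x ν (place x (f ν)) := fun ν hν => by
    have h := hν.exists_first
    simp only [f, dif_pos h]
    exact h.choose_spec
  have hgood := hyp.ae_good hn s x
  have hfm : AEMeasurable f (μ s : Measure (CountingMeasures (Marked n S))) := by
    refine NullMeasurable.aemeasurable fun A hA => ?_
    have hm : MeasurableSet {ν : CountingMeasures (Marked n S) | ∃ t : ℚ,
        ν.1 {y | 0 < y.1 0 ∧ y.1 0 < t ∧ ‖perp y.1 - x‖ < 1} = 1 ∧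
        ν.1 ({y | 0 < y.1 0 ∧ y.1 0 < t ∧ ‖perp y.1 - x‖ < 1} ∩ place x '' A) = 1} := by
      simp only [ofPred_exists]
      refine MeasurableSet.iUnion fun t => ?_
      have h1 := (isOpen_cyl (S := S) x t).measurableSet
      have h2 := h1.inter ((measurableEmbedding_place x).measurableSet_image.2 hA)
      exact (measurableSet_eq_fun (CountingMeasures.measurable_apply h1) measurable_const).inter
        (measurableSet_eq_fun (CountingMeasures.measurable_apply h2) measurable_const)
    refine hm.nullMeasurableSet.congr ?_
    filter_upwards [hgood] with ν hν
    refine propext ?_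
    change (∃ t : ℚ, _) ↔ f ν ∈ A
    rw [← hν.exists_firstAt_iff hA]
    constructor
    · rintro ⟨z, hz, h⟩
      rwa [← place_injective x (h.unique (hf ν hν))]
    · exact fun h => ⟨_, h, hf ν hν⟩
  refine (measurable_inl.comp_aemeasurable hfm).congr ?_
  filter_upwards [hgood] with ν hν
  exact ((hit_eq_inl_iff x ν (f ν)).2 (hf ν hν)).symm

/-- Almost everywhere measurability is what prevents the push-forward in `hitLaw` from being the
default zero measure. -/
lemma StandingAssumptions.hitLaw_apply (hyp : StandingAssumptions R Q c m μ E) (hn : 1 ≤ n)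
    (s : S) (x : Euc n) {A : Set (Set.Ioi (0 : ℝ) × ImpactSpace n S)} (hA : MeasurableSet A) :
    hitLaw μ (x, s) A = (μ s : Measure (CountingMeasures (Marked n S)))
      {ν | ∃ z ∈ A, FirstAt x ν (place x z)} := by
  have hinl : MeasurableEmbedding (Sum.inl : _ → HitSpace n S) := 
    ⟨Sum.inl_injective, measurable_inl, fun _ h => h.inl_image⟩
  change (((μ s : Measure (CountingMeasures (Marked n S))).map (hit x)).comap Sum.inl) A = _
  rw [hinl.comap_apply, Measure.map_apply_of_aemeasurable (hyp.aemeasurable_hit hn s x)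
    (hinl.measurableSet_image.2 hA)]
  congr 1
  ext ν
  constructor
  · rintro ⟨z, hz, h⟩
    exact ⟨z, hz, (hit_eq_inl_iff x ν z).1 h.symm⟩
  · rintro ⟨z, hz, h⟩
    exact ⟨z, hz, ((hit_eq_inl_iff x ν z).2 h).symm⟩

lemma StandingAssumptions.isProbabilityMeasure_hitLaw (hyp : StandingAssumptions R Q c m μ E)
    (hn : 1 ≤ n) (ω : Euc n × S) : IsProbabilityMeasure (hitLaw μ ω) := by
  obtain ⟨x, s⟩ := ω
  refine ⟨?_⟩
  rw [hyp.hitLaw_apply hn s x MeasurableSet.univ,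
    ← measure_univ (μ := (μ s : Measure (CountingMeasures (Marked n S))))]
  refine measure_congr (eventuallyEq_univ.2 ?_)
  filter_upwards [hyp.ae_good hn s x] with ν hν
  obtain ⟨z, hz⟩ := hν.exists_first
  exact ⟨z, mem_univ z, hz⟩

/-- A first hit in a null set is in particular a point of the process in a null set of its
intensity. -/
lemma StandingAssumptions.hitLaw_absolutelyContinuous (hyp : StandingAssumptions R Q c m μ E)
    (hn : 1 ≤ n) (ω : Euc n × S) :
    hitLaw μ ω ≪ posMeasure.prod (impactMeasure n (m : Measure S)) := by
  obtain ⟨x, s⟩ := ω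
  refine Measure.AbsolutelyContinuous.mk fun A hA h => ?_
  rw [hyp.hitLaw_apply hn s x hA]
  have h1 := hyp.intensity_absolutelyContinuous hn s (prod_place_eq_zero (m : Measure S) x hA h)
  refine measure_mono_null ?_ (measure_eq_zero_iff_ae_notMem.2 ?_) (t := {ν | ¬ ∀ y ∈ place x '' A, y ∉ ν.points})
  · rintro ν ⟨z, hz, hf⟩ hc
    exact hc _ (mem_image_of_mem _ hz) hf.1.1
  · filter_upwards [ae_no_points h1] with ν hν hc
    exact hc hν

/-- Radon–Nikodym; the derivative is finite almost everywhere, so passing to real values loses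
nothing. -/
lemma StandingAssumptions.hitLaw_eq_withDensity (hyp : StandingAssumptions R Q c m μ E)
    (hn : 1 ≤ n) (ω : Euc n × S) :
    hitLaw μ ω = (posMeasure.prod (impactMeasure n (m : Measure S))).withDensity
      (fun y => ENNReal.ofReal (transitionKernel (m : Measure S) μ ω y.1 y.2)) := by
  have := hyp.isProbabilityMeasure_hitLaw hn ω
  conv_lhs => rw [← Measure.withDensity_rnDeriv_eq _ _ (hyp.hitLaw_absolutelyContinuous hn ω)]
  refine withDensity_congr_ae ?_
  filter_upwards [Measure.rnDeriv_lt_top (hitLaw μ ω)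
    (posMeasure.prod (impactMeasure n (m : Measure S)))] with y hy
  exact (ENNReal.ofReal_toReal hy.ne).symm

/-- Stability of first points, in terms of the data `(ξ, w, ς)`. -/
lemma Good.eventually_firstAt [Nonempty S] {x : Euc n} {ν : CountingMeasures (Marked n S)}
    (h : Good x ν) {z : Set.Ioi (0 : ℝ) × ImpactSpace n S} (hz : FirstAt x ν (place x z))
    {ι : Type*} {l : Filter ι} {νi : ι → CountingMeasures (Marked n S)} {xi : ι → Euc n}
    (hν : Tendsto (fun i => (νi i).testVec) l (𝓝 ν.testVec)) (hx : Tendsto xi l (𝓝 x))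
    {G : Set (Set.Ioi (0 : ℝ) × ImpactSpace n S)} (hG : IsOpen G) (hzG : z ∈ G) :
    ∀ᶠ i in l, ∃ z' ∈ G, FirstAt (xi i) (νi i) (place (xi i) z') := by
  -- The two slabs matter only for collisions; here just the enlarged cylinder is used, so any
  -- constant will do.
  obtain ⟨η, hη, H⟩ := h.eventually_first hz 0
  have h1 : {p : Euc n × Marked n S | ∃ z ∈ G, place p.1 z = p.2} ∈ 𝓝 (x, place x z) :=
    (isOpen_place hG).mem_nhds ⟨z, hzG, rfl⟩
  obtain ⟨O₁, hO₁, O₂, hO₂, hO⟩ := mem_nhds_prod_iff.1 h1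
  have hc0 : Continuous fun z : Marked n S => z.1 0 := by fun_prop
  have h2 : O₂ ∩ {y | y.1 0 < (place x z).1 0 + 2 * η} ∈ 𝓝 (place x z) :=
    inter_mem hO₂ ((isOpen_lt hc0 continuous_const).mem_nhds (show (place x z).1 0 < (place x z).1 0 + 2 * η by linarith))
  filter_upwards [H hν _ h2, hx hO₁, hx (Metric.ball_mem_nhds x hη)] with i hi hi1 hi2
  obtain ⟨y, hyO, hyp, hu, -⟩ := hi
  obtain ⟨z', hz', he⟩ := hO (show (xi i, y) ∈ O₁ ×ˢ O₂ from ⟨hi1, hyO.1⟩)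
  simp only at he
  have hin : 0 < y.1 0 ∧ ‖perp y.1 - xi i‖ < 1 := by
    rw [← he]
    refine ⟨z'.1.2, ?_⟩
    have := z'.2.1.2
    rw [mem_ball_zero_iff] at this
    simpa [place] using this
  refine ⟨z', hz', ?_⟩
  rw [he]
  refine ⟨⟨hyp, hin⟩, fun y' hy' h3 h4 h5 => ?_⟩
  by_contra h6
  refine h5 (hu y' hy' (by linarith) ?_ ?_)
  · have := hyO.2
    exact (not_lt.1 h6).trans this.le
  · have h7 : ‖xi i - x‖ < η := by simpa [dist_eq_norm] using hi2
    have := norm_add_le (perp y'.1 - xi i) (xi i - x)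
    rw [sub_add_sub_cancel] at this
    linarith

/-- The transition probabilities depend continuously on the exit data. -/
lemma StandingAssumptions.hitLaw_le_liminf (hyp : StandingAssumptions R Q c m μ E) (hn : 1 ≤ n)
    {xi : ℕ → Euc n} {x : Euc n} {si : ℕ → S} {s : S} (hx : Tendsto xi atTop (𝓝 x))
    (hs : Tendsto si atTop (𝓝 s)) {G : Set (Set.Ioi (0 : ℝ) × ImpactSpace n S)} (hG : IsOpen G) :
    hitLaw μ (x, s) G ≤ liminf (fun j => hitLaw μ (xi j, si j) G) atTop := by
  have : Nonempty S := ⟨s⟩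
  simp_rw [hyp.hitLaw_apply hn _ _ hG.measurableSet]
  have hΦ := CountingMeasures.continuous_testVec (X := Marked n S)
  have hlim := ((ProbabilityMeasure.continuous_map hΦ).tendsto _).comp
    ((hyp.continuous_limit.tendsto s).comp hs)
  have hW : ∀ T : Set (ℕ × ℕ → ℝ), IsOpen T →
      ((μ s : Measure (CountingMeasures (Marked n S))).map CountingMeasures.testVec) T ≤
      liminf (fun j => (μ (si j) : Measure (CountingMeasures (Marked n S)))
        (CountingMeasures.testVec ⁻¹' T)) atTop := by
    intro T hT
    refine (ProbabilityMeasure.le_liminf_measure_open_of_tendsto hlim hT).trans (le_of_eq ?_)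
    congr 1
    funext j
    exact Measure.map_apply hΦ.measurable hT.measurableSet
  -- This image need not be measurable: the bound for push-forwards of arbitrary sets and the
  -- portmanteau inequality for outer measure avoid the question.
  let A : Set (ℕ × ℕ → ℝ) := CountingMeasures.testVec ''
    {ν : CountingMeasures (Marked n S) | Good x ν ∧ ∃ z ∈ G, FirstAt x ν (place x z)}
  calc (μ s : Measure (CountingMeasures (Marked n S))) {ν | ∃ z ∈ G, FirstAt x ν (place x z)}
      ≤ (μ s : Measure (CountingMeasures (Marked n S)))
          (CountingMeasures.testVec ⁻¹' A) := by
        refine measure_mono_ae ?_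
        filter_upwards [hyp.ae_good hn s x] with ν hν hz
        exact ⟨ν, ⟨hν, hz⟩, rfl⟩
    _ ≤ ((μ s : Measure (CountingMeasures (Marked n S))).map CountingMeasures.testVec) A :=
        Measure.le_map_apply hΦ.measurable.aemeasurable _
    _ ≤ _ := measure_le_liminf_of_eventually (W := fun _ => CountingMeasures.testVec)
        (B := fun j => {ν | ∃ z ∈ G, FirstAt (xi j) ν (place (xi j) z)}) hW ?_
  rintro _ ⟨ν, ⟨hν, z, hzG, hz⟩, rfl⟩
  have ht : Tendsto (fun i : ℕ × CountingMeasures (Marked n S) => (i.1, i.2.testVec))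
      (comap (fun i : ℕ × CountingMeasures (Marked n S) => (i.1, i.2.testVec))
        (atTop ×ˢ 𝓝 ν.testVec)) (atTop ×ˢ 𝓝 ν.testVec) := tendsto_comap
  exact hν.eventually_firstAt hz (tendsto_snd.comp ht) (hx.comp (tendsto_fst.comp ht)) hG hzG

end HitLaw

/-! ### The geometry of the first collision -/

section Geometry

variable {n : ℕ} {S : Type*}

lemma ScattererConfig.mem_freeSpace {Q : ScattererConfig n S} {ρ : ℝ} {x : Euc (n + 1)} :
    x ∈ Q.freeSpace ρ ↔ ∀ p ∈ Q.centers, ρ ≤ ‖x - p‖ := by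
  simp [ScattererConfig.freeSpace, dist_eq_norm]

lemma ScattererConfig.isClosed_freeSpace (Q : ScattererConfig n S) (ρ : ℝ) :
    IsClosed (Q.freeSpace ρ) :=
  (isOpen_biUnion fun _ _ => Metric.isOpen_ball).isClosed_compl

lemma norm_perp_frame_le (R : FrameMap n) (v : UnitSphere n) (b : Euc (n + 1)) :
    ‖perp (rowMul b (R.toFun v).1)‖ ≤ ‖b‖ :=
  (norm_perp_le _).trans (norm_rowMul _ _).le

lemma perp_frame_self (R : FrameMap n) (v : UnitSphere n) :
    perp (rowMul (v : Euc (n + 1)) (R.toFun v).1) = 0 := by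
  rw [R.map_to_e1]
  ext i
  simp [perp, e1]

/-- The perpendicular part of the position relative to a center, in the particle frame. -/
lemma perp_frame_trajectory (R : FrameMap n) (Q : ScattererConfig n S) (ρ : Radius)
    (q b p : Euc (n + 1)) (v : UnitSphere n) (t : ℝ) :
    perp (rowMul (q + (ρ : ℝ) • b + t • (v : Euc (n + 1)) - p) (R.toFun v).1) =
      (ρ : ℝ) • (perp (rowMul b (R.toFun v).1) -
        perp (frameAction R ρ q v ((p, Q.mark p) : Marked n S)).1) := by
  have e : q + (ρ : ℝ) • b + t • (v : Euc (n + 1)) - p =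
      (ρ : ℝ) • b + t • (v : Euc (n + 1)) - (p - q) := by abel
  rw [e, rowMul_sub, rowMul_add, rowMul_smul, rowMul_smul, perp_sub, perp_add, perp_smul, perp_smul,
    perp_frame_self, perp_frameAction, smul_sub, smul_smul, mul_inv_cancel₀ ρ.2.1.ne', one_smul,
    smul_zero, add_zero]

/-- Pythagoras in the particle frame: only the axial term depends on time, and the transverse
distance is ρ times a distance in the rescaled picture. -/
lemma norm_sq_trajectory (R : FrameMap n) (Q : ScattererConfig n S) (ρ : Radius)
    (q b p : Euc (n + 1)) (v : UnitSphere n) (t : ℝ) :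
    ‖q + (ρ : ℝ) • b + t • (v : Euc (n + 1)) - p‖ ^ 2 =
      (t - (inner ℝ (p - q) (v : Euc (n + 1)) - ρ * inner ℝ b (v : Euc (n + 1)))) ^ 2 +
      (ρ : ℝ) ^ 2 * ‖perp (frameAction R ρ q v ((p, Q.mark p) : Marked n S)).1 -
        perp (rowMul b (R.toFun v).1)‖ ^ 2 := by
  rw [← norm_rowMul (R.toFun v), norm_sq_split, perp_frame_trajectory R Q, rowMul_frame_zero,
    norm_smul, Real.norm_of_nonneg ρ.2.1.le, mul_pow, norm_sub_rev (perp (rowMul b _))]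
  congr 1
  have e : q + (ρ : ℝ) • b + t • (v : Euc (n + 1)) - p =
      (ρ : ℝ) • b + t • (v : Euc (n + 1)) - (p - q) := by abel
  rw [e, inner_sub_left, inner_add_left, real_inner_smul_left, real_inner_smul_left,
    real_inner_self_eq_norm_sq, norm_coe_sphere]
  ring

/-- A ray avoiding the open unit ball starts outside it, and is outgoing if it starts on the unit
sphere. -/
lemma outgoing_of_avoids {b : Euc (n + 1)} {v : UnitSphere n}
    (h : ∀ t : ℝ, 0 < t → b + t • (v : Euc (n + 1)) ∉ Metric.ball (0 : Euc (n + 1)) 1) :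
    1 ≤ ‖b‖ ∧ (‖b‖ = 1 → 0 ≤ inner ℝ b (v : Euc (n + 1))) := by
  have h' : ∀ t : ℝ, 0 < t → 1 ≤ ‖b + t • (v : Euc (n + 1))‖ := fun t ht => by
    simpa using h t ht
  refine ⟨?_, fun hb => ?_⟩
  · refine le_of_forall_pos_le_add fun t ht => (h' t ht).trans ((norm_add_le _ _).trans ?_)
    rw [norm_smul, norm_coe_sphere, mul_one, Real.norm_of_nonneg ht.le]
  · by_contra hc
    rw [not_le] at hc
    set a : ℝ := inner ℝ b (v : Euc (n + 1)) with ha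
    have h1 := h' (-a) (by linarith)
    have h2 := one_le_pow₀ h1 (n := 2)
    rw [norm_add_sq_real, hb, inner_smul_right, norm_smul, norm_coe_sphere, mul_one, ← ha,
      Real.norm_of_nonneg (by linarith)] at h2
    nlinarith

variable [MetricSpace S] [CompactSpace S] [MeasurableSpace S] [BorelSpace S]

set_option maxHeartbeats 1000000 in
/-- If the scatterers, in the particle frame, are in general position with a margin which is large
compared to `ρ^d`, then the particle collides with the first scatterer in the unit cylinder, and
the collision data are close to the position of that scatterer. -/
lemma exists_colliding {R : FrameMap n} {Q : ScattererConfig n S} {ρ : Radius}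
    {q b p : Euc (n + 1)} {v : UnitSphere n} {e : ℝ}
    (hq : q ∈ Q.centers)
    (hb : ∀ t : ℝ, 0 < t → b + t • (v : Euc (n + 1)) ∉ Metric.ball (0 : Euc (n + 1)) 1)
    (hp : p ∈ Q.centers) (hpq : p ≠ q) {y : Marked n S}
    (hy : frameAction R ρ q v (p, Q.mark p) = y)
    (he : (ρ : ℝ) ^ n * (ρ * (‖b‖ + 2)) ≤ e) (hy0 : e < y.1 0)
    (hy1 : ‖perp y.1 - perp (rowMul b (R.toFun v).1)‖ < 1)
    (h1 : ∀ z ∈ Q.view R ρ q v, -e ≤ z.1 0 → z.1 0 ≤ y.1 0 + e →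
      ‖perp z.1 - perp (rowMul b (R.toFun v).1)‖ ≤ 1 → z = y)
    (h2 : ∀ z ∈ Q.view R ρ q v, |z.1 0| ≤ e → ‖b‖ + 3 < ‖perp z.1‖)
    (h3 : ∀ z ∈ Q.view R ρ q v, |z.1 0 - y.1 0| ≤ e → ‖perp z.1‖ ≤ ‖b‖ + 3 → z = y) :
    ∃ h : (q + (ρ : ℝ) • b, v) ∈ Q.colliding ρ,
      |((collisionData R h).1 : ℝ) - y.1 0| ≤ (ρ : ℝ) ^ n * (ρ * (‖b‖ + 2)) ∧
      ((collisionData R h).2.1 : Euc n) = perp (rowMul b (R.toFun v).1) - perp y.1 ∧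
      (collisionData R h).2.2 = y.2 := by
  subst hy
  set x := perp (rowMul b (R.toFun v).1) with hx
  set F : Euc (n + 1) → Marked n S := fun p' => frameAction R ρ q v (p', Q.mark p') with hF
  change e < (F p).1 0 at hy0
  change ‖perp (F p).1 - x‖ < 1 at hy1
  have hρ := ρ.2.1
  have hρn : 0 < (ρ : ℝ) ^ n := pow_pos hρ n
  have hxb : ‖x‖ ≤ ‖b‖ := norm_perp_frame_le R v b
  have hb0 := norm_nonneg b
  set B : ℝ := inner ℝ b (v : Euc (n + 1)) with hB
  have hBb : |B| ≤ ‖b‖ := by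
    have := abs_real_inner_le_norm b (v : Euc (n + 1))
    rwa [norm_coe_sphere, mul_one] at this
  obtain ⟨hB1, hB2⟩ := abs_le.1 hBb
  -- The time of closest approach to p'. It differs from the axial coordinate of p' − q by the
  -- offset ρ B of the starting point.
  let A : Euc (n + 1) → ℝ := fun p' => inner ℝ (p' - q) (v : Euc (n + 1)) - ρ * B
  have hF0 : ∀ p', (F p').1 0 = ρ ^ n * (A p' + ρ * B) := fun p' => by
    simp only [hF, frameAction_zero, A]
    ring
  have hview : ∀ p' ∈ Q.centers, p' ≠ q → F p' ∈ Q.view R ρ q v := fun p' h h' =>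
    ScattererConfig.mem_view.2 ⟨p', h, h', rfl⟩
  have hinj : ∀ {p'}, F p' = F p → p' = p := fun h =>
    (Prod.mk.inj (frameAction_injective R ρ q v h)).1
  have hnorm : ∀ p' t, ‖q + (ρ : ℝ) • b + t • (v : Euc (n + 1)) - p'‖ ^ 2 =
      (t - A p') ^ 2 + (ρ : ℝ) ^ 2 * ‖perp (F p').1 - x‖ ^ 2 := fun p' t =>
    norm_sq_trajectory R Q ρ q b p' v t
  have hnear : ∀ {p' : Euc (n + 1)} {t : ℝ},
      ‖q + (ρ : ℝ) • b + t • (v : Euc (n + 1)) - p'‖ ≤ ρ → |t - A p'| ≤ ρ ∧ ‖perp (F p').1 - x‖ ≤ 1 := by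
    intro p' t h
    have h4 := pow_le_pow_left₀ (norm_nonneg _) h 2
    rw [hnorm] at h4
    constructor
    · refine abs_le_of_sq_le_sq ?_ hρ.le
      nlinarith [sq_nonneg ((ρ : ℝ) * ‖perp (F p').1 - x‖)]
    · by_contra hc
      have h5 : 1 < ‖perp (F p').1 - x‖ ^ 2 := one_lt_pow₀ (not_le.1 hc) two_ne_zero
      nlinarith [sq_nonneg (t - A p'), mul_lt_mul_of_pos_left h5 (pow_pos hρ 2)]
  obtain ⟨hb1, hb2⟩ := outgoing_of_avoids hb
  have hq_avoid : ∀ t : ℝ, 0 < t → (ρ : ℝ) ≤ ‖q + (ρ : ℝ) • b + t • (v : Euc (n + 1)) - q‖ := by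
    intro t ht
    have h4 := hb (t / ρ) (by positivity)
    rw [mem_ball_zero_iff, not_lt] at h4
    have e1 : q + (ρ : ℝ) • b + t • (v : Euc (n + 1)) - q =
        (ρ : ℝ) • (b + (t / ρ) • (v : Euc (n + 1))) := by
      rw [smul_add, smul_smul, mul_div_cancel₀ _ hρ.ne']
      abel
    rw [e1, norm_smul, Real.norm_of_nonneg hρ.le]
    exact le_mul_of_one_le_right hρ.le h4
  -- the initial condition is admissible
  have hstart : ∀ p' ∈ Q.centers, p' ≠ q → (ρ : ℝ) < ‖q + (ρ : ℝ) • b - p'‖ := by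
    intro p' hp' hne
    by_contra hc
    have h0 : ‖q + (ρ : ℝ) • b + (0 : ℝ) • (v : Euc (n + 1)) - p'‖ ≤ ρ := by
      rw [zero_smul, add_zero]
      exact not_lt.1 hc
    obtain ⟨h4, h5⟩ := hnear h0
    rw [abs_le] at h4
    have h6 : |(F p').1 0| ≤ e := by
      refine le_trans ?_ he
      rw [hF0, abs_mul, abs_of_pos hρn]
      refine mul_le_mul_of_nonneg_left ?_ hρn.le
      rw [abs_le]
      constructor <;> nlinarith
    have h7 := h2 _ (hview p' hp' hne) h6
    have h8 := norm_add_le (perp (F p').1 - x) x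
    rw [sub_add_cancel] at h8
    linarith
  have huntrapped : (q + (ρ : ℝ) • b, v) ∈ Q.untrapped ρ := by
    have hfree : q + (ρ : ℝ) • b ∈ Q.freeSpace ρ := by
      refine ScattererConfig.mem_freeSpace.2 fun p' hp' => ?_
      by_cases hne : p' = q
      · rw [hne, add_sub_cancel_left, norm_smul, Real.norm_of_nonneg hρ.le]
        exact le_mul_of_one_le_right hρ.le hb1
      · exact (hstart p' hp' hne).le
    by_cases hi : q + (ρ : ℝ) • b ∈ interior (Q.freeSpace ρ)
    · exact Or.inl hi
    · refine Or.inr ⟨⟨subset_closure hfree, hi⟩, fun p' hp' h4 => ?_⟩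
      by_cases hne : p' = q
      · subst hne
        simp only [add_sub_cancel_left, norm_smul, Real.norm_of_nonneg hρ.le] at h4 ⊢
        rw [real_inner_smul_left]
        exact mul_nonneg hρ.le (hb2 (by
          rwa [mul_eq_left₀ hρ.ne'] at h4))
      · exact absurd h4 (hstart p' hp' hne).ne'
  -- the free path length
  set σ : ℝ := Real.sqrt (1 - ‖perp (F p).1 - x‖ ^ 2) with hσ
  have hpos : 0 < 1 - ‖perp (F p).1 - x‖ ^ 2 := by
    have := pow_lt_one₀ (norm_nonneg _) hy1 two_ne_zero
    linarith
  have hσ0 : 0 < σ := Real.sqrt_pos.2 hpos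
  have hσ2 : σ ^ 2 = 1 - ‖perp (F p).1 - x‖ ^ 2 := Real.sq_sqrt hpos.le
  have hσ1 : σ ≤ 1 := by nlinarith [sq_nonneg ‖perp (F p).1 - x‖]
  have hA2 : 2 * ρ < A p := by
    have h4 : (ρ : ℝ) ^ n * (ρ * (‖b‖ + 2)) < ρ ^ n * (A p + ρ * B) := by
      rw [← hF0]
      linarith
    have h5 := lt_of_mul_lt_mul_left h4 hρn.le
    nlinarith
  set τ : ℝ := A p - ρ * σ with hτ
  have hτ0 : 0 < τ := by nlinarith
  have hfreepath : Q.freePath ρ (q + (ρ : ℝ) • b) v = ENNReal.ofReal τ := by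
    rw [ScattererConfig.freePath, if_pos huntrapped]
    refine le_antisymm ?_ (le_iInf₂ fun t ht => ENNReal.ofReal_le_ofReal ?_)
    -- The infimum is not attained at τ, where the particle is only on the sphere; the times just
    -- after τ are inside the open ball.
    · have hlim : Tendsto (fun δ : ℝ => ENNReal.ofReal (τ + δ)) (𝓝[>] 0) (𝓝 (ENNReal.ofReal τ)) := by
        have : Tendsto (fun δ : ℝ => ENNReal.ofReal (τ + δ)) (𝓝 0) (𝓝 (ENNReal.ofReal (τ + 0))) :=
          ((ENNReal.continuous_ofReal.comp (continuous_const.add continuous_id)).tendsto 0)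
        rw [add_zero] at this
        exact this.mono_left nhdsWithin_le_nhds
      refine ge_of_tendsto hlim ?_
      have hσρ : 0 < ρ * σ := mul_pos hρ hσ0
      filter_upwards [self_mem_nhdsWithin, mem_nhdsWithin_of_mem_nhds (gt_mem_nhds hσρ)]
        with δ hδ hδ'
      have hδ0 : (0 : ℝ) < δ := hδ
      refine iInf₂_le (τ + δ) ⟨by linarith, fun hc => ?_⟩
      have h4 := pow_le_pow_left₀ hρ.le (ScattererConfig.mem_freeSpace.1 hc p hp) 2
      rw [hnorm] at h4
      have e1 : τ + δ - A p = δ - ρ * σ := by rw [hτ]; ring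
      rw [e1] at h4
      nlinarith
    -- An obstacle met before τ is not q, since the ray avoids the ball at q. Its rescaled position
    -- lies in the region of `h1`, so it must be p, which is not yet reached at that time.
    · by_contra hlt
      rw [not_le] at hlt
      refine ht.2 (ScattererConfig.mem_freeSpace.2 fun p' hp' => ?_)
      by_cases hne : p' = q
      · rw [hne]
        exact hq_avoid t ht.1
      by_contra hc
      obtain ⟨h4, h5⟩ := hnear (not_le.1 hc).le
      rw [abs_le] at h4
      have hρσ : 0 < ρ * σ := mul_pos hρ hσ0
      have h6 : F p' = F p := by
        refine h1 _ (hview p' hp' hne) ?_ ?_ h5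
        · rw [hF0]
          have : -(ρ * (‖b‖ + 2)) ≤ A p' + ρ * B := by nlinarith [ht.1]
          nlinarith [mul_le_mul_of_nonneg_left this hρn.le]
        · change (F p').1 0 ≤ (F p).1 0 + e
          rw [hF0, hF0]
          have : A p' + ρ * B ≤ (A p + ρ * B) + ρ * (‖b‖ + 2) := by nlinarith
          nlinarith [mul_le_mul_of_nonneg_left this hρn.le]
      have h7 := hinj h6
      have h8 : ‖q + (ρ : ℝ) • b + t • (v : Euc (n + 1)) - p'‖ ^ 2 < ρ ^ 2 :=
        pow_lt_pow_left₀ (not_le.1 hc) (norm_nonneg _) two_ne_zero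
      rw [hnorm, h7] at h8
      have h9 : ρ * σ < A p - t := by rw [hτ] at hlt; linarith
      nlinarith [pow_lt_pow_left₀ h9 hρσ.le two_ne_zero]
  have htoReal : (Q.freePath ρ (q + (ρ : ℝ) • b) v).toReal = τ := by
    rw [hfreepath, ENNReal.toReal_ofReal hτ0.le]
  have hsphere : q + (ρ : ℝ) • b + τ • (v : Euc (n + 1)) ∈ Metric.sphere p ρ := by
    rw [mem_sphere_iff_norm, ← sq_eq_sq₀ (norm_nonneg _) hρ.le, hnorm]
    have e1 : τ - A p = -(ρ * σ) := by rw [hτ]; ring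
    rw [e1, neg_sq, mul_pow, hσ2]
    ring
  -- A center within 2ρ of p, other than q, lies within e of the height of y and has transverse norm
  -- at most ‖b‖ + 3, so `h3` identifies it with p. The center q is excluded because p is more than
  -- 2ρ away along v.
  have hsep : Q.Separated ρ p := by
    intro p' hp' hne
    by_contra hc
    rw [not_lt] at hc
    have h4 : |inner ℝ (p' - p) (v : Euc (n + 1))| ≤ 2 * ρ := by
      have := abs_real_inner_le_norm (p' - p) (v : Euc (n + 1))
      rw [norm_coe_sphere, mul_one] at this
      exact this.trans hc
    have h5 : A p' - A p = inner ℝ (p' - p) (v : Euc (n + 1)) := by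
      have e1 : p' - p = (p' - q) - (p - q) := by abel
      rw [e1, inner_sub_left]
      simp only [A]
      ring
    rw [← h5, abs_le] at h4
    by_cases hpq' : p' = q
    · have : A q = -(ρ * B) := by simp [A]
      rw [hpq', this] at h4
      have h4 : (ρ : ℝ) ^ n * (ρ * (‖b‖ + 2)) < ρ ^ n * (A p + ρ * B) := by
        rw [← hF0]
        linarith
      have h5 := lt_of_mul_lt_mul_left h4 hρn.le
      nlinarith
    refine hne (hinj (h3 _ (hview p' hp' hpq') ?_ ?_))
    · refine le_trans ?_ he
      change |(F p').1 0 - (F p).1 0| ≤ _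
      rw [hF0, hF0, ← mul_sub, abs_mul, abs_of_pos hρn]
      refine mul_le_mul_of_nonneg_left ?_ hρn.le
      rw [abs_le]
      constructor <;> nlinarith
    · have h6 : ρ * ‖perp (F p').1 - perp (F p).1‖ ≤ 2 * ρ := by
        have e1 : perp (rowMul (p' - p) (R.toFun v).1) = (ρ : ℝ) • (perp (F p').1 - perp (F p).1) := by
          have e2 : p' - p = (p' - q) - (p - q) := by abel
          simp only [hF, perp_frameAction, ← smul_sub, smul_smul, mul_inv_cancel₀ hρ.ne', one_smul]
          rw [e2, rowMul_sub, perp_sub]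
        have := norm_perp_frame_le R v (p' - p)
        rw [e1, norm_smul, Real.norm_of_nonneg hρ.le] at this
        exact this.trans hc
      have h7 : ‖perp (F p').1 - perp (F p).1‖ ≤ 2 := by nlinarith
      have h8 := norm_add_le (perp (F p').1 - perp (F p).1) ((perp (F p).1 - x) + x)
      rw [sub_add_cancel, sub_add_cancel] at h8
      have h9 := norm_add_le (perp (F p).1 - x) x
      rw [sub_add_cancel] at h9
      linarith
  have hcoll : (q + (ρ : ℝ) • b, v) ∈ Q.colliding ρ := by
    refine ⟨huntrapped, ?_, p, hp, hsep, ?_⟩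
    · change Q.freePath ρ (q + (ρ : ℝ) • b) v < ⊤
      rw [hfreepath]
      exact ENNReal.ofReal_lt_top
    · change q + (ρ : ℝ) • b + (Q.freePath ρ (q + (ρ : ℝ) • b) v).toReal • (v : Euc (n + 1)) ∈ _
      rw [htoReal]
      exact hsphere
  have hcenter : p = hitCenter hcoll := by
    refine hitCenter_unique hcoll hp ?_
    rw [htoReal]
    exact (mem_sphere_iff_norm.1 hsphere).le
  refine ⟨hcoll, ?_, ?_, ?_⟩
  · change |(ρ : ℝ) ^ n * (Q.freePath ρ (q + (ρ : ℝ) • b) v).toReal - (F p).1 0| ≤ _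
    rw [htoReal, hF0, ← mul_sub, abs_mul, abs_of_pos hρn]
    refine mul_le_mul_of_nonneg_left ?_ hρn.le
    rw [abs_le]
    constructor <;> nlinarith
  · change impactParameter R hcoll = x - perp (F p).1
    rw [impactParameter, hitPosition, ← hcenter, htoReal, rowMul_smul, perp_smul,
      perp_frame_trajectory R Q, smul_smul, inv_mul_cancel₀ hρ.ne', one_smul]
  · change Q.mark (hitCenter hcoll) = Q.mark p
    rw [← hcenter]

end Geometry

/-! ### Measurability of the collision data -/

section Measurability

variable {n : ℕ} {S : Type*}

/-- Linear expansion reduces measurability with a varying vector to the measurability in v already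
known for fixed vectors. -/
lemma rowMul_eq_sum (u : Euc n) (A : Matrix (Fin n) (Fin n) ℝ) :
    rowMul u A = ∑ i, u i • rowMul (EuclideanSpace.single i 1) A := by
  ext j
  simp [rowMul, Matrix.vecMul, dotProduct]

lemma measurable_rowMul_frame_comp {V : Type*} [MeasurableSpace V] (R : FrameMap n)
    {u : V → Euc (n + 1)} {w : V → UnitSphere n} (hu : Measurable u) (hw : Measurable w) :
    Measurable fun v => rowMul (u v) (R.toFun (w v)).1 := by
  simp_rw [rowMul_eq_sum (u _)]
  refine Finset.measurable_sum _ fun i _ => ?_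
  have h1 : Continuous fun x : Euc (n + 1) => x i := by fun_prop
  have h2 : Measurable fun v => u v i := h1.measurable.comp hu
  have h3 : Measurable fun v => rowMul (EuclideanSpace.single i 1) (R.toFun (w v)).1 :=
    (measurable_rowMul_frame R _).comp hw
  exact h2.smul h3

variable [MetricSpace S] [CompactSpace S] [MeasurableSpace S] [BorelSpace S]
variable {U : Set (UnitSphere n)}

lemma continuous_startPoint (ρ : Radius) (q : Euc (n + 1)) (β : U →ᵇ Euc (n + 1)) :
    Continuous (startPoint ρ q β) := by
  have h := β.continuous
  change Continuous fun v => q + (ρ : ℝ) • β v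
  fun_prop

lemma ScattererConfig.measurableSet_untrapped (Q : ScattererConfig n S) (ρ : Radius)
    (q : Euc (n + 1)) (β : U →ᵇ Euc (n + 1)) :
    MeasurableSet {v : U | (startPoint ρ q β v, (v : UnitSphere n)) ∈ Q.untrapped ρ} := by
  have hs := (continuous_startPoint ρ q β)
  have hv : Continuous fun v : U => ((v : UnitSphere n) : Euc (n + 1)) :=
    continuous_subtype_val.comp continuous_subtype_val
  refine MeasurableSet.union (hs.measurable isOpen_interior.measurableSet)
    ((hs.measurable isClosed_frontier.measurableSet).inter ?_)
  have e : {v : U | ∀ p ∈ Q.centers, ‖startPoint ρ q β v - p‖ = ρ →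
      0 ≤ inner ℝ (startPoint ρ q β v - p) ((v : UnitSphere n) : Euc (n + 1))} =
      ⋂ p ∈ Q.centers, ({v : U | ‖startPoint ρ q β v - p‖ = ρ}ᶜ ∪
        {v : U | 0 ≤ inner ℝ (startPoint ρ q β v - p) ((v : UnitSphere n) : Euc (n + 1))}) := by
    ext v
    simp only [mem_ofPred_eq, mem_iInter, mem_union, mem_compl_iff]
    exact forall₂_congr fun p _ => imp_iff_not_or
  change MeasurableSet {v : U | ∀ p ∈ Q.centers, ‖startPoint ρ q β v - p‖ = ρ →
      0 ≤ inner ℝ (startPoint ρ q β v - p) ((v : UnitSphere n) : Euc (n + 1))}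
  rw [e]
  refine MeasurableSet.biInter Q.countable_centers fun p _ => MeasurableSet.union ?_ ?_
  · exact (isClosed_eq (hs.sub continuous_const).norm continuous_const).measurableSet.compl
  · exact (isClosed_le continuous_const ((hs.sub continuous_const).inner hv)).measurableSet

/-- On untrapped data the strict sublevel sets are unions over times of preimages of the open set of
obstacles. They are open, although the union is uncountable. -/
lemma ScattererConfig.measurable_freePath (Q : ScattererConfig n S) (ρ : Radius)
    (q : Euc (n + 1)) (β : U →ᵇ Euc (n + 1)) :
    Measurable fun v : U => Q.freePath ρ (startPoint ρ q β v) v := by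
  classical
  have hs := (continuous_startPoint ρ q β)
  have hv : Continuous fun v : U => ((v : UnitSphere n) : Euc (n + 1)) :=
    continuous_subtype_val.comp continuous_subtype_val
  suffices h : Measurable fun v : U => ⨅ (t : ℝ) (_ : 0 < t ∧ startPoint ρ q β v +
      t • ((v : UnitSphere n) : Euc (n + 1)) ∉ Q.freeSpace ρ), ENNReal.ofReal t by
    simp only [ScattererConfig.freePath]
    exact Measurable.ite (Q.measurableSet_untrapped ρ q β) h measurable_const
  refine measurable_of_Iio fun a => ?_
  have e : (fun v : U => ⨅ (t : ℝ) (_ : 0 < t ∧ startPoint ρ q β v +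
      t • ((v : UnitSphere n) : Euc (n + 1)) ∉ Q.freeSpace ρ), ENNReal.ofReal t) ⁻¹' Iio a =
      ⋃ (t : ℝ) (_ : 0 < t ∧ ENNReal.ofReal t < a), (fun v : U => startPoint ρ q β v +
        t • ((v : UnitSphere n) : Euc (n + 1))) ⁻¹' (Q.freeSpace ρ)ᶜ := by
    ext v
    simp only [mem_preimage, mem_Iio, iInf_lt_iff, mem_iUnion, mem_compl_iff]
    constructor
    · rintro ⟨t, ⟨h1, h2⟩, h3⟩
      exact ⟨t, ⟨h1, h3⟩, h2⟩
    · rintro ⟨t, ⟨h1, h3⟩, h2⟩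
      exact ⟨t, ⟨h1, h2⟩, h3⟩
  rw [e]
  refine (isOpen_biUnion fun t _ => (Q.isClosed_freeSpace ρ).isOpen_compl.preimage ?_).measurableSet
  fun_prop

/-- The position of the particle at its first collision. -/
def ScattererConfig.endPoint (Q : ScattererConfig n S) (ρ : Radius)
    (q : Euc (n + 1)) (β : U →ᵇ Euc (n + 1)) (v : U) : Euc (n + 1) :=
  startPoint ρ q β v +
    (Q.freePath ρ (startPoint ρ q β v) v).toReal • ((v : UnitSphere n) : Euc (n + 1))

lemma ScattererConfig.measurable_endPoint (Q : ScattererConfig n S) (ρ : Radius)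
    (q : Euc (n + 1)) (β : U →ᵇ Euc (n + 1)) : Measurable (Q.endPoint ρ q β) := by
  have hv : Continuous fun v : U => ((v : UnitSphere n) : Euc (n + 1)) :=
    continuous_subtype_val.comp continuous_subtype_val
  exact (continuous_startPoint ρ q β).measurable.add
    ((Q.measurable_freePath ρ q β).ennreal_toReal.smul hv.measurable)

lemma ScattererConfig.measurableSet_collidingVelocities (Q : ScattererConfig n S) (ρ : Radius)
    (q : Euc (n + 1)) (β : U →ᵇ Euc (n + 1)) : MeasurableSet (Q.collidingVelocities ρ q β) := by
  have h3 : MeasurableSet (⋃ p ∈ {p | p ∈ Q.centers ∧ Q.Separated ρ p},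
      Q.endPoint ρ q β ⁻¹' Metric.sphere p ρ) :=
    MeasurableSet.biUnion (Q.countable_centers.mono fun p hp => hp.1) fun p _ =>
      Q.measurable_endPoint ρ q β Metric.isClosed_sphere.measurableSet
  convert (Q.measurableSet_untrapped ρ q β).inter
    ((Q.measurable_freePath ρ q β (measurableSet_Iio (a := ⊤))).inter h3) using 1
  ext v
  simp only [ScattererConfig.collidingVelocities, ScattererConfig.colliding, mem_ofPred_eq,
    mem_inter_iff, mem_preimage, mem_Iio, mem_iUnion, exists_prop, and_assoc]
  rfl

/-- By separation, the chosen center is p exactly when the end point lies on the sphere about p. It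
takes countably many values, so even an arbitrary marking composes to a measurable function. -/
lemma measurable_collisionData (R : FrameMap n) (Q : ScattererConfig n S) (ρ : Radius)
    (q : Euc (n + 1)) (β : U →ᵇ Euc (n + 1)) :
    Measurable fun v : Q.collidingVelocities ρ q β => collisionData R v.2 := by
  have hcount : Countable Q.centers := Q.countable_centers.to_subtype
  let f : Q.collidingVelocities ρ q β → Q.centers := fun v =>
    ⟨hitCenter v.2, v.2.2.2.choose_spec.1⟩
  have hf : Measurable f := by
    refine measurable_to_countable' fun p => ?_
    have e : f ⁻¹' {p} = {v : Q.collidingVelocities ρ q β |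
        Q.endPoint ρ q β v ∈ Metric.sphere (p : Euc (n + 1)) ρ} := by
      ext v
      constructor
      · rintro rfl
        exact v.2.2.2.choose_spec.2.2
      · intro h
        exact Subtype.ext (hitCenter_unique v.2 p.2 (mem_sphere_iff_norm.1 h).le).symm
    rw [e]
    exact ((Q.measurable_endPoint ρ q β).comp measurable_subtype_coe)
      Metric.isClosed_sphere.measurableSet
  refine Measurable.prodMk ?_ (Measurable.prodMk ?_ ?_)
  · exact (measurable_const.mul ((Q.measurable_freePath ρ q β).ennreal_toReal.comp
      measurable_subtype_coe)).subtype_mk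
  · refine Measurable.subtype_mk ?_
    have h0 : Measurable fun v : Q.collidingVelocities ρ q β =>
        Q.endPoint ρ q β v - (f v : Euc (n + 1)) :=
      ((Q.measurable_endPoint ρ q β).comp measurable_subtype_coe).sub
        (measurable_subtype_coe.comp hf)
    have h1 := h0.const_smul (ρ : ℝ)⁻¹
    exact continuous_perp.measurable.comp (measurable_rowMul_frame_comp R h1
      (measurable_subtype_coe.comp measurable_subtype_coe))
  · have h1 : Measurable fun p : Q.centers => Q.mark p := Measurable.of_discrete
    exact h1.comp hf

open Classical in
/-- The integrand of the collision integral, extended by zero. -/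
def collisionIntegrand (R : FrameMap n) (Q : ScattererConfig n S)
    (f : (U × Set.Ioi (0 : ℝ) × ImpactSpace n S) →ᵇ ℝ)
    (ρ : Radius) (q : Euc (n + 1)) (β : U →ᵇ Euc (n + 1)) (v : U) : ℝ :=
  if h : (startPoint ρ q β v, (v : UnitSphere n)) ∈ Q.colliding ρ then
      f (v, collisionData R h) else 0

end Measurability

/-! ### Limits of integrals -/

section Integrals

/-- Lower semicontinuity is applied to the nonnegative function ‖f‖ + f. Mass missing from `L j`
does no harm, because ‖f‖ times its mass is at most ‖f‖, the corresponding value for M. -/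
lemma eventually_integral_le_add {X : Type*} [TopologicalSpace X] [MeasurableSpace X]
    [OpensMeasurableSpace X] {M : Measure X} [IsProbabilityMeasure M] {L : ℕ → Measure X}
    [∀ j, IsFiniteMeasure (L j)] (hL : ∀ j, L j univ ≤ 1)
    (h : ∀ G, IsOpen G → M G ≤ liminf (fun j => L j G) atTop) (f : X →ᵇ ℝ) {δ : ℝ} (hδ : 0 < δ) :
    ∀ᶠ j in atTop, ∫ x, f x ∂M ≤ ∫ x, f x ∂L j + δ := by
  set c := ‖f‖
  have hf : ∀ x, 0 ≤ c + f x := fun x => by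
    have := (abs_le.1 (f.norm_coe_le_norm x)).1
    linarith
  have hcont : Continuous fun x => c + f x := continuous_const.add f.continuous
  have h1 := lintegral_le_liminf_lintegral_of_forall_isOpen_measure_le_liminf_measure
    (μ := M) (μs := L) hcont hf h
  have hint : ∀ (N : Measure X) [IsFiniteMeasure N], ∫⁻ x, ENNReal.ofReal (c + f x) ∂N =
      ENNReal.ofReal (c * N.real univ + ∫ x, f x ∂N) := by
    intro N _
    have hi : Integrable (fun x => c + f x) N := (integrable_const c).add (f.integrable N)
    rw [← ofReal_integral_eq_lintegral_ofReal hi (Eventually.of_forall hf), integral_add (integrable_const c) (f.integrable N)]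
    simp [mul_comm]
  simp_rw [hint] at h1
  rw [probReal_univ, mul_one] at h1
  have hlow : 0 ≤ c + ∫ x, f x ∂M := by
    have : 0 ≤ ∫ x, (c + f x) ∂M := integral_nonneg hf
    rw [integral_add (integrable_const c) (f.integrable M)] at this
    simpa using this
  have hup : ∀ j, c * (L j).real univ ≤ c := fun j => by
    refine mul_le_of_le_one_right (norm_nonneg f) ?_
    rw [measureReal_def]
    exact ENNReal.toReal_le_of_le_ofReal zero_le_one (by simpa using hL j)
  -- The strict inequality between extended values needs a positive limit; when the limit is 0, the
  -- integral of f under M equals −‖f‖ and the claim is trivial.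
  rcases hlow.eq_or_lt with h0 | hpos
  · refine Eventually.of_forall fun j => ?_
    have : 0 ≤ ∫ x, (c + f x) ∂L j := integral_nonneg hf
    rw [integral_add (integrable_const c) (f.integrable _)] at this
    simp only [integral_const, smul_eq_mul] at this
    linarith [hup j, mul_comm c ((L j).real univ)]
  · have h2 : ENNReal.ofReal (c + ∫ x, f x ∂M - δ) < ENNReal.ofReal (c + ∫ x, f x ∂M) :=
      (ENNReal.ofReal_lt_ofReal_iff hpos).2 (by linarith)
    filter_upwards [eventually_lt_of_lt_liminf (h2.trans_le h1)] with j hj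
    have h3 := (ENNReal.ofReal_lt_ofReal_iff'.1 hj).1
    linarith [hup j]

/-- One implication of the portmanteau theorem, for sub-probability measures. -/
lemma tendsto_integral_of_isOpen {X : Type*} [TopologicalSpace X] [MeasurableSpace X]
    [OpensMeasurableSpace X] {M : Measure X} [IsProbabilityMeasure M] {L : ℕ → Measure X}
    [∀ j, IsFiniteMeasure (L j)] (hL : ∀ j, L j univ ≤ 1)
    (h : ∀ G, IsOpen G → M G ≤ liminf (fun j => L j G) atTop) (f : X →ᵇ ℝ) :
    Tendsto (fun j => ∫ x, f x ∂L j) atTop (𝓝 (∫ x, f x ∂M)) := by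
  rw [Metric.tendsto_nhds]
  intro ε hε
  filter_upwards [eventually_integral_le_add hL h f (half_pos hε),
    eventually_integral_le_add hL h (-f) (half_pos hε)] with j h1 h2
  simp only [BoundedContinuousFunction.coe_neg, Pi.neg_apply, integral_neg] at h2
  rw [Real.dist_eq, abs_lt]
  constructor <;> linarith

end Integrals

/-! ### The limit integral as an iterated integral against a kernel, and its continuity -/

section LimitIntegral

variable {n : ℕ} {S : Type*} [MetricSpace S] [CompactSpace S] [MeasurableSpace S] [BorelSpace S]
variable {R : FrameMap n} {Q : ScattererConfig n S} {c : ℝ}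
    {m : ProbabilityMeasure S} {μ : S → ProbabilityMeasure (CountingMeasures (Marked n S))}
    {E : Set (Euc (n + 1))}

/-- Masses of open sets are lower semicontinuous in x, hence measurable, and open sets form a
generating π-system. -/
lemma StandingAssumptions.measurable_hitLaw (hyp : StandingAssumptions R Q c m μ E) (hn : 1 ≤ n)
    (s : S) : Measurable fun x : Euc n => hitLaw μ (x, s) := by
  have : ∀ x : Euc n, IsProbabilityMeasure (hitLaw μ (x, s)) :=
    fun x => hyp.isProbabilityMeasure_hitLaw hn (x, s)
  refine Measurable.measure_of_isPiSystem_of_isProbabilityMeasure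
    BorelSpace.measurable_eq isPiSystem_isOpen fun G hG => ?_
  refine measurable_of_Iic fun a => IsClosed.measurableSet (IsSeqClosed.isClosed ?_)
  intro xi x hxi hx
  refine (hyp.hitLaw_le_liminf hn hx tendsto_const_nhds hG).trans ?_
  exact (liminf_le_liminf (Eventually.of_forall hxi)).trans (by simp)

/-- The transition probabilities with a fixed mark, as a kernel. -/
def StandingAssumptions.hitKernel (hyp : StandingAssumptions R Q c m μ E) (hn : 1 ≤ n) (s : S) :
    ProbabilityTheory.Kernel (Euc n) (Set.Ioi (0 : ℝ) × ImpactSpace n S) :=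
  ⟨fun x => hitLaw μ (x, s), hyp.measurable_hitLaw hn s⟩

lemma StandingAssumptions.integral_transitionKernel (hyp : StandingAssumptions R Q c m μ E)
    (hn : 1 ≤ n) (ω : Euc n × S) (F : (Set.Ioi (0 : ℝ) × ImpactSpace n S) →ᵇ ℝ) :
    ∫ ξ, ∫ y, F (ξ, y) * transitionKernel (m : Measure S) μ ω ξ y
      ∂(impactMeasure n (m : Measure S)) ∂posMeasure = ∫ z, F z ∂(hitLaw μ ω) := by
  have := hyp.isProbabilityMeasure_hitLaw hn ω
  set k : Set.Ioi (0 : ℝ) × ImpactSpace n S → ℝ≥0∞ :=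
    fun z => ENNReal.ofReal (transitionKernel (m : Measure S) μ ω z.1 z.2) with hk
  have hkm : Measurable k :=
    (Measure.measurable_rnDeriv _ _).ennreal_toReal.ennreal_ofReal
  have hd := hyp.hitLaw_eq_withDensity hn ω
  have hlt : ∀ᵐ z ∂(posMeasure.prod (impactMeasure n (m : Measure S))), k z < ⊤ :=
    Eventually.of_forall fun z => ENNReal.ofReal_lt_top
  have htr : ∀ z, (k z).toReal * F z = F z * transitionKernel (m : Measure S) μ ω z.1 z.2 :=
    fun z => by
      rw [mul_comm, hk]
      simp only
      rw [ENNReal.toReal_ofReal (show 0 ≤ transitionKernel (m : Measure S) μ ω z.1 z.2 from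
        ENNReal.toReal_nonneg)]
  have hint : Integrable F (hitLaw μ ω) := F.integrable _
  rw [hd] at hint
  have hint' := (integrable_withDensity_iff_integrable_smul' hkm hlt).1 hint
  conv_rhs => rw [hd]
  rw [integral_withDensity_eq_integral_toReal_smul hkm hlt]
  simp only [smul_eq_mul, htr] at hint' ⊢
  exact (integral_prod _ hint').symm

variable {U : Set (UnitSphere n)}

/-- Freezing the direction in a test function. -/
def freezeDirection (f : (U × Set.Ioi (0 : ℝ) × ImpactSpace n S) →ᵇ ℝ) (v : U) :
    (Set.Ioi (0 : ℝ) × ImpactSpace n S) →ᵇ ℝ :=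
  f.compContinuous ⟨fun z => (v, z), by fun_prop⟩

/-- The exit parameter `(β(v) R(v))_⊥`. -/
def exitParameter (R : FrameMap n) (β : U →ᵇ Euc (n + 1)) (v : U) : Euc n :=
  perp (rowMul (β v) (R.toFun v).1)

lemma measurable_exitParameter (R : FrameMap n) (β : U →ᵇ Euc (n + 1)) :
    Measurable (exitParameter R β) :=
  continuous_perp.measurable.comp
    (measurable_rowMul_frame_comp R β.continuous.measurable measurable_subtype_coe)

lemma StandingAssumptions.limitIntegral_eq (hyp : StandingAssumptions R Q c m μ E) (hn : 1 ≤ n)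
    (lam : Measure (UnitSphere n)) (f : (U × Set.Ioi (0 : ℝ) × ImpactSpace n S) →ᵇ ℝ)
    (s : S) (β : U →ᵇ Euc (n + 1)) :
    limitIntegral R (m : Measure S) μ lam f s β =
      ∫ v : U, ∫ z, f (v, z) ∂(hitLaw μ (exitParameter R β v, s)) ∂(lam.comap Subtype.val) := by
  refine integral_congr_ae (Eventually.of_forall fun v => ?_)
  exact hyp.integral_transitionKernel hn _ (freezeDirection f v)

/-- The limit law of the direction and the collision data. -/
def StandingAssumptions.jointLaw (hyp : StandingAssumptions R Q c m μ E) (hn : 1 ≤ n)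
    (lam : Measure U) (s : S) (β : U →ᵇ Euc (n + 1)) :
    Measure (U × Set.Ioi (0 : ℝ) × ImpactSpace n S) :=
  lam.compProd ((hyp.hitKernel hn s).comap _ (measurable_exitParameter R β))

instance (hyp : StandingAssumptions R Q c m μ E) (hn : 1 ≤ n) (s : S) :
    ProbabilityTheory.IsMarkovKernel (hyp.hitKernel hn s) :=
  ⟨fun x => hyp.isProbabilityMeasure_hitLaw hn (x, s)⟩

lemma StandingAssumptions.integral_jointLaw (hyp : StandingAssumptions R Q c m μ E) (hn : 1 ≤ n)
    (lam : Measure U) [IsFiniteMeasure lam] (f : (U × Set.Ioi (0 : ℝ) × ImpactSpace n S) →ᵇ ℝ)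
    (s : S) (β : U →ᵇ Euc (n + 1)) :
    ∫ y, f y ∂(hyp.jointLaw hn lam s β) =
      ∫ v : U, ∫ z, f (v, z) ∂(hitLaw μ (exitParameter R β v, s)) ∂lam :=
  Measure.integral_compProd (f.integrable _)

lemma tendsto_exitParameter {βi : ℕ → U →ᵇ Euc (n + 1)} {β : U →ᵇ Euc (n + 1)}
    (hβ : Tendsto βi atTop (𝓝 β)) {v : U} (hv : ContinuousAt R.toFun v)
    {ι : Type*} {l : Filter ι} {ji : ι → ℕ} {vi : ι → U} (hj : Tendsto ji l atTop)
    (hvi : Tendsto vi l (𝓝 v)) :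
    Tendsto (fun i => exitParameter R (βi (ji i)) (vi i)) l (𝓝 (exitParameter R β v)) := by
  have h1 : Tendsto (fun i => βi (ji i) (vi i)) l (𝓝 (β v)) :=
    (continuous_eval (F := U →ᵇ Euc (n + 1))).tendsto (β, v) |>.comp
      ((hβ.comp hj).prodMk_nhds hvi)
  have h2 : Tendsto (fun i => (R.toFun (vi i)).1) l (𝓝 (R.toFun v).1) :=
    (continuous_subtype_val.tendsto _).comp (hv.tendsto.comp
      ((continuous_subtype_val.tendsto v).comp hvi))
  exact (continuous_perp.tendsto _).comp ((continuous_rowMul.tendsto _).comp (h1.prodMk_nhds h2))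

/-- Dominated convergence over v: for fixed v the exit parameters converge, so semicontinuity of the
hit law gives convergence of the inner integrals. -/
lemma StandingAssumptions.tendsto_limitIntegral (hyp : StandingAssumptions R Q c m μ E)
    (hn : 1 ≤ n) (lam : Measure (UnitSphere n)) [IsFiniteMeasure lam]
    (f : (U × Set.Ioi (0 : ℝ) × ImpactSpace n S) →ᵇ ℝ) {si : ℕ → S} {s : S}
    (hs : Tendsto si atTop (𝓝 s)) {βi : ℕ → U →ᵇ Euc (n + 1)} {β : U →ᵇ Euc (n + 1)}
    (hβ : Tendsto βi atTop (𝓝 β)) :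
    Tendsto (fun j => limitIntegral R (m : Measure S) μ lam f (si j) (βi j)) atTop
      (𝓝 (limitIntegral R (m : Measure S) μ lam f s β)) := by
  simp_rw [hyp.limitIntegral_eq hn]
  have hprob : ∀ ω, IsProbabilityMeasure (hitLaw μ ω) := hyp.isProbabilityMeasure_hitLaw hn
  refine tendsto_integral_of_dominated_convergence (fun _ => ‖f‖) (fun j => ?_)
    (integrable_const _) (fun j => Eventually.of_forall fun v => ?_)
    (Eventually.of_forall fun v => ?_)
  · exact (f.continuous.measurable.stronglyMeasurable.integral_kernel_prod_right'
      (κ := (hyp.hitKernel hn (si j)).comap _ (measurable_exitParameter R (βi j)))).aestronglyMeasurable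
  · refine (norm_integral_le_of_norm_le_const (Eventually.of_forall fun z =>
      f.norm_coe_le_norm (v, z))).trans ?_
    simp
  · refine tendsto_integral_of_isOpen (fun j => prob_le_one) (fun G hG => ?_) (freezeDirection f v)
    refine hyp.hitLaw_le_liminf hn ?_ hs hG
    have h1 : Tendsto (fun j => βi j v) atTop (𝓝 (β v)) :=
      (continuous_eval_const (F := U →ᵇ Euc (n + 1)) v).tendsto β |>.comp hβ
    exact (continuous_perp.tendsto _).comp
      ((continuous_rowMul.tendsto _).comp (h1.prodMk_nhds tendsto_const_nhds))

end LimitIntegral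

/-! ### Convergence of the collision data -/

section CollisionLimit

variable {n : ℕ} {S : Type*} [MetricSpace S] [CompactSpace S] [MeasurableSpace S] [BorelSpace S]
variable {R : FrameMap n} {Q : ScattererConfig n S} {c : ℝ}
    {m : ProbabilityMeasure S} {μ : S → ProbabilityMeasure (CountingMeasures (Marked n S))}
    {E : Set (Euc (n + 1))} {U : Set (UnitSphere n)}

/-- Lets the point of discontinuity of the frame be discarded. -/
lemma sphereMeasure_singleton (hn : 1 ≤ n) (v : UnitSphere n) : sphereMeasure n {v} = 0 := by
  obtain ⟨C, hC⟩ := sphereMeasure_closedBall_le n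
  have h1 : Tendsto (fun t : ℝ => (C : ℝ≥0∞) * ENNReal.ofReal (t ^ n)) (𝓝[>] 0) (𝓝 0) := by
    have h2 : Tendsto (fun t : ℝ => ENNReal.ofReal (t ^ n)) (𝓝 0) (𝓝 (ENNReal.ofReal (0 ^ n))) :=
      (ENNReal.continuous_ofReal.comp (continuous_pow n)).tendsto 0
    have h3 := ENNReal.Tendsto.const_mul (a := (C : ℝ≥0∞)) h2 (Or.inr ENNReal.coe_ne_top)
    rw [zero_pow (by omega), ENNReal.ofReal_zero, mul_zero] at h3
    exact h3.mono_left nhdsWithin_le_nhds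
  refine le_antisymm (ge_of_tendsto h1 ?_) (zero_le)
  filter_upwards [self_mem_nhdsWithin] with t ht
  refine (measure_mono ?_).trans (hC v t ht)
  have ht' : (0 : ℝ) < t := ht
  simpa using ht'.le

lemma isProbabilityMeasure_comap {lam : ProbabilityMeasure (UnitSphere n)} (hU : IsOpen U)
    (hlU : (lam : Measure (UnitSphere n)) U = 1) :
    IsProbabilityMeasure ((lam : Measure (UnitSphere n)).comap (Subtype.val : U → UnitSphere n)) := by
  refine ⟨?_⟩
  rw [comap_subtype_coe_apply hU.measurableSet, image_univ, Subtype.range_coe, hlU]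

/-- The direction and the view of the scatterers become independent in the limit. -/
lemma StandingAssumptions.prod_le_liminf_view [Nonempty S] (hyp : StandingAssumptions R Q c m μ E)
    {T : ℝ} (hT : 1 ≤ T) {lam : ProbabilityMeasure (UnitSphere n)}
    (hlam : (lam : Measure (UnitSphere n)) ≪ sphereMeasure n) (hU : IsOpen U)
    (hlU : (lam : Measure (UnitSphere n)) U = 1) {ρ : ℕ → Radius}
    (hρ : Tendsto (fun j => (ρ j : ℝ)) atTop (𝓝 0)) {q : ℕ → Euc (n + 1)}
    (hq : ∀ᶠ j in atTop, q j ∈ Q.centersIn E T (ρ j)) {s : S}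
    (hs : Tendsto (fun j => Q.mark (q j)) atTop (𝓝 s)) {G : Set (U × (ℕ × ℕ → ℝ))}
    (hG : IsOpen G) :
    (((lam : Measure (UnitSphere n)).comap (Subtype.val : U → UnitSphere n)).prod
      ((μ s : Measure (CountingMeasures (Marked n S))).map CountingMeasures.testVec)) G ≤
      liminf (fun j => ((lam : Measure (UnitSphere n)).comap (Subtype.val : U → UnitSphere n))
        ((fun v : U => (v, (Q.viewMeasure R (ρ j) (q j) v).testVec)) ⁻¹' G)) atTop := by
  have := isProbabilityMeasure_comap hU hlU
  have hΦ := CountingMeasures.continuous_testVec (X := Marked n S)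
  have hprob : IsProbabilityMeasure
      ((μ s : Measure (CountingMeasures (Marked n S))).map CountingMeasures.testVec) :=
    Measure.isProbabilityMeasure_map hΦ.measurable.aemeasurable
  have hZ : ∀ j, Measurable fun v => (Q.viewMeasure R (ρ j) (q j) v).testVec := fun j =>
    hΦ.measurable.comp (Q.measurable_viewMeasure R (ρ j) (q j))
  refine prod_le_liminf _ _ _ (fun j => (hZ j).comp measurable_subtype_coe) ?_ hG
  intro A hA B hB hB0
  have hA' : MeasurableSet (Subtype.val '' A : Set (UnitSphere n)) :=
    hU.measurableSet.subtype_image hA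
  set A' : Set (UnitSphere n) := Subtype.val '' A with hA'def
  have e : ∀ j, ((lam : Measure (UnitSphere n)).comap (Subtype.val : U → UnitSphere n))
      (A ∩ (fun v : U => (Q.viewMeasure R (ρ j) (q j) v).testVec) ⁻¹' B) =
      (lam : Measure (UnitSphere n)) (A' ∩
        (fun v => (Q.viewMeasure R (ρ j) (q j) v).testVec) ⁻¹' B) := fun j => by
    rw [comap_subtype_coe_apply hU.measurableSet]
    congr 1
    exact image_inter_preimage Subtype.val A
      ((fun v => (Q.viewMeasure R (ρ j) (q j) v).testVec) ⁻¹' B)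
  refine Tendsto.congr (fun j => (e j).symm) ?_
  rw [comap_subtype_coe_apply hU.measurableSet, ← hA'def]
  by_cases h0 : (lam : Measure (UnitSphere n)) A' = 0
  · rw [h0, zero_mul]
    refine tendsto_const_nhds.congr fun j => ?_
    exact (measure_mono_null inter_subset_left h0).symm
  -- The conditional law is still absolutely continuous, so [P2] holds for it with the same limit;
  -- this is the source of asymptotic independence.
  let lamA : ProbabilityMeasure (UnitSphere n) :=
    ⟨ProbabilityTheory.cond (lam : Measure (UnitSphere n)) A',
      ProbabilityTheory.cond_isProbabilityMeasure h0⟩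
  have hac : (lamA : Measure (UnitSphere n)) ≪ sphereMeasure n :=
    ProbabilityTheory.cond_absolutelyContinuous.trans hlam
  have hlim := ((ProbabilityMeasure.continuous_map hΦ).tendsto _).comp
    (hyp.tendsto_viewLaw hT hac hρ hq hs)
  have h1 := ProbabilityMeasure.tendsto_measure_of_null_frontier_of_tendsto' hlim (E := B) hB0
  have h2 := ENNReal.Tendsto.const_mul (a := (lam : Measure (UnitSphere n)) A') h1
    (Or.inr (measure_ne_top _ _))
  refine h2.congr fun j => ?_
  change (lam : Measure (UnitSphere n)) A' * (((ProbabilityTheory.cond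
    (lam : Measure (UnitSphere n)) A').map (Q.viewMeasure R (ρ j) (q j))).map
      CountingMeasures.testVec) B = _
  rw [Measure.map_map hΦ.measurable (Q.measurable_viewMeasure R _ _),
    Measure.map_apply (hΦ.measurable.comp (Q.measurable_viewMeasure R _ _)) hB, ProbabilityTheory.cond_apply hA', ← mul_assoc,
    ENNReal.mul_inv_cancel h0 (measure_ne_top _ _), one_mul]
  rfl

/-- Near a configuration in general position, the particle collides, and the collision data are
close to the first point of that configuration. -/
lemma Good.eventually_colliding [Nonempty S] {ρ : ℕ → Radius}
    (hρ : Tendsto (fun j => (ρ j : ℝ)) atTop (𝓝 0)) {q : ℕ → Euc (n + 1)}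
    (hq : ∀ᶠ j in atTop, q j ∈ Q.centers) {βi : ℕ → U →ᵇ Euc (n + 1)} {β : U →ᵇ Euc (n + 1)}
    (hβ : Tendsto βi atTop (𝓝 β))
    (havoid : ∀ j, ∀ v : U, ∀ t : ℝ, 0 < t → βi j v + t • ((v : UnitSphere n) : Euc (n + 1)) ∉
        Metric.ball (0 : Euc (n + 1)) 1)
    {v : U} (hv : ContinuousAt R.toFun v) {ν : CountingMeasures (Marked n S)}
    (h : Good (exitParameter R β v) ν) {z : Set.Ioi (0 : ℝ) × ImpactSpace n S}
    (hz : FirstAt (exitParameter R β v) ν (place (exitParameter R β v) z))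
    {G : Set (U × Set.Ioi (0 : ℝ) × ImpactSpace n S)} (hG : IsOpen G) (hzG : (v, z) ∈ G)
    {ι : Type*} {l : Filter ι} {ji : ι → ℕ} {vi : ι → U} (hj : Tendsto ji l atTop)
    (hvi : Tendsto vi l (𝓝 v))
    (hν : Tendsto (fun i => (Q.viewMeasure R (ρ (ji i)) (q (ji i)) (vi i)).testVec) l
      (𝓝 ν.testVec)) :
    ∀ᶠ i in l, ∃ h : (startPoint (ρ (ji i)) (q (ji i)) (βi (ji i)) (vi i), (vi i : UnitSphere n)) ∈
      Q.colliding (ρ (ji i)), (vi i, collisionData R h) ∈ G := by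
  set x := exitParameter R β v with hx
  set y := place x z with hy
  -- Eventually ‖b‖ ≤ ‖β‖ + 1 for the actual starting offset b, and the collision geometry asks for
  -- transverse clearance ‖b‖ + 3.
  obtain ⟨η, hη, H⟩ := h.eventually_first hz (‖β‖ + 4)
  have hxi := tendsto_exitParameter (R := R) hβ hv hj hvi
  have hρi : Tendsto (fun i => (ρ (ji i) : ℝ) ^ n * (ρ (ji i) * (‖β‖ + 3))) l (𝓝 0) := by
    have := ((hρ.comp hj).pow n).mul ((hρ.comp hj).mul_const (‖β‖ + 3))
    rwa [zero_mul, mul_zero] at this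
  have hβi : ∀ᶠ i in l, ‖βi (ji i)‖ < ‖β‖ + 1 :=
    (hβ.norm.comp hj).eventually (gt_mem_nhds (lt_add_one _))
  obtain ⟨V, hV, W, hW, hVW⟩ := mem_nhds_prod_iff.1 (hG.mem_nhds hzG)
  rw [isOpenEmbedding_ambient.isInducing.nhds_eq_comap, mem_comap] at hW
  obtain ⟨W', hW', hWW'⟩ := hW
  -- Recovers the collision data from the error in the free path, the exit parameter and the
  -- scatterer point; closeness of these three puts the data in the prescribed neighborhood.
  have hΨ : Continuous fun p : ℝ × Euc n × Marked n S =>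
      (p.2.2.1 0 + p.1, p.2.1 - perp p.2.2.1, p.2.2.2) := by
    have : Continuous fun p : ℝ × Euc n × Marked n S => perp p.2.2.1 :=
      continuous_perp.comp (by fun_prop)
    fun_prop
  have hΨ0 : (y.1 0 + 0, x - perp y.1, y.2) = ambient z := by
    simp [hy, place, ambient]
  have hpre := hΨ.tendsto (0, x, y)
  simp only [hΨ0] at hpre
  obtain ⟨D, hD, O, hO, hDO⟩ := mem_nhds_prod_iff.1 (hpre hW')
  obtain ⟨O₁, hO₁, O₂, hO₂, hOO⟩ := mem_nhds_prod_iff.1 hO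
  obtain ⟨r, hr, hrD⟩ := Metric.mem_nhds_iff.1 hD
  have hcyl : IsOpen {p : Euc n × Marked n S | 0 < p.2.1 0 ∧ ‖perp p.2.1 - p.1‖ < 1} := by
    have h1 : Continuous fun p : Euc n × Marked n S => perp p.2.1 :=
      continuous_perp.comp (by fun_prop)
    have h2 : Continuous fun p : Euc n × Marked n S => p.2.1 0 := by fun_prop
    exact (isOpen_lt continuous_const h2).inter
      (isOpen_lt (h1.sub continuous_fst).norm continuous_const)
  obtain ⟨O₃, hO₃, O₄, hO₄, hcyl'⟩ := mem_nhds_prod_iff.1 (hcyl.mem_nhds (x := (x, y)) hz.1.2)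
  have hc0 : Continuous fun z : Marked n S => z.1 0 := by fun_prop
  have hO₅ : {z : Marked n S | |z.1 0 - y.1 0| < η} ∈ 𝓝 y :=
    (isOpen_lt (hc0.sub continuous_const).abs continuous_const).mem_nhds (by simpa using hη)
  filter_upwards [H hν _ (inter_mem (inter_mem hO₂ hO₄) hO₅), hxi hO₁, hxi hO₃,
    hxi (Metric.ball_mem_nhds x hη), hρi (gt_mem_nhds hη), hρi (gt_mem_nhds hr), hβi,
    hvi hV, hj.eventually hq] with i hi hi1 hi2 hi3 hi4 hi5 hi6 hi7 hi8
  obtain ⟨y', ⟨⟨hy2, hy4⟩, hy5⟩, hyp, hu1, hu2, hu3⟩ := hi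
  simp only [ScattererConfig.points_viewMeasure] at hyp hu1 hu2 hu3
  set xi := exitParameter R (βi (ji i)) (vi i) with hxidef
  set b := βi (ji i) (vi i) with hb
  have hbn : ‖b‖ ≤ ‖β‖ + 1 := (BoundedContinuousFunction.norm_coe_le_norm _ _).trans hi6.le
  have hxin : ‖xi‖ ≤ ‖b‖ := norm_perp_frame_le R _ _
  have hin : 0 < y'.1 0 ∧ ‖perp y'.1 - xi‖ < 1 := hcyl' (show (xi, y') ∈ O₃ ×ˢ O₄ from ⟨hi2, hy4⟩)
  have hxx : ‖xi - x‖ < η := by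
    have : xi ∈ Metric.ball x η := hi3
    rwa [mem_ball_iff_norm] at this
  have hy5' : |y'.1 0 - y.1 0| < η := hy5
  have hperp : ‖perp y'.1‖ ≤ ‖β‖ + 4 := by
    have := norm_add_le (perp y'.1 - xi) xi
    rw [sub_add_cancel] at this
    linarith [hin.2]
  obtain ⟨p, hp, hpq, hpy⟩ := ScattererConfig.mem_view.1 hyp
  have hρ0 := (ρ (ji i)).2.1
  have hsmall : ((ρ (ji i) : ℝ)) ^ n * (ρ (ji i) * (‖b‖ + 2)) ≤
      (ρ (ji i) : ℝ) ^ n * (ρ (ji i) * (‖β‖ + 3)) := by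
    gcongr ?_ * (?_ * ?_)
    linarith
  rw [abs_lt] at hy5'
  -- The margin is e = η: the point found is within η of y in height, so windows of width η about it
  -- fit in the 2η-windows about y.
  obtain ⟨hc, hd1, hd2, hd3⟩ := exists_colliding (R := R) (Q := Q) (ρ := ρ (ji i)) (q := q (ji i))
    (b := b) (p := p) (v := vi i) (e := η) hi8 (havoid (ji i) (vi i)) hp hpq hpy
    (hsmall.trans (le_of_lt hi4))
    (by
      by_contra hle
      have := hu2 y' hyp (by rw [abs_of_pos hin.1]; exact not_lt.1 hle)
      linarith)
    hin.2
    (fun z' hz' h1 h2 h3 => hu1 z' hz' h1 (by linarith) (by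
      have := norm_add_le (perp z'.1 - xi) (xi - x)
      rw [sub_add_sub_cancel] at this
      have h3' : ‖perp z'.1 - xi‖ ≤ 1 := h3
      linarith))
    (fun z' hz' h1 => (hu2 z' hz' h1).trans_le' (by linarith))
    (fun z' hz' h1 h2 => hu3 z' hz' (by
      rw [abs_le] at h1 ⊢
      constructor <;> linarith) (by linarith))
  refine ⟨hc, hVW ⟨hi7, hWW' ?_⟩⟩
  have hmem : (((collisionData R hc).1 : ℝ) - y'.1 0, xi, y') ∈ D ×ˢ O := by
    refine ⟨hrD ?_, hOO ⟨hi1, hy2⟩⟩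
    rw [mem_ball_zero_iff, Real.norm_eq_abs]
    exact (hd1.trans hsmall).trans_lt hi5
  have := hDO hmem
  simp only [mem_preimage, add_sub_cancel] at this
  change (((collisionData R hc).1 : ℝ), ((collisionData R hc).2.1 : Euc n), (collisionData R hc).2.2) ∈ W'
  rw [hd2, hd3]
  exact this

end CollisionLimit

/-! ### Convergence of the collision laws, and uniformity by compactness -/

section MainLimit

variable {n : ℕ} {S : Type*} [MetricSpace S] [CompactSpace S] [MeasurableSpace S] [BorelSpace S]
variable {R : FrameMap n} {Q : ScattererConfig n S} {c : ℝ}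
    {m : ProbabilityMeasure S} {μ : S → ProbabilityMeasure (CountingMeasures (Marked n S))}
    {E : Set (Euc (n + 1))} {U : Set (UnitSphere n)}

/-- The law of the direction and the collision data, on the set of colliding velocities. -/
def collisionLaw (R : FrameMap n) (Q : ScattererConfig n S) (lam : Measure U) (ρ : Radius)
    (q : Euc (n + 1)) (β : U →ᵇ Euc (n + 1)) :
    Measure (U × Set.Ioi (0 : ℝ) × ImpactSpace n S) :=
  (lam.comap (Subtype.val : Q.collidingVelocities ρ q β → U)).map
    fun v => (v.1, collisionData R v.2)

lemma measurable_collisionPair (R : FrameMap n) (Q : ScattererConfig n S) (ρ : Radius)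
    (q : Euc (n + 1)) (β : U →ᵇ Euc (n + 1)) :
    Measurable fun v : Q.collidingVelocities ρ q β => (v.1, collisionData R v.2) :=
  measurable_subtype_coe.prodMk (measurable_collisionData R Q ρ q β)

lemma collisionLaw_apply (R : FrameMap n) (Q : ScattererConfig n S) (lam : Measure U) (ρ : Radius)
    (q : Euc (n + 1)) (β : U →ᵇ Euc (n + 1))
    {G : Set (U × Set.Ioi (0 : ℝ) × ImpactSpace n S)} (hG : MeasurableSet G) :
    collisionLaw R Q lam ρ q β G =
      lam {v | ∃ h : (startPoint ρ q β v, (v : UnitSphere n)) ∈ Q.colliding ρ,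
        (v, collisionData R h) ∈ G} := by
  rw [collisionLaw, Measure.map_apply (measurable_collisionPair R Q ρ q β) hG,
    comap_subtype_coe_apply (Q.measurableSet_collidingVelocities ρ q β)]
  congr 1
  ext v
  constructor
  · rintro ⟨w, hw, rfl⟩
    exact ⟨w.2, hw⟩
  · rintro ⟨h, hv⟩
    exact ⟨⟨v, h⟩, hv, rfl⟩

lemma integral_collisionLaw (R : FrameMap n) (Q : ScattererConfig n S)
    (lam : Measure (UnitSphere n)) (ρ : Radius) (q : Euc (n + 1)) (β : U →ᵇ Euc (n + 1))
    (f : (U × Set.Ioi (0 : ℝ) × ImpactSpace n S) →ᵇ ℝ) :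
    ∫ y, f y ∂(collisionLaw R Q (lam.comap Subtype.val) ρ q β) =
      collisionIntegral R Q lam f ρ q β := by
  rw [collisionLaw, integral_map (measurable_collisionPair R Q ρ q β).aemeasurable
    f.continuous.measurable.aestronglyMeasurable]
  change _ = ∫ v in Q.collidingVelocities ρ q β, collisionIntegrand R Q f ρ q β v ∂_
  rw [← integral_subtype_comap (Q.measurableSet_collidingVelocities ρ q β)]
  refine integral_congr_ae (Eventually.of_forall fun v => ?_)
  have hv : (startPoint ρ q β v.1, (v.1 : UnitSphere n)) ∈ Q.colliding ρ := v.2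
  simp only [collisionIntegrand, dif_pos hv]

/-- The lower bound for open sets in the convergence of the collision data. -/
lemma StandingAssumptions.jointLaw_le_liminf (hyp : StandingAssumptions R Q c m μ E) (hn : 1 ≤ n)
    {T : ℝ} (hT : 1 ≤ T) {lam : ProbabilityMeasure (UnitSphere n)}
    (hlam : (lam : Measure (UnitSphere n)) ≪ sphereMeasure n) (hU : IsOpen U)
    (hlU : (lam : Measure (UnitSphere n)) U = 1) {ρ : ℕ → Radius}
    (hρ : Tendsto (fun j => (ρ j : ℝ)) atTop (𝓝 0)) {q : ℕ → Euc (n + 1)}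
    (hq : ∀ j, q j ∈ Q.centersIn E T (ρ j)) {s : S}
    (hs : Tendsto (fun j => Q.mark (q j)) atTop (𝓝 s))
    {βi : ℕ → U →ᵇ Euc (n + 1)} {β : U →ᵇ Euc (n + 1)} (hβ : Tendsto βi atTop (𝓝 β))
    (havoid : ∀ j, ∀ v : U, ∀ t : ℝ, 0 < t → βi j v + t • ((v : UnitSphere n) : Euc (n + 1)) ∉
        Metric.ball (0 : Euc (n + 1)) 1)
    {G : Set (U × Set.Ioi (0 : ℝ) × ImpactSpace n S)} (hG : IsOpen G) :
    hyp.jointLaw hn ((lam : Measure (UnitSphere n)).comap Subtype.val) s β G ≤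
      liminf (fun j => collisionLaw R Q ((lam : Measure (UnitSphere n)).comap Subtype.val)
        (ρ j) (q j) (βi j) G) atTop := by
  have : Nonempty S := ⟨s⟩
  have hprobU := isProbabilityMeasure_comap hU hlU
  set lamU := (lam : Measure (UnitSphere n)).comap (Subtype.val : U → UnitSphere n) with hlamU
  simp_rw [collisionLaw_apply R Q _ _ _ _ hG.measurableSet]
  obtain ⟨v₀, hv₀⟩ := R.continuousOn_compl
  have hΦ := CountingMeasures.continuous_testVec (X := Marked n S)
  set N := (μ s : Measure (CountingMeasures (Marked n S))).map CountingMeasures.testVec with hN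
  have hprobN : IsProbabilityMeasure N := Measure.isProbabilityMeasure_map hΦ.measurable.aemeasurable
  let A : Set (U × (ℕ × ℕ → ℝ)) := {p | (p.1 : UnitSphere n) ≠ v₀ ∧
    ∃ ν : CountingMeasures (Marked n S), ν.testVec = p.2 ∧ Good (exitParameter R β p.1) ν ∧
      ∃ z, FirstAt (exitParameter R β p.1) ν (place (exitParameter R β p.1) z) ∧ (p.1, z) ∈ G}
  have hne : ∀ᵐ v : U ∂lamU, (v : UnitSphere n) ≠ v₀ := by
    refine (measure_eq_zero_iff_ae_notMem (s := {v : U | (v : UnitSphere n) = v₀})).1 ?_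
    rw [hlamU, comap_subtype_coe_apply hU.measurableSet]
    refine measure_mono_null ?_ (hlam (sphereMeasure_singleton hn v₀))
    rintro _ ⟨v, hv, rfl⟩
    exact hv
  -- Fiberwise comparison over v. As A is not known to be measurable, the product measure is
  -- computed on its measurable hull.
  have hMA : hyp.jointLaw hn lamU s β G ≤ (lamU.prod N) A := by
    rw [← measure_toMeasurable A, Measure.prod_apply (measurableSet_toMeasurable _ _),
      StandingAssumptions.jointLaw, Measure.compProd_apply hG.measurableSet]
    refine lintegral_mono_ae ?_
    filter_upwards [hne] with v hv
    have hGv : IsOpen (Prod.mk v ⁻¹' G) := hG.preimage (Continuous.prodMk_right v)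
    change hitLaw μ (exitParameter R β v, s) (Prod.mk v ⁻¹' G) ≤ _
    rw [hyp.hitLaw_apply hn _ _ hGv.measurableSet]
    refine le_trans ?_ (measure_mono (preimage_mono (subset_toMeasurable (lamU.prod N) A)))
    refine le_trans ?_ (Measure.le_map_apply hΦ.measurable.aemeasurable _)
    refine measure_mono_ae ?_
    filter_upwards [hyp.ae_good hn s (exitParameter R β v)] with ν hν hz
    obtain ⟨z, hzG, hz⟩ := hz
    exact ⟨hv, ν, rfl, hν, z, hz, hzG⟩
  refine hMA.trans (measure_le_liminf_of_eventually
    (W := fun j (v : U) => (v, (Q.viewMeasure R (ρ j) (q j) v).testVec))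
    (B := fun j => {v | ∃ h : (startPoint (ρ j) (q j) (βi j) v, (v : UnitSphere n)) ∈
      Q.colliding (ρ j), (v, collisionData R h) ∈ G}) (fun T' hT' =>
      hyp.prod_le_liminf_view hT hlam hU hlU hρ (Eventually.of_forall hq) hs hT') ?_)
  rintro ⟨v, t⟩ ⟨hv, ν, rfl, hν, z, hz, hzG⟩
  set l := comap (fun i : ℕ × U => (i.1, (i.2, (Q.viewMeasure R (ρ i.1) (q i.1) i.2).testVec)))
    (atTop ×ˢ 𝓝 (v, ν.testVec))
  have ht : Tendsto (fun i : ℕ × U => (i.1, (i.2, (Q.viewMeasure R (ρ i.1) (q i.1) i.2).testVec)))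
      l (atTop ×ˢ 𝓝 (v, ν.testVec)) := tendsto_comap
  have hvc : ContinuousAt R.toFun v := hv₀.continuousAt (isOpen_compl_singleton.mem_nhds hv)
  have hj : Tendsto (fun i : ℕ × U => i.1) l atTop := ht.fst
  have ht2 := ht.snd
  have hvi : Tendsto (fun i : ℕ × U => i.2) l (𝓝 v) := (continuous_fst.tendsto _).comp ht2
  have hνi : Tendsto (fun i : ℕ × U => (Q.viewMeasure R (ρ i.1) (q i.1) i.2).testVec) l
      (𝓝 ν.testVec) := (continuous_snd.tendsto _).comp ht2
  exact hν.eventually_colliding hρ (Eventually.of_forall fun j => (hq j).1.1) hβ havoid hvc hz hG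
    hzG hj hvi hνi

/-- Convergence of the collision integrals along sequences. -/
lemma StandingAssumptions.tendsto_collisionIntegral (hyp : StandingAssumptions R Q c m μ E)
    (hn : 1 ≤ n) {T : ℝ} (hT : 1 ≤ T) {lam : ProbabilityMeasure (UnitSphere n)}
    (hlam : (lam : Measure (UnitSphere n)) ≪ sphereMeasure n) (hU : IsOpen U)
    (hlU : (lam : Measure (UnitSphere n)) U = 1) {ρ : ℕ → Radius}
    (hρ : Tendsto (fun j => (ρ j : ℝ)) atTop (𝓝 0)) {q : ℕ → Euc (n + 1)}
    (hq : ∀ j, q j ∈ Q.centersIn E T (ρ j)) {s : S}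
    (hs : Tendsto (fun j => Q.mark (q j)) atTop (𝓝 s))
    {βi : ℕ → U →ᵇ Euc (n + 1)} {β : U →ᵇ Euc (n + 1)} (hβ : Tendsto βi atTop (𝓝 β))
    (havoid : ∀ j, ∀ v : U, ∀ t : ℝ, 0 < t → βi j v + t • ((v : UnitSphere n) : Euc (n + 1)) ∉
        Metric.ball (0 : Euc (n + 1)) 1)
    (f : (U × Set.Ioi (0 : ℝ) × ImpactSpace n S) →ᵇ ℝ) :
    Tendsto (fun j => collisionIntegral R Q (lam : Measure (UnitSphere n)) f (ρ j) (q j) (βi j))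
      atTop (𝓝 (limitIntegral R (m : Measure S) μ (lam : Measure (UnitSphere n)) f s β)) := by
  have hprobU := isProbabilityMeasure_comap hU hlU
  have hM : IsProbabilityMeasure
      (hyp.jointLaw hn ((lam : Measure (UnitSphere n)).comap (Subtype.val : U → UnitSphere n)) s β) := by
    unfold StandingAssumptions.jointLaw
    infer_instance
  have hle : ∀ j, collisionLaw R Q ((lam : Measure (UnitSphere n)).comap Subtype.val)
      (ρ j) (q j) (βi j) univ ≤ 1 := fun j => by
    rw [collisionLaw_apply R Q _ _ _ _ MeasurableSet.univ]
    exact prob_le_one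
  have hfin : ∀ j, IsFiniteMeasure (collisionLaw R Q
      ((lam : Measure (UnitSphere n)).comap Subtype.val) (ρ j) (q j) (βi j)) := fun j =>
    ⟨(hle j).trans_lt ENNReal.one_lt_top⟩
  have h := tendsto_integral_of_isOpen hle (fun G hG =>
    hyp.jointLaw_le_liminf hn hT hlam hU hlU hρ hq hs hβ havoid hG) f
  simp_rw [integral_collisionLaw] at h
  rwa [hyp.integral_jointLaw hn, ← hyp.limitIntegral_eq hn] at h

/-- Convergence of the collision integrals, uniformly in the starting scatterer and the exit
function. -/
lemma StandingAssumptions.exists_radius (hyp : StandingAssumptions R Q c m μ E)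
    (hn : 1 ≤ n) (hU : IsOpen U) {K : Set (U →ᵇ Euc (n + 1))} (hK : IsCompact (closure K))
    (havoid : ∀ β ∈ K, ∀ v : U, ∀ t : ℝ, 0 < t → β v + t • ((v : UnitSphere n) : Euc (n + 1)) ∉
        Metric.ball (0 : Euc (n + 1)) 1)
    {lam : ProbabilityMeasure (UnitSphere n)}
    (hlam : (lam : Measure (UnitSphere n)) ≪ sphereMeasure n)
    (hlU : (lam : Measure (UnitSphere n)) U = 1) {T : ℝ} (hT : 1 ≤ T)
    (f : (U × Set.Ioi (0 : ℝ) × ImpactSpace n S) →ᵇ ℝ) {ε : ℝ} (hε : 0 < ε) :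
    ∃ ρ₀ : Radius, ∀ ρ : Radius, ρ < ρ₀ → ∀ q ∈ Q.centersIn E T ρ, ∀ β ∈ K,
      |collisionIntegral R Q (lam : Measure (UnitSphere n)) f ρ q β -
        limitIntegral R (m : Measure S) μ (lam : Measure (UnitSphere n)) f (Q.mark q) β| < ε := by
  by_contra hcon
  push Not at hcon
  choose ρ hρlt q hq β hβ hbad using fun j => hcon (radSeq j)
  have hρ : Tendsto (fun j => (ρ j : ℝ)) atTop (𝓝 0) :=
    squeeze_zero (fun j => (ρ j).2.1.le) (fun j => (Subtype.coe_lt_coe.2 (hρlt j)).le)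
      tendsto_radSeq
  have hcpt : IsCompact (closure K ×ˢ (univ : Set S)) := hK.prod isCompact_univ
  -- The limit β' may leave K. The avoidance condition is only needed for the functions `β (φ j)`,
  -- which stay in K.
  obtain ⟨⟨β', s⟩, -, φ, hφ, hlim⟩ := hcpt.tendsto_subseq (x := fun j => (β j, Q.mark (q j)))
    fun j => ⟨subset_closure (hβ j), mem_univ _⟩
  have hβ' : Tendsto (fun j => β (φ j)) atTop (𝓝 β') := (continuous_fst.tendsto _).comp hlim
  have hs : Tendsto (fun j => Q.mark (q (φ j))) atTop (𝓝 s) := (continuous_snd.tendsto _).comp hlim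
  have h1 := hyp.tendsto_collisionIntegral hn hT hlam hU hlU (hρ.comp hφ.tendsto_atTop)
    (q := fun j => q (φ j)) (fun j => hq (φ j)) hs hβ' (fun j => havoid _ (hβ (φ j))) f
  have h2 := hyp.tendsto_limitIntegral hn (lam : Measure (UnitSphere n)) f hs hβ'
  have h3 := (h1.sub h2).abs
  rw [sub_self, abs_zero] at h3
  obtain ⟨j, hj⟩ := (h3.eventually (gt_mem_nhds hε)).exists
  exact absurd hj (not_lt.2 (hbad (φ j)))

end MainLimit

end

end LorentzGas

theorem theorem3p6 (n : ℕ) (hn : 1 ≤ n) {S : Type*} [MetricSpace S] [CompactSpace S]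
    [MeasurableSpace S] [BorelSpace S]
    (R : LorentzGas.FrameMap n) (Q : LorentzGas.ScattererConfig n S) (c : ℝ)
    (m : ProbabilityMeasure S)
    (μ : S → ProbabilityMeasure (LorentzGas.CountingMeasures (LorentzGas.Marked n S)))
    (E : Set (LorentzGas.Euc (n + 1)))
    (hyp : LorentzGas.StandingAssumptions R Q c m μ E) :
    (∀ ω' : LorentzGas.Euc n × S,
      IsProbabilityMeasure (LorentzGas.hitLaw μ ω') ∧
      LorentzGas.hitLaw μ ω' =
        (LorentzGas.posMeasure.prod (LorentzGas.impactMeasure n (m : Measure S))).withDensity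
          (fun y => ENNReal.ofReal
            (LorentzGas.transitionKernel (m : Measure S) μ ω' y.1 y.2))) ∧
    ∀ (U : Set (LorentzGas.UnitSphere n)), IsOpen U →
    ∀ (K : Set (U →ᵇ LorentzGas.Euc (n + 1))), IsCompact (closure K) →
    (∀ β ∈ K, ∀ v : U, ∀ t : ℝ, 0 < t →
      β v + t • ((v : LorentzGas.UnitSphere n) : LorentzGas.Euc (n + 1)) ∉
        Metric.ball (0 : LorentzGas.Euc (n + 1)) 1) →
    ∀ (lam : ProbabilityMeasure (LorentzGas.UnitSphere n)),
    (lam : Measure (LorentzGas.UnitSphere n)) ≪ LorentzGas.sphereMeasure n →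
    (lam : Measure (LorentzGas.UnitSphere n)) U = 1 →
    ∀ (T : ℝ), 1 ≤ T →
    ∀ (f : (U × Set.Ioi (0 : ℝ) × LorentzGas.ImpactSpace n S) →ᵇ ℝ),
    ∀ ε : ℝ, 0 < ε → ∃ ρ₀ : LorentzGas.Radius, ∀ ρ : LorentzGas.Radius, ρ < ρ₀ →
      ∀ q ∈ Q.centersIn E T ρ, ∀ β ∈ K,
        |LorentzGas.collisionIntegral R Q (lam : Measure (LorentzGas.UnitSphere n)) f ρ q β -
          LorentzGas.limitIntegral R (m : Measure S) μ
            (lam : Measure (LorentzGas.UnitSphere n)) f (Q.mark q) β| < ε := by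
  refine ⟨fun ω' => ⟨hyp.isProbabilityMeasure_hitLaw hn ω', hyp.hitLaw_eq_withDensity hn ω'⟩, ?_⟩
  intro U hU K hK havoid lam hlam hlU T hT f ε hε
  exact hyp.exists_radius hn hU hK havoid hlam hlU hT f hε
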